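/- **Setting.** Let $n=m+l$ and let $V=U\times W\subset\mathbb C^m\times\mathbb C^l$ be a polydisc centred at $0$ with all radii $<1$ and coordinates $z=(u,w)$, $u_j=r_je^{i\theta_j}$. Let $D=\{u_1\cdots u_m=0\}$, $\phi_D=\sum_{j\le m}\log|u_j|^2$, and $\psi_D=\phi_D-\phi^{sm}\le -1$ on $V$ with $\phi^{sm}$ real smooth and $\inf_V r_j\,\partial\psi_D/\partial r_j>0$ for $j\le m$. Let $\varphi_F=\sum_{k\le l}b_k\log|w_k|^2+\beta$ with constants $b_k\ge 0$ and $\beta\le 0$ real smooth, let $\varphi=\varphi_F+\phi_D$, and let $\omega$ be a smooth hermitian metric on $V$ (for instance a Kähler metric), with coefficient matrix $(h_{j\bar k})$. (This is an admissible polydisc; $m$ is the number $\sigma_V$ of components of $D$ through $0$.) Integrals over $V$, and over coordinate subspaces, are with respect to Lebesgue measure $\lambda$. For an $(n,q)$-form $f=dz_1\wedge\dots\wedge dz_n\wedge\tilde f$ write $|f|^2_{\varphi}=|\tilde f|_\omega^2e^{-\varphi}$, where $\langle\cdot,\cdot\rangle_\omega$ is the pointwise inner product on $(0,q)$-forms with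 $\langle d\bar z_j,d\bar z_k\rangle_\omega=(h^{-1})_{jk}$. **Decompositions.** For $0\le\sigma\le m$, a *regular level-$\sigma$ decomposition* of an $(n,q)$-form $f$ is an identity (a.e. on $V$) $$f=\sum_{P\subset\{1,\dots,m\},\,|P|=\sigma}dz_P\wedge g_P\prod_{j\le m,\,j\notin P}z_j ,\qquad dz_P\wedge g_P=dz_1\wedge\dots\wedge dz_n\wedge\tilde g_P ,$$ with $\tilde g_P$ a $(0,q)$-form, such that for all $P,P'$ the function $h_{P,P'}=\langle g_P,g_{P'}\rangle_{\varphi_F}:=\langle\tilde g_P,\tilde g_{P'}\rangle_\omega e^{-\varphi_F}$ satisfies: * (a) for a.e. $w\in W$, the function $u\mapsto h_{P,P'}(u,w)$ is, where no $u_j$ vanishes, a finite sum of terms $a(u)e^{i\nu\cdot\theta}$ with $a\in C^\infty(U)$ and $\nu\in\mathbb Z^m$; * (b) for every $0\le s\le m$ and all distinct $j_1,\dots,j_s\le m$, the derivative $\partial^s h_{P,P'}/\partial r_{j_s}\cdots\partial r_{j_1}$ is locally integrable on $V$, up to $r_j=0$, with respect to the polar measure $\prod_{j\le m}dr_j\,d\theta_j\;d\lambda(w)$.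 For $|P|=\sigma$ the $\sigma$-lc centre is $S_P=\{u_j=0:\ j\in P\}\cap V$, and $|g_P|^2_{\varphi_F}$ on $S_P$ means the boundary value of $h_{P,P}$ at $r_j=0$ $(j\in P)$, averaged over the angles $\theta_j$ $(j\in P)$; this is the ordinary restriction when $h_{P,P}$ is continuous across $S_P$. Let $\sigma_f$ be the codimension of the minimal lc centres of $(V,D)$ with respect to $f$: the least $\sigma\in\{0,\dots,m\}$ for which $f$ has a regular level-$\sigma$ decomposition with $|g_P|^2_{\varphi_F}\not\equiv 0$ (as an a.e. class) on $S_P$ for some $P$. **Theorem.** Let $f$ be an $(n,q)$-form for which $\sigma_f$ exists, let $(g_P)$ be any regular level-$\sigma_f$ decomposition of $f$, and let $\rho$ be a real smooth function with compact support in $V$. For $P=\{j_1<\dots<j_{\sigma_f}\}$ put $T_jF=\partial_{r_j}\bigl(F/(\tfrac{r_j}{2}\partial_{r_j}\psi_D)\bigr)$ and $$G=\operatorname{Re}\sum_{|P|=|P'|=\sigma_f}\ \prod_{j\in P}\frac1{2r_j}\;\,T_{j_{\sigma_f}}\cdots T_{j_1}\Bigl(\rho\,h_{P,P'}\,\frac{\prod_{j\in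 P}\bar u_j}{\prod_{j\in P'}\bar u_j}\Bigr),$$ a function not depending on $\sigma$ or $\varepsilon$ which contains derivatives of the $\rho\langle g_P,g_{P'}\rangle_{\varphi_F}$ of order at most $\sigma_f$ in directions normal to the lc centres. Then $G\in L^1(V)$, and the following hold. 1. For all real $\sigma\ge\sigma_f$ and $\varepsilon>0$, both integrals below converge absolutely and $$\varepsilon\int_V\frac{\rho|f|^2_{\varphi}}{|\psi_D|^{\sigma+\varepsilon}}=\frac{(-1)^{\sigma_f}\,\varepsilon}{\prod_{j=1}^{\sigma_f}(\sigma-j+\varepsilon)}\int_V\frac{G}{|\psi_D|^{\sigma-\sigma_f+\varepsilon}} .$$ 2. If $\rho\ge 0$ and $\rho\,|g_P|^2_{\varphi_F}$ is not a.e. zero on some $\sigma_f$-lc centre $S_P$, then for all real $0\le\sigma<\sigma_f$ and all $0<\varepsilon\le\sigma_f-\sigma$, $$\varepsilon\int_V\frac{\rho|f|^2_{\varphi}}{|\psi_D|^{\sigma+\varepsilon}}=+\infty .$$ 3. For real $\sigma>\sigma_f$, and also for $\sigma=\sigma_f=0$, $$\lim_{\varepsilon\to0^+}\varepsilon\int_V\frac{\rho|f|^2_\varphi}{|\psi_D|^{\sigma+\varepsilon}}=0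 .$$ 4. For every integer $\sigma\ge1$ with $\sigma_f\le\sigma\le m$ and every regular level-$\sigma$ decomposition $(g_P)_{|P|=\sigma}$ of $f$, each $\rho|g_P|^2_{\varphi_F}$ is integrable on $S_P$ and $$\lim_{\varepsilon\to0^+}\varepsilon\int_V\frac{\rho|f|^2_\varphi}{|\psi_D|^{\sigma+\varepsilon}}=\sum_{|P|=\sigma}\frac{\pi^\sigma}{(\sigma-1)!}\int_{S_P}\rho\,|g_P|^2_{\varphi_F} .$$ -/

import Mathlib

open MeasureTheory Filter Topology
open scoped ContDiff ComplexConjugate ComplexOrder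

noncomputable section

/-- Coordinates `(z_1, …, z_n)` on `ℂⁿ = ℂᵐ × ℂˡ`, split as `z = (u, w)`; the first `m` coordinates
`u` are those in which the divisor is `{u_1 ⋯ u_m = 0}`.  `volume` is Lebesgue measure, i.e. the
measure of the volume form `∏_j (√-1/2) dz_j ∧ dz̄_j`. -/
abbrev Coords (m l : ℕ) : Type := (Fin m → ℂ) × (Fin l → ℂ)

/-- Coefficients at a point of a `(0,q)`-form `Σ'_{J} a_J dz̄^J` in `n` variables, where `J` runs
through the strictly increasing multi-indices `J_1 < ⋯ < J_q`.  An `(n,q)`-form is written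
`dz_1 ∧ ⋯ ∧ dz_n ∧ (Σ'_J a_J dz̄^J)` and has the same coefficients. -/
abbrev AntiForm (n q : ℕ) : Type := (Fin q ↪o Fin n) → ℂ

/-- Pointwise hermitian inner product `⟨a, b⟩_ω` of two `(0,q)`-forms for the hermitian metric with
coefficient matrix `H = (h_{j k̄})`: `⟨dz̄^j, dz̄^k⟩ = (H⁻¹)_{jk}` and
`⟨dz̄^J, dz̄^K⟩ = det (⟨dz̄^{J_a}, dz̄^{K_b}⟩)_{a,b}`. -/
def AntiForm.inner {n q : ℕ} (H : Matrix (Fin n) (Fin n) ℂ) (a b : AntiForm n q) : ℂ :=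
  ∑ J, ∑ K, a J * conj (b K) * (H⁻¹.submatrix J K).det

section Radial

variable {m l : ℕ}

/-- The first-order operator `r_j ∂/∂r_j` on smooth functions, `r_j = |u_j|`. -/
def radialEuler (j : Fin m) (F : Coords m l → ℝ) (z : Coords m l) : ℝ :=
  fderiv ℝ F z (Pi.single j (z.1 j), 0)

/-- The partial derivative `∂/∂r_j` with respect to the radial coordinate `r_j = |u_j|` in polar
coordinates (used at points with `u_j ≠ 0`). -/
def radialDeriv (j : Fin m) (h : Coords m l → ℂ) (z : Coords m l) : ℂ :=
  lineDeriv ℝ h z (Pi.single j (z.1 j / (‖z.1 j‖ : ℂ)), 0)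

/-- The iterated radial derivative `∂/∂r_{j_s} ⋯ ∂/∂r_{j_1}` for a list `[j_1, …, j_s]`. -/
def radialDerivs (L : List (Fin m)) (h : Coords m l → ℂ) : Coords m l → ℂ :=
  L.foldl (fun F j => radialDeriv j F) h

/-- Membership in the algebra `C^∞(U)[e^{± iθ_1}, …, e^{± iθ_m}]`: a finite sum of smooth functions
on `U` times monomials in the phases `e^{iθ_j} = u_j / |u_j|` (which are defined where no `u_j`
vanishes). -/
def IsPolarSmoothOn (U : Set (Fin m → ℂ)) (h : (Fin m → ℂ) → ℂ) : Prop :=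
  ∃ (S : Finset (Fin m → ℤ)) (a : (Fin m → ℤ) → (Fin m → ℂ) → ℂ),
    (∀ ν ∈ S, ContDiffOn ℝ ∞ (a ν) U) ∧
    ∀ u ∈ U, (∀ j, u j ≠ 0) →
      h u = ∑ ν ∈ S, a ν u * ∏ j, (u j / (‖u j‖ : ℂ)) ^ (ν j)

/-- The point `u` with `u_j = t e^{iθ_j}` for `j ∈ P` and the remaining coordinates given by `v`. -/
def polarPoint (P : Finset (Fin m)) (t : ℝ) (θ : {j // j ∈ P} → ℝ) (v : {j // j ∉ P} → ℂ) :
    Fin m → ℂ :=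
  fun j => if hj : j ∈ P then (t : ℂ) * Complex.exp ((θ ⟨j, hj⟩ : ℂ) * Complex.I) else v ⟨j, hj⟩

/-- Restriction of `h` to the coordinate subspace `{u_j = 0 : j ∈ P}` with coordinates
`x = ((u_j)_{j ∉ P}, w)`: the boundary value at `r_P = 0` in polar coordinates, averaged over the
angles `θ_P`.  For functions continuous across the subspace this is the ordinary restriction; the
average is needed because elements of `C^∞[e^{± iθ}]` may have boundary values depending on
`θ_P`. -/
def lcRestrict (P : Finset (Fin m)) (h : Coords m l → ℂ)
    (x : ({j // j ∉ P} → ℂ) × (Fin l → ℂ)) : ℂ :=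
  ((2 * Real.pi : ℝ) : ℂ)⁻¹ ^ P.card *
    ∫ θ in Set.pi Set.univ (fun _ : {j // j ∈ P} => Set.Ioc (0 : ℝ) (2 * Real.pi)),
      limUnder (𝓝[>] (0 : ℝ)) (fun t => h (polarPoint P t θ x.1, x.2))

end Radial

/-- The data on an admissible polydisc `V = U × W` centred at the origin of `ℂᵐ × ℂˡ`:
`D ∩ V = {u_1 ⋯ u_m = 0}`, a smooth potential `smD` with `ψ_D = Σ_j log|u_j|² - smD ≤ -1` and
`inf_V r_j ∂ψ_D/∂r_j > 0`, a potential `φ_F = Σ_k b_k log|w_k|² + β` with `b_k ≥ 0` and `β` smooth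
with `sup_V β ≤ 0`, and a smooth hermitian metric `ω` with coefficient matrix `H`. -/
structure AdmissiblePolydisc (m l : ℕ) where
  /-- radii of `U` -/
  R : Fin m → ℝ
  /-- radii of `W` -/
  S : Fin l → ℝ
  R_pos : ∀ j, 0 < R j
  R_lt_one : ∀ j, R j < 1
  S_pos : ∀ k, 0 < S k
  S_lt_one : ∀ k, S k < 1
  /-- the smooth potential of the line bundle of `D` -/
  smD : Coords m l → ℝ
  smD_smooth : ContDiffOn ℝ ∞ smD {z | (∀ j, ‖z.1 j‖ < R j) ∧ ∀ k, ‖z.2 k‖ < S k}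
  psiD_le : ∀ z : Coords m l, (∀ j, ‖z.1 j‖ < R j) → (∀ k, ‖z.2 k‖ < S k) →
    (∀ j, z.1 j ≠ 0) → (∑ j, Real.log (‖z.1 j‖ ^ 2)) - smD z ≤ -1
  /-- off `D` one has `r_j ∂ψ_D/∂r_j = 2 - r_j ∂smD/∂r_j` -/
  radial_pos : ∀ j, ∃ c : ℝ, 0 < c ∧ ∀ z : Coords m l,
    (∀ i, ‖z.1 i‖ < R i) → (∀ k, ‖z.2 k‖ < S k) → c ≤ 2 - radialEuler j smD z
  b : Fin l → ℝ
  b_nonneg : ∀ k, 0 ≤ b k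
  β : Coords m l → ℝ
  β_smooth : ContDiffOn ℝ ∞ β {z | (∀ j, ‖z.1 j‖ < R j) ∧ ∀ k, ‖z.2 k‖ < S k}
  β_nonpos : ∀ z : Coords m l, (∀ j, ‖z.1 j‖ < R j) → (∀ k, ‖z.2 k‖ < S k) → β z ≤ 0
  /-- coefficient matrix of the hermitian metric `ω` -/
  H : Coords m l → Matrix (Fin (m + l)) (Fin (m + l)) ℂ
  H_smooth : ∀ i j, ContDiffOn ℝ ∞ (fun z => H z i j)
    {z | (∀ j, ‖z.1 j‖ < R j) ∧ ∀ k, ‖z.2 k‖ < S k}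
  H_posDef : ∀ z : Coords m l, (∀ j, ‖z.1 j‖ < R j) → (∀ k, ‖z.2 k‖ < S k) → (H z).PosDef

namespace AdmissiblePolydisc

variable {m l : ℕ} (A : AdmissiblePolydisc m l)

/-- The polydisc `U ⊂ ℂᵐ`. -/
def U : Set (Fin m → ℂ) := {u | ∀ j, ‖u j‖ < A.R j}

/-- The polydisc `W ⊂ ℂˡ`. -/
def W : Set (Fin l → ℂ) := {w | ∀ k, ‖w k‖ < A.S k}

/-- The polydisc `V = U × W`. -/
def V : Set (Coords m l) := A.U ×ˢ A.W

/-- The lc centre `{u_j = 0 : j ∈ P} ∩ V`, in its own coordinates `((u_j)_{j ∉ P}, w)`. -/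
def lcCentre (P : Finset (Fin m)) : Set (({j // j ∉ P} → ℂ) × (Fin l → ℂ)) :=
  {v | ∀ j : {j // j ∉ P}, ‖v j‖ < A.R j.1} ×ˢ A.W

/-- `φ_D = log|u_1 ⋯ u_m|²`. -/
def phiD (z : Coords m l) : ℝ := ∑ j, Real.log (‖z.1 j‖ ^ 2)

/-- `ψ_D = φ_D - smD`. -/
def psiD (z : Coords m l) : ℝ := phiD z - A.smD z

/-- `φ_F = Σ_k b_k log|w_k|² + β`. -/
def phiF (z : Coords m l) : ℝ := (∑ k, A.b k * Real.log (‖z.2 k‖ ^ 2)) + A.β z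

/-- `φ = φ_F + φ_D`. -/
def phi (z : Coords m l) : ℝ := A.phiF z + phiD z

variable {q : ℕ}

/-- The density of `|f|²_{φ,ω} = |f|²_ω e^{-φ}` with respect to Lebesgue measure, for an
`(n,q)`-form `f`. -/
def normSqPhi (f : Coords m l → AntiForm (m + l) q) (z : Coords m l) : ℝ :=
  (AntiForm.inner (A.H z) (f z) (f z)).re * Real.exp (-A.phi z)

/-- `⟨a, b⟩_{φ_F,ω} = ⟨a, b⟩_ω e^{-φ_F}`. -/
def innerF (a b : Coords m l → AntiForm (m + l) q) (z : Coords m l) : ℂ :=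
  AntiForm.inner (A.H z) (a z) (b z) * (Real.exp (-A.phiF z) : ℂ)

/-- A decomposition of the `(n,q)`-form `f` on `V` at level `s`:
`f = Σ_{|P| = s} dz_P ∧ g_P ∏_{j ∉ P, j ≤ m} z_j`, with the relaxed regularity conditions on the
`(n-s,q)`-forms `g_P`.  Here `P` runs through the `s`-element subsets of `{1, …, m}`, and `g_P` is
represented by the `(0,q)`-form `g P` with `dz_P ∧ g_P = dz_1 ∧ ⋯ ∧ dz_n ∧ g P`, i.e.
`g_P = ± dz_{Pᶜ} ∧ g P` (other components of `g_P` do not contribute to `dz_P ∧ g_P`). -/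
structure IsRegularDecomposition (s : ℕ) (f : Coords m l → AntiForm (m + l) q)
    (g : Finset (Fin m) → Coords m l → AntiForm (m + l) q) : Prop where
  eq_sum : ∀ᵐ z ∂(volume.restrict A.V), ∀ J,
    f z J = ∑ P ∈ Finset.powersetCard s (Finset.univ : Finset (Fin m)),
      (∏ j ∈ Pᶜ, z.1 j) * g P z J
  /-- smoothness in the directions of `U` (in the polar sense) for almost every `w` -/
  smooth_U : ∀ P ∈ Finset.powersetCard s (Finset.univ : Finset (Fin m)),
    ∀ P' ∈ Finset.powersetCard s (Finset.univ : Finset (Fin m)),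
    ∀ᵐ w ∂(volume.restrict A.W), IsPolarSmoothOn A.U (fun u => A.innerF (g P) (g P') (u, w))
  /-- the radial derivatives `∂^i/∂r_{j_i} ⋯ ∂r_{j_1}` with distinct `j_1, …, j_i ≤ m` (and
  `0 ≤ i ≤ m`) are locally integrable up to `r_j = 0` in polar coordinates, i.e. with respect to
  `∏_{j ≤ m} dr_j dθ_j · dλ(w)`, whose density against Lebesgue measure is `∏_{j ≤ m} |u_j|⁻¹` -/
  locInt : ∀ P ∈ Finset.powersetCard s (Finset.univ : Finset (Fin m)),
    ∀ P' ∈ Finset.powersetCard s (Finset.univ : Finset (Fin m)),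
    ∀ L : List (Fin m), L.Nodup →
      LocallyIntegrableOn
        (fun z : Coords m l =>
          radialDerivs L (A.innerF (g P) (g P')) z / ((∏ j, ‖z.1 j‖ : ℝ) : ℂ)) A.V volume

/-- The function `|g_P|²_{φ_F,ω}` restricted to the lc centre `{u_j = 0 : j ∈ P}`. -/
def lcNormSq (P : Finset (Fin m)) (gP : Coords m l → AntiForm (m + l) q)
    (x : ({j // j ∉ P} → ℂ) × (Fin l → ℂ)) : ℝ :=
  (lcRestrict P (A.innerF gP gP) x).re

/-- `k` is the codimension `σ_f` of the minimal lc centres of `(V, D ∩ V)` with respect to `f`: the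
least level at which `f` has a decomposition such that some `g_P` does not vanish identically on
the corresponding lc centre. -/
def IsMlcCodim (f : Coords m l → AntiForm (m + l) q) (k : ℕ) : Prop :=
  IsLeast {s : ℕ | s ≤ m ∧ ∃ g, A.IsRegularDecomposition s f g ∧
    ∃ P ∈ Finset.powersetCard s (Finset.univ : Finset (Fin m)),
      ¬ ∀ᵐ x ∂(volume.restrict (A.lcCentre P)), A.lcNormSq P (g P) x = 0} k

/-- The integrand `ρ |f|²_{φ,ω} / |ψ_D|^τ`. -/
def residueIntegrand (ρ : Coords m l → ℝ) (f : Coords m l → AntiForm (m + l) q) (τ : ℝ)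
    (z : Coords m l) : ℝ :=
  ρ z * A.normSqPhi f z / |A.psiD z| ^ τ

/-- The integrand `ρ |g_P|²_{φ_F,ω}` of the residue norm on the lc centre `{u_j = 0 : j ∈ P}`. -/
def lcIntegrand (ρ : Coords m l → ℝ) (P : Finset (Fin m))
    (gP : Coords m l → AntiForm (m + l) q) (x : ({j // j ∉ P} → ℂ) × (Fin l → ℂ)) : ℝ :=
  ρ (polarPoint P 0 0 x.1, x.2) * A.lcNormSq P gP x

/-- The operator `F ↦ ∂/∂r_j (F / (r_j² ∂ψ_D/∂r_j²))`, where
`r_j² ∂ψ_D/∂(r_j²) = (r_j/2) ∂ψ_D/∂r_j = 1 - (r_j/2) ∂smD/∂r_j`. -/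
def radialStep (F : Coords m l → ℂ) (j : Fin m) : Coords m l → ℂ :=
  radialDeriv j (fun z => F z / ((1 - radialEuler j A.smD z / 2 : ℝ) : ℂ))

/-- The density `G_k` with respect to Lebesgue measure, built from radial derivatives of order at
most `k` of `ρ ⟨g_P, g_{P'}⟩_{φ_F,ω}` in the normal directions `r_j`, `j ∈ P`, of the lc centres:
`G_k = Re Σ_{P,P'} ∏_{j ∈ P} (2 r_j)⁻¹ · T_{j_k} ⋯ T_{j_1}
  (ρ ⟨g_P, g_{P'}⟩_{φ_F,ω} ∏_{j ∈ P} ū_j / ∏_{j ∈ P'} ū_j)`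
with `P = {j_1 < ⋯ < j_k}` and `T_j` the operator `radialStep`. -/
def residueG (ρ : Coords m l → ℝ) (k : ℕ)
    (g : Finset (Fin m) → Coords m l → AntiForm (m + l) q) (z : Coords m l) : ℝ :=
  (∑ P ∈ Finset.powersetCard k (Finset.univ : Finset (Fin m)),
    ∑ P' ∈ Finset.powersetCard k (Finset.univ : Finset (Fin m)),
      ((P.sort (· ≤ ·)).foldl A.radialStep
        (fun y => (ρ y : ℂ) * A.innerF (g P) (g P') y *
          ((∏ j ∈ P, conj (y.1 j)) / ∏ j ∈ P', conj (y.1 j)))) z /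
        ((∏ j ∈ P, (2 * ‖z.1 j‖) : ℝ) : ℂ)).re

end AdmissiblePolydisc

end

/-!
The identity is an integration by parts in the radial variables. Expanding `|f|²` by means of a
regular level-`s` decomposition, the powers of the coordinates combine so that `ρ |f|²_φ` becomes a
double sum over `P`, `P'` of terms `κ b h ∏_{j ∈ P} r_j⁻²`, where `h = ⟨g_P, g_{P'}⟩_{φ_F}`, the
smooth cut-off `b` is `ρ ∏_{j ∈ P ∖ P'} ū_j`, and the factor `κ = ∏_{j ∈ P' ∖ P} ū_j⁻¹` does not
involve the coordinates `u_j`, `j ∈ P` (`IsRegularDecomposition.residueIntegrand_eq_re`). In polar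
coordinates in the directions of `P` the Jacobian leaves one power `r_j⁻¹` for each `j ∈ P`, and
since `r_j ∂ψ_D/∂r_j` is positive and bounded below, `r_j⁻¹ |ψ_D|^{-τ}` is the product of
`(r_j ∂ψ_D/∂r_j)⁻¹` and the radial derivative of `|ψ_D|^{1-τ}/(τ-1)`. Integrating by parts once in
each of these directions lowers the exponent by `s = |P|`. There are no boundary terms: `b` has
compact support, and `|ψ_D|^{1-τ}` vanishes at `r_j = 0` when `τ > 1`
(`PartsData.integral_singularDensity`).

The radial derivatives that arise are integrable over `V`: each of the operators `radialStep`
applied to `b h` gives a combination of the assumed radial derivatives of `h` along distinct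
directions with coefficients generated by smooth functions and phases (`RadialComb`). Hence the
density `residueG` is integrable and the right-hand side converges down to `σ = s`.

When no power of `|ψ_D|` is left, the fundamental theorem of calculus evaluates the integral of
the density in the directions of `P` by the boundary values at `r_P = 0`
(`PartsData.integral_partsDensity`). For `P ≠ P'` the factor `b` vanishes there; for `P = P'` the
result is the integral of `ρ |g_P|²_{φ_F}` over the lc centre
(`IsRegularDecomposition.integral_residueG`). Together with dominated convergence as `ε → 0⁺` and
`ε / ∏_{j ≤ s} (s - j + ε) → 1/(s-1)!`, this is the residue formula.

Both remaining limits follow by comparison, as `|ψ_D| ≥ 1`. Above the critical level the integrals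
stay bounded as `ε → 0⁺`. Below it, a finite value would bound the integrals at the critical level
for all `ε > 0`, so the residue at that level would vanish; but it is a sum of integrals of the
functions `ρ |g_P|²_{φ_F} ≥ 0`, nonnegative because the inner product on `(0,q)`-forms is positive
semidefinite (`AntiForm.inner_self_nonneg`, from the Cauchy–Binet formula).
-/

noncomputable section

/-! ### Measures on faces of a box -/

/-- Lebesgue measure on the open face `{0 < r_i < R_i (i ∈ S), r_i = 0 (i ∉ S)}` of a box,
viewed as a measure on the whole space `ι → ℝ`. -/
def faceMeasure {ι : Type*} [Fintype ι] [DecidableEq ι] (R : ι → ℝ) (S : Finset ι) :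
    Measure (ι → ℝ) :=
  Measure.pi fun i => if i ∈ S then volume.restrict (Set.Ioo 0 (R i)) else Measure.dirac 0

instance isFiniteMeasure_ite_restrict_dirac (b : ℝ) (p : Prop) [Decidable p] :
    IsFiniteMeasure (if p then volume.restrict (Set.Ioo 0 b) else Measure.dirac (0 : ℝ)) := by
  split_ifs <;> infer_instance

section FaceMeasure

variable {ι : Type*} [Fintype ι] [DecidableEq ι]

instance (R : ι → ℝ) (S : Finset ι) : IsFiniteMeasure (faceMeasure R S) := by
  unfold faceMeasure; infer_instance

lemma faceMeasure_univ (R : ι → ℝ) :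
    faceMeasure R Finset.univ = Measure.pi fun i => volume.restrict (Set.Ioo 0 (R i)) := by
  simp [faceMeasure]

lemma faceMeasure_empty (R : ι → ℝ) : faceMeasure R ∅ = Measure.dirac 0 := by
  unfold faceMeasure
  refine Measure.pi_eq fun s hs => ?_
  rw [Measure.dirac_apply' _ (MeasurableSet.univ_pi hs)]
  simp only [Finset.notMem_empty, if_false]
  simp_rw [fun i => Measure.dirac_apply' (0 : ℝ) (hs i)]
  by_cases h : ∀ i, (0 : ℝ) ∈ s i
  · rw [Set.indicator_of_mem (by simpa [Set.mem_pi] using h)]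
    simp [Set.indicator_of_mem (h _)]
  · push Not at h
    obtain ⟨i, hi⟩ := h
    rw [Set.indicator_of_notMem (by simpa [Set.mem_pi] using ⟨i, hi⟩)]
    exact (Finset.prod_eq_zero (Finset.mem_univ i) (by simp [hi])).symm

/-- Fubini for one coordinate: the face spanned by `S ∪ {j}` is swept out by moving the `j`-th
coordinate over the face spanned by `S`. -/
lemma measurePreserving_update (R : ι → ℝ) {S : Finset ι} {j : ι} (hj : j ∉ S) :
    MeasurePreserving (fun p : (ι → ℝ) × ℝ => Function.update p.1 j p.2)
      ((faceMeasure R S).prod (volume.restrict (Set.Ioo 0 (R j))))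
      (faceMeasure R (insert j S)) := by
  have hm : Measurable (fun p : (ι → ℝ) × ℝ => Function.update p.1 j p.2) := by
    refine measurable_pi_lambda _ fun i => ?_
    by_cases h : i = j
    · subst h; simpa using measurable_snd
    · simp only [Function.update_of_ne h]
      exact (measurable_pi_apply i).comp measurable_fst
  refine ⟨hm, ?_⟩
  symm
  refine Measure.pi_eq fun s hs => ?_
  rw [Measure.map_apply hm (MeasurableSet.univ_pi hs)]
  have hpre : (fun p : (ι → ℝ) × ℝ => Function.update p.1 j p.2) ⁻¹' Set.univ.pi s =
      (Set.univ.pi (Function.update s j Set.univ)) ×ˢ s j := by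
    ext ⟨x, t⟩
    simp only [Set.mem_preimage, Set.mem_pi, Set.mem_univ, true_imp_iff, Set.mem_prod]
    constructor
    · intro h
      refine ⟨fun i => ?_, by simpa using h j⟩
      by_cases hi : i = j
      · subst hi; simp
      · simpa [Function.update_of_ne hi] using h i
    · rintro ⟨h, ht⟩ i
      by_cases hi : i = j
      · subst hi; simpa using ht
      · simpa [Function.update_of_ne hi] using h i
  rw [hpre, Measure.prod_prod, faceMeasure, Measure.pi_pi,
    ← Finset.prod_erase_mul _ _ (Finset.mem_univ j),
    ← Finset.prod_erase_mul (Finset.univ) (fun i => (if i ∈ insert j S then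
      volume.restrict (Set.Ioo 0 (R i)) else Measure.dirac (0 : ℝ)) (s i)) (Finset.mem_univ j)]
  simp only [hj, if_false, Function.update_self, Finset.mem_insert_self, if_true, measure_univ,
    mul_one]
  congr 1
  refine Finset.prod_congr rfl fun i hi => ?_
  have hne : i ≠ j := Finset.ne_of_mem_erase hi
  simp [Finset.mem_insert, hne]

lemma ae_faceMeasure (R : ι → ℝ) (S : Finset ι) :
    ∀ᵐ x ∂faceMeasure R S, ∀ i, (i ∈ S → x i ∈ Set.Ioo 0 (R i)) ∧ (i ∉ S → x i = 0) := by
  refine eventually_all.2 fun i => ?_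
  refine Measure.tendsto_eval_ae_ae.eventually
    (p := fun t : ℝ => (i ∈ S → t ∈ Set.Ioo 0 (R i)) ∧ (i ∉ S → t = 0)) ?_
  by_cases hi : i ∈ S
  · simp only [hi, if_true, not_true_eq_false, false_imp_iff, and_true, true_imp_iff]
    exact ae_restrict_mem measurableSet_Ioo
  · simp only [hi, if_false, not_false_eq_true, false_imp_iff, true_and, true_imp_iff]
    exact (ae_dirac_iff (measurableSet_singleton (0 : ℝ))).2 rfl

end FaceMeasure

/-! ### Partial polar coordinates -/

/-- Reducing angles from `(-π, π)` to `(0, 2π]`. -/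
lemma measurePreserving_shiftAngle :
    MeasurePreserving (fun θ : ℝ => if θ ≤ 0 then θ + 2 * Real.pi else θ)
      (volume.restrict (Set.Ioo (-Real.pi) Real.pi))
      (volume.restrict (Set.Ioc 0 (2 * Real.pi))) := by
  have hm : Measurable (fun θ : ℝ => if θ ≤ 0 then θ + 2 * Real.pi else θ) :=
    Measurable.ite measurableSet_Iic (measurable_id.add_const _) measurable_id
  refine ⟨hm, ?_⟩
  have hpi := Real.pi_pos
  rw [Measure.restrict_congr_set Ioo_ae_eq_Ioc]
  ext s hs
  rw [Measure.map_apply hm hs, Measure.restrict_apply (hm hs), Measure.restrict_apply hs]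
  rw [← Set.Ioc_union_Ioc_eq_Ioc (by linarith : -Real.pi ≤ 0) hpi.le, Set.inter_union_distrib_left,
    measure_union _ ((hm hs).inter measurableSet_Ioc),
    ← Set.Ioc_union_Ioc_eq_Ioc hpi.le (by linarith : Real.pi ≤ 2 * Real.pi),
    Set.inter_union_distrib_left, measure_union _ (hs.inter measurableSet_Ioc), add_comm]
  · congr 1
    · congr 1
      ext θ
      simp only [Set.mem_inter_iff, Set.mem_preimage, Set.mem_Ioc]
      constructor
      · rintro ⟨h, h1, h2⟩
        rw [if_neg (not_le.2 h1)] at h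
        exact ⟨h, h1, h2⟩
      · rintro ⟨h, h1, h2⟩
        rw [if_neg (not_le.2 h1)]
        exact ⟨h, h1, h2⟩
    · have : (fun θ : ℝ => if θ ≤ 0 then θ + 2 * Real.pi else θ) ⁻¹' s ∩ Set.Ioc (-Real.pi) 0 =
          (fun θ => θ + 2 * Real.pi) ⁻¹' (s ∩ Set.Ioc Real.pi (2 * Real.pi)) := by
        ext θ
        simp only [Set.mem_inter_iff, Set.mem_preimage, Set.mem_Ioc]
        constructor
        · rintro ⟨h, h1, h2⟩
          rw [if_pos h2] at h
          exact ⟨h, by linarith, by linarith⟩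
        · rintro ⟨h, h1, h2⟩
          have h2' : θ ≤ 0 := by linarith
          rw [if_pos h2']
          exact ⟨h, by linarith, h2'⟩
      rw [this, measure_preimage_add_right]
  · refine Set.disjoint_left.2 fun θ h h' => ?_
    exact absurd h.2.2 (not_le.2 h'.2.1)
  · refine Set.disjoint_left.2 fun θ h h' => ?_
    exact absurd h.2.2 (not_le.2 h'.2.1)

section Polar

variable {ι : Type*}

/-- Polar coordinates `u_i = r_i e^{iθ_i}` on `ι → ℂ`. -/
def piPolar (p : (ι → ℝ) × (ι → ℝ)) (i : ι) : ℂ :=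
  (p.1 i : ℂ) * Complex.exp ((p.2 i : ℂ) * Complex.I)

lemma continuous_piPolar : Continuous (piPolar (ι := ι)) := by
  unfold piPolar
  fun_prop

lemma lintegral_piPolar [Fintype ι] [DecidableEq ι] (R : ι → ℝ) (f : (ι → ℂ) → ENNReal)
    (hf : Measurable f) :
    ∫⁻ p, (∏ i, ENNReal.ofReal (p.1 i)) * f (piPolar p)
      ∂((faceMeasure R Finset.univ).prod
        (volume.restrict (Set.pi Set.univ fun _ : ι => Set.Ioc (0 : ℝ) (2 * Real.pi)))) =
    ∫⁻ z in {z : ι → ℂ | ∀ i, ‖z i‖ < R i}, f z := by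
  have hball : MeasurableSet {z : ι → ℂ | ∀ i, ‖z i‖ < R i} := by
    rw [Set.ofPred_forall]
    exact MeasurableSet.iInter fun i =>
      measurableSet_lt (measurable_pi_apply i).norm measurable_const
  rw [faceMeasure_univ, volume_pi, Measure.restrict_pi_pi]
  have hκ := (MeasurePreserving.id
    (Measure.pi fun i => (volume : Measure ℝ).restrict (Set.Ioo 0 (R i)))).prod
    (measurePreserving_pi (fun _ : ι => volume.restrict (Set.Ioo (-Real.pi) Real.pi)) _
      (fun _ => measurePreserving_shiftAngle))
  have hF : Measurable fun p : (ι → ℝ) × (ι → ℝ) =>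
      (∏ i, ENNReal.ofReal (p.1 i)) * f (piPolar p) := by
    refine Measurable.mul ?_ (hf.comp continuous_piPolar.measurable)
    exact Finset.measurable_prod _ fun i _ =>
      ((measurable_pi_apply i).comp measurable_fst).ennreal_ofReal
  rw [← hκ.lintegral_comp hF]
  have hA := measurePreserving_arrowProdEquivProdArrow ℝ ℝ ι
    (fun i => (volume : Measure ℝ).restrict (Set.Ioo 0 (R i)))
    (fun _ => volume.restrict (Set.Ioo (-Real.pi) Real.pi))
  rw [← hA.lintegral_comp_emb (MeasurableEquiv.measurableEmbedding _)]
  rw [← lintegral_indicator hball, ← Complex.lintegral_comp_pi_polarCoord_symm]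
  simp_rw [Measure.prod_restrict]
  rw [← Measure.restrict_pi_pi, ← lintegral_indicator
    (MeasurableSet.univ_pi fun i => measurableSet_Ioo.prod measurableSet_Ioo),
    ← lintegral_indicator (MeasurableSet.univ_pi fun i =>
      Complex.polarCoord.open_target.measurableSet)]
  refine lintegral_congr fun p => ?_
  have key : piPolar ((id : (ι → ℝ) → ι → ℝ) (fun i => (p i).1),
      fun i => if (p i).2 ≤ 0 then (p i).2 + 2 * Real.pi else (p i).2) =
      fun i => Complex.polarCoord.symm (p i) := by
    funext i
    simp only [piPolar, id, Complex.polarCoord_symm_apply]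
    congr 1
    split_ifs
    · push_cast
      rw [add_mul, Complex.exp_add, Complex.exp_two_pi_mul_I, mul_one, Complex.exp_mul_I]
    · rw [Complex.exp_mul_I]; simp
  by_cases h : p ∈ Set.univ.pi fun _ : ι => Complex.polarCoord.target
  · rw [Set.indicator_of_mem h]
    have h0 : ∀ i, 0 < (p i).1 ∧ (p i).2 ∈ Set.Ioo (-Real.pi) Real.pi := fun i => by
      have := h i (Set.mem_univ i)
      rwa [Complex.polarCoord_target, Set.mem_prod] at this
    have hn : ∀ i, ‖Complex.polarCoord.symm (p i)‖ = (p i).1 := fun i => by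
      rw [Complex.norm_polarCoord_symm, abs_of_pos (h0 i).1]
    by_cases h' : ∀ i, (p i).1 < R i
    · rw [Set.indicator_of_mem (fun i _ => ⟨⟨(h0 i).1, h' i⟩, (h0 i).2⟩),
        Set.indicator_of_mem (show _ from fun i => by rw [hn]; exact h' i), ← key]
      rfl
    · rw [Set.indicator_of_notMem (fun h2 => h' fun i => (h2 i (Set.mem_univ i)).1.2),
        Set.indicator_of_notMem (fun h2 => h' fun i => by have := h2 i; rwa [hn] at this), mul_zero]
  · rw [Set.indicator_of_notMem h, Set.indicator_of_notMem]
    refine fun h2 => h fun i _ => ?_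
    rw [Complex.polarCoord_target, Set.mem_prod]
    exact ⟨(h2 i (Set.mem_univ i)).1.1, (h2 i (Set.mem_univ i)).2⟩

end Polar

section PartialPolar

variable {m l : ℕ}

/-- The parameters `(θ_P, (u_j)_{j ∉ P}, w)` which together with the radii `r_P` make up partial
polar coordinates around the lc centre `{u_j = 0 : j ∈ P}`. -/
abbrev PolarBase (l : ℕ) (P : Finset (Fin m)) : Type :=
  ({j // j ∈ P} → ℝ) × (({j // j ∉ P} → ℂ) × (Fin l → ℂ))

/-- Partial polar coordinates: `u_j = r_j e^{iθ_j}` for `j ∈ P`, the other coordinates being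
unchanged. -/
def polarSplit (P : Finset (Fin m)) (r : {j // j ∈ P} → ℝ) (x : PolarBase l P) : Coords m l :=
  (fun j => if hj : j ∈ P then (r ⟨j, hj⟩ : ℂ) * Complex.exp ((x.1 ⟨j, hj⟩ : ℂ) * Complex.I)
    else x.2.1 ⟨j, hj⟩, x.2.2)

lemma polarSplit_fst_mem {P : Finset (Fin m)} (r : {j // j ∈ P} → ℝ) (x : PolarBase l P)
    (j : {j // j ∈ P}) :
    (polarSplit P r x).1 j = (r j : ℂ) * Complex.exp ((x.1 j : ℂ) * Complex.I) := by
  simp [polarSplit]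

lemma polarSplit_fst_notMem {P : Finset (Fin m)} (r : {j // j ∈ P} → ℝ) (x : PolarBase l P)
    (j : {j // j ∉ P}) : (polarSplit P r x).1 j = x.2.1 j := by
  simp [polarSplit, j.2]

lemma norm_polarSplit_mem {P : Finset (Fin m)} (r : {j // j ∈ P} → ℝ) (x : PolarBase l P)
    (j : {j // j ∈ P}) : ‖(polarSplit P r x).1 j‖ = |r j| := by
  rw [polarSplit_fst_mem, norm_mul, Complex.norm_exp_ofReal_mul_I, mul_one, Complex.norm_real,
    Real.norm_eq_abs]

lemma continuous_polarSplit (P : Finset (Fin m)) :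
    Continuous fun y : ({j // j ∈ P} → ℝ) × PolarBase l P => polarSplit P y.1 y.2 := by
  unfold polarSplit
  refine Continuous.prodMk (continuous_pi fun j => ?_) (by fun_prop)
  by_cases hj : j ∈ P
  · simp only [hj, dif_pos]; fun_prop
  · simp only [hj, dif_neg, not_false_eq_true]; fun_prop

namespace AdmissiblePolydisc

variable (A : AdmissiblePolydisc m l)

/-- The radii of the polydisc in the coordinates `u_j`, `j ∈ P`. -/
def radii (P : Finset (Fin m)) (i : {j // j ∈ P}) : ℝ := A.R i

/-- The measure `dθ_P dλ` on the parameters of the polar coordinates around an lc centre. -/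
def baseMeasure (P : Finset (Fin m)) : Measure (PolarBase l P) :=
  (volume.restrict (Set.pi Set.univ fun _ : {j // j ∈ P} => Set.Ioc (0 : ℝ) (2 * Real.pi))).prod
    (volume.restrict (A.lcCentre P))

instance (P : Finset (Fin m)) : SFinite (A.baseMeasure P) := by
  unfold baseMeasure; infer_instance

/-- The polar measure `dr_P dθ_P dλ`. -/
def polarMeasure (P : Finset (Fin m)) : Measure (({j // j ∈ P} → ℝ) × PolarBase l P) :=
  (faceMeasure (A.radii P) Finset.univ).prod (A.baseMeasure P)

lemma isOpen_U : IsOpen A.U := by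
  rw [U, Set.ofPred_forall]
  exact isOpen_iInter_of_finite fun i => isOpen_lt (by fun_prop) continuous_const

lemma isOpen_W : IsOpen A.W := by
  rw [W, Set.ofPred_forall]
  exact isOpen_iInter_of_finite fun i => isOpen_lt (by fun_prop) continuous_const

lemma isOpen_V : IsOpen A.V := A.isOpen_U.prod A.isOpen_W

lemma isOpen_lcCentre (P : Finset (Fin m)) : IsOpen (A.lcCentre P) := by
  refine IsOpen.prod ?_ A.isOpen_W
  rw [Set.ofPred_forall]
  exact isOpen_iInter_of_finite fun i => isOpen_lt (by fun_prop) continuous_const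

lemma lintegral_polarSplit (P : Finset (Fin m)) (f : Coords m l → ENNReal) (hf : Measurable f) :
    ∫⁻ y, (∏ i, ENNReal.ofReal (y.1 i)) * f (polarSplit P y.1 y.2) ∂(A.polarMeasure P) =
      ∫⁻ z in A.V, f z := by
  -- split off the coordinates in `P` on the right-hand side
  have h0 : MeasurePreserving
      (MeasurableEquiv.piEquivPiSubtypeProd (fun _ : Fin m => ℂ) (· ∈ P)).symm
      ((volume : Measure ({j // j ∈ P} → ℂ)).prod (volume : Measure ({j // j ∉ P} → ℂ)))
      (volume : Measure (Fin m → ℂ)) := by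
    convert! (volume_preserving_piEquivPiSubtypeProd (fun _ : Fin m => ℂ) (· ∈ P)).symm using 1
    rw [Measure.volume_eq_prod]
    congr!
  have h1 := (h0.prod (MeasurePreserving.id (volume : Measure (Fin l → ℂ)))).comp
    ((measurePreserving_prodAssoc (volume : Measure ({j // j ∈ P} → ℂ))
      (volume : Measure ({j // j ∉ P} → ℂ)) (volume : Measure (Fin l → ℂ))).symm)
  set j : ({j // j ∈ P} → ℂ) × (({j // j ∉ P} → ℂ) × (Fin l → ℂ)) → Coords m l :=
    Prod.map (MeasurableEquiv.piEquivPiSubtypeProd (fun _ : Fin m => ℂ) (· ∈ P)).symm id ∘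
      MeasurableEquiv.prodAssoc.symm with hjdef
  have hj : ∀ a x, j (a, x) = (fun i => if hi : i ∈ P then a ⟨i, hi⟩ else x.1 ⟨i, hi⟩, x.2) :=
    fun a x => rfl
  have hball : MeasurableSet {a : {j // j ∈ P} → ℂ | ∀ i, ‖a i‖ < A.radii P i} := by
    rw [Set.ofPred_forall]
    exact MeasurableSet.iInter fun i =>
      measurableSet_lt (measurable_pi_apply i).norm measurable_const
  have hpre : j ⁻¹' A.V = {a | ∀ i, ‖a i‖ < A.radii P i} ×ˢ A.lcCentre P := by
    ext ⟨a, x⟩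
    rw [Set.mem_preimage, hj]
    simp only [V, U, lcCentre, Set.mem_prod, Set.mem_ofPred_eq, radii]
    constructor
    · rintro ⟨h, hw⟩
      refine ⟨fun i => by simpa using h i, fun i => ?_, hw⟩
      simpa [i.2] using h i
    · rintro ⟨h, h', hw⟩
      refine ⟨fun i => ?_, hw⟩
      by_cases hi : i ∈ P
      · simpa [hi] using h ⟨i, hi⟩
      · simpa [hi] using h' ⟨i, hi⟩
  have h2 := h1.setLIntegral_comp_preimage A.isOpen_V.measurableSet hf
  change ∫⁻ a in j ⁻¹' A.V, f (j a) ∂(volume.prod (volume.prod volume)) = ∫⁻ z in A.V, f z at h2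
  have hjm : Measurable j := h1.measurable
  rw [← h2, hpre, ← Measure.prod_restrict, lintegral_prod_symm' (fun a => f (j a)) (hf.comp hjm)]
  -- reassociate the left-hand side as `((r, θ), x)`
  have h3 := measurePreserving_prodAssoc (faceMeasure (A.radii P) Finset.univ)
    (volume.restrict (Set.pi Set.univ fun _ : {j // j ∈ P} => Set.Ioc (0 : ℝ) (2 * Real.pi)))
    (volume.restrict (A.lcCentre P))
  have hm : Measurable fun y : ({j // j ∈ P} → ℝ) × PolarBase l P =>
      (∏ i, ENNReal.ofReal (y.1 i)) * f (polarSplit P y.1 y.2) := by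
    refine Measurable.mul ?_ (hf.comp (continuous_polarSplit P).measurable)
    exact Finset.measurable_prod _ fun i _ =>
      ((measurable_pi_apply i).comp measurable_fst).ennreal_ofReal
  rw [polarMeasure, baseMeasure, ← h3.lintegral_comp hm]
  have := Measure.prod.instSFinite (μ := faceMeasure (A.radii P) Finset.univ)
    (ν := (volume : Measure ({j // j ∈ P} → ℝ)).restrict
      (Set.pi Set.univ fun _ => Set.Ioc (0 : ℝ) (2 * Real.pi)))
  refine (lintegral_prod_symm' _ (hm.comp h3.measurable)).trans ?_
  refine lintegral_congr fun x => ?_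
  exact lintegral_piPolar (A.radii P) (fun a => f (j (a, x)))
    (hf.comp (hjm.comp measurable_prodMk_right))

/-- Partial polar coordinates carry the polar measure, weighted by `∏_{j ∈ P} r_j`, to Lebesgue
measure. -/
lemma measurePreserving_polarSplit (P : Finset (Fin m)) :
    MeasurePreserving
      (fun y : ({j // j ∈ P} → ℝ) × PolarBase l P => polarSplit P y.1 y.2)
      ((A.polarMeasure P).withDensity fun y => ∏ i, ENNReal.ofReal (y.1 i))
      (volume.restrict A.V) := by
  have hΨ := (continuous_polarSplit (l := l) P).measurable
  refine ⟨hΨ, ?_⟩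
  ext s hs
  rw [Measure.map_apply hΨ hs, withDensity_apply _ (hΨ hs), ← lintegral_indicator (hΨ hs),
    ← lintegral_indicator_one hs, ← A.lintegral_polarSplit P _ (measurable_one.indicator hs)]
  refine lintegral_congr fun y => ?_
  by_cases hy : polarSplit P y.1 y.2 ∈ s
  · rw [Set.indicator_of_mem (by exact hy), Set.indicator_of_mem hy]; simp
  · rw [Set.indicator_of_notMem (by exact hy), Set.indicator_of_notMem hy]; simp

/-- The product of the radii, the Jacobian of the polar coordinates. -/
def polarJacobian (P : Finset (Fin m)) (r : {j // j ∈ P} → ℝ) : ℝ := ∏ i, r i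

variable {A} in
lemma polarMeasure_ae (P : Finset (Fin m)) :
    ∀ᵐ y ∂(A.polarMeasure P), ∀ i, y.1 i ∈ Set.Ioo 0 (A.radii P i) := by
  have := (Measure.quasiMeasurePreserving_fst (μ := faceMeasure (A.radii P) Finset.univ)
    (ν := A.baseMeasure P)).ae (ae_faceMeasure (A.radii P) Finset.univ)
  filter_upwards [this] with y hy i
  exact (hy i).1 (Finset.mem_univ i)

lemma measurable_polarDensity (P : Finset (Fin m)) :
    Measurable fun y : ({j // j ∈ P} → ℝ) × PolarBase l P => ∏ i, ENNReal.ofReal (y.1 i) :=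
  Finset.measurable_prod _ fun i _ =>
    ((measurable_pi_apply i).comp measurable_fst).ennreal_ofReal

lemma aestronglyMeasurable_polarSplit {P : Finset (Fin m)} {f : Coords m l → ℂ}
    (hf : AEStronglyMeasurable f (volume.restrict A.V)) :
    AEStronglyMeasurable
      (fun y : ({j // j ∈ P} → ℝ) × PolarBase l P => f (polarSplit P y.1 y.2))
      (A.polarMeasure P) := by
  have h1 := hf.comp_measurePreserving (A.measurePreserving_polarSplit P)
  refine h1.mono_ac (withDensity_absolutelyContinuous' (measurable_polarDensity P).aemeasurable ?_)
  filter_upwards [polarMeasure_ae P] with y hpos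
  refine Finset.prod_ne_zero_iff.2 fun i _ => ?_
  simpa using (hpos i).1

lemma integrable_polarSplit_iff {P : Finset (Fin m)} {f : Coords m l → ℂ}
    (hf : AEStronglyMeasurable f (volume.restrict A.V)) :
    IntegrableOn f A.V ↔ Integrable (fun y : ({j // j ∈ P} → ℝ) × PolarBase l P =>
      (polarJacobian P y.1 : ℂ) * f (polarSplit P y.1 y.2)) (A.polarMeasure P) := by
  have hmp := A.measurePreserving_polarSplit P
  rw [IntegrableOn, ← hmp.integrable_comp hf,
    integrable_withDensity_iff_integrable_smul' (measurable_polarDensity P)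
      (ae_of_all _ fun y => ENNReal.prod_lt_top fun i _ => ENNReal.ofReal_lt_top)]
  refine integrable_congr ?_
  filter_upwards [polarMeasure_ae P] with y hpos
  simp only [ENNReal.toReal_prod, Function.comp, polarJacobian, Complex.real_smul]
  congr 2
  exact Finset.prod_congr rfl fun i _ => ENNReal.toReal_ofReal (hpos i).1.le

lemma integral_polarSplit {P : Finset (Fin m)} {f : Coords m l → ℂ}
    (hf : AEStronglyMeasurable f (volume.restrict A.V)) :
    ∫ z in A.V, f z = ∫ y, (polarJacobian P y.1 : ℂ) * f (polarSplit P y.1 y.2)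
      ∂(A.polarMeasure P) := by
  have hmp := A.measurePreserving_polarSplit P
  have h1 : ∫ z in A.V, f z = ∫ y, f (polarSplit P y.1 y.2)
      ∂((A.polarMeasure P).withDensity fun y => ∏ i, ENNReal.ofReal (y.1 i)) := by
    rw [← hmp.map_eq, integral_map hmp.aemeasurable (by rwa [hmp.map_eq])]
  rw [h1, integral_withDensity_eq_integral_toReal_smul (measurable_polarDensity P)
    (ae_of_all _ fun y => ENNReal.prod_lt_top fun i _ => ENNReal.ofReal_lt_top)]
  refine integral_congr_ae ?_
  filter_upwards [polarMeasure_ae P] with y hpos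
  simp only [ENNReal.toReal_prod, polarJacobian, Complex.real_smul]
  congr 2
  exact Finset.prod_congr rfl fun i _ => ENNReal.toReal_ofReal (hpos i).1.le

end AdmissiblePolydisc

end PartialPolar

/-! ### Weighted integration along a ray -/

section Ray

/-- The setting of an integration by parts along a ray `0 < t < b`: `ψ ≤ -1` tends to `-∞` at the
origin, with `t ψ'(t) = 2 E(t)` and `E > 0`. -/
structure IsRayWeight (b : ℝ) (ψ E : ℝ → ℝ) : Prop where
  le : ∀ t ∈ Set.Ioo 0 b, ψ t ≤ -1
  deriv : ∀ t ∈ Set.Ioo 0 b, HasDerivAt ψ (2 * E t / t) t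
  pos : ∀ t ∈ Set.Ioo 0 b, 0 < E t
  cont : ContinuousOn E (Set.Ioo 0 b)
  lim : Tendsto ψ (𝓝[>] 0) atBot

variable {b : ℝ} {ψ E : ℝ → ℝ}

/-- The weight `|ψ|^{-τ} E / t` has primitive `|ψ|^{1-τ} / (2(τ-1))`, which vanishes at `0`. -/
lemma IsRayWeight.integral_weight (h : IsRayWeight b ψ E) {τ : ℝ} (hτ : 1 < τ) {t : ℝ}
    (ht : t ∈ Set.Ioo 0 b) :
    IntegrableOn (fun r => |ψ r| ^ (-τ) * (E r / r)) (Set.Ioc 0 t) ∧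
      ∫ r in Set.Ioc 0 t, |ψ r| ^ (-τ) * (E r / r) = |ψ t| ^ (1 - τ) / (2 * (τ - 1)) := by
  have hτ' : 0 < τ - 1 := by linarith
  set g : ℝ → ℝ := fun r => if r ≤ 0 then 0 else (-ψ r) ^ (1 - τ) / (2 * (τ - 1)) with hg
  have hsub : Set.Ioo 0 t ⊆ Set.Ioo 0 b := Set.Ioo_subset_Ioo_right ht.2.le
  have hder : ∀ x ∈ Set.Ioo 0 b, HasDerivAt g (|ψ x| ^ (-τ) * (E x / x)) x := by
    intro x hx
    have hneg : 0 < -ψ x := by linarith [h.le x hx]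
    have h1 : HasDerivAt (fun r => (-ψ r) ^ (1 - τ) / (2 * (τ - 1)))
        (|ψ x| ^ (-τ) * (E x / x)) x := by
      have h2 := (((h.deriv x hx).neg).rpow_const (p := 1 - τ) (Or.inl hneg.ne')).div_const
        (2 * (τ - 1))
      convert! h2 using 1
      rw [abs_of_neg (by linarith), show 1 - τ - 1 = -τ by ring]
      have := hx.1.ne'
      simp only [Pi.neg_apply]
      field_simp
      ring
    refine h1.congr_of_eventuallyEq ?_
    filter_upwards [lt_mem_nhds hx.1] with r hr
    simp [hg, not_le.2 hr]
  have hcont : ContinuousOn g (Set.Icc 0 t) := by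
    intro x hx
    rcases eq_or_lt_of_le hx.1 with rfl | hx0
    · have hlim : Tendsto (fun r => (-ψ r) ^ (1 - τ) / (2 * (τ - 1))) (𝓝[>] 0) (𝓝 0) := by
        have h1 : Tendsto (fun r => -ψ r) (𝓝[>] 0) atTop := tendsto_neg_atBot_atTop.comp h.lim
        have h2 := (tendsto_rpow_neg_atTop hτ').comp h1
        have h3 := h2.div_const (2 * (τ - 1))
        rw [zero_div] at h3
        refine h3.congr fun r => ?_
        simp [Function.comp]
      have h4 : Tendsto g (𝓝[≥] 0) (𝓝 (g 0)) := by
        have hg0 : g 0 = 0 := by simp [hg]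
        rw [hg0, ← Set.Ioi_insert, nhdsWithin_insert, tendsto_sup]
        refine ⟨by simpa [hg0] using tendsto_pure_nhds g 0, ?_⟩
        refine hlim.congr' ?_
        filter_upwards [self_mem_nhdsWithin] with r hr
        simp [hg, not_le.2 (Set.mem_Ioi.1 hr)]
      exact h4.mono_left (nhdsWithin_mono _ Set.Icc_subset_Ici_self)
    · exact (hder x ⟨hx0, hx.2.trans_lt ht.2⟩).continuousAt.continuousWithinAt
  have hnn : ∀ x ∈ Set.Ioo 0 t, 0 ≤ |ψ x| ^ (-τ) * (E x / x) := fun x hx =>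
    mul_nonneg (Real.rpow_nonneg (abs_nonneg _) _)
      (div_nonneg (h.pos x (hsub hx)).le hx.1.le)
  have hint := intervalIntegral.integrableOn_deriv_of_nonneg hcont
    (fun x hx => hder x (hsub hx)) hnn
  refine ⟨hint, ?_⟩
  have h5 := intervalIntegral.integral_eq_sub_of_hasDerivAt_of_le ht.1.le hcont
    (fun x hx => hder x (hsub hx))
    ((intervalIntegrable_iff_integrableOn_Ioc_of_le ht.1.le).2 hint)
  rw [intervalIntegral.integral_of_le ht.1.le] at h5
  rw [h5]
  have : ψ t < 0 := by linarith [h.le t ht]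
  simp [hg, not_le.2 ht.1, abs_of_neg this]

/-- The primitive of the derivative of a function on `(0, b)` vanishing near `b`. -/
lemma integral_deriv_of_eventually_zero {b' : ℝ} (hb' : b' < b) {K K' : ℝ → ℂ}
    (hK : ∀ t ∈ Set.Ioo 0 b, HasDerivAt K (K' t) t) (hK'c : ContinuousOn K' (Set.Ioo 0 b))
    (hK0 : ∀ t ∈ Set.Ioo 0 b, b' < t → K t = 0) {r : ℝ} (hr : r ∈ Set.Ioo 0 b) :
    IntegrableOn K' (Set.Ioo r b) ∧ ∫ t in Set.Ioo r b, K' t = - K r := by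
  obtain ⟨c, hc1, hc2⟩ := exists_between (max_lt hb' hr.2)
  have hc0 : 0 < c := hr.1.trans ((le_max_right _ _).trans_lt hc1)
  have hrc : r ≤ c := ((le_max_right _ _).trans_lt hc1).le
  have hbc : b' < c := (le_max_left _ _).trans_lt hc1
  have hzero : ∀ t ∈ Set.Ioo c b, K' t = 0 := by
    intro t ht
    have h1 : HasDerivAt K 0 t := by
      refine (hasDerivAt_const t (0 : ℂ)).congr_of_eventuallyEq ?_
      filter_upwards [Ioo_mem_nhds ht.1 ht.2] with s hs
      exact hK0 s ⟨hc0.trans hs.1, hs.2⟩ (hbc.trans hs.1)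
    exact (hK t ⟨hc0.trans ht.1, ht.2⟩).unique h1
  have hsub : Set.Icc r c ⊆ Set.Ioo 0 b := fun t ht => ⟨hr.1.trans_le ht.1, ht.2.trans_lt hc2⟩
  have hii : IntervalIntegrable K' volume r c :=
    (hK'c.mono (by rwa [Set.uIcc_of_le hrc])).intervalIntegrable
  have h1 : IntegrableOn K' (Set.Ioc r c) :=
    (intervalIntegrable_iff_integrableOn_Ioc_of_le hrc).1 hii
  have h2 : IntegrableOn K' (Set.Ioo c b) :=
    (integrableOn_congr_fun (g := fun _ => (0 : ℂ)) hzero measurableSet_Ioo).2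
      integrableOn_zero
  have hun : Set.Ioc r c ∪ Set.Ioo c b = Set.Ioo r b := Set.Ioc_union_Ioo_eq_Ioo hrc hc2
  refine ⟨hun ▸ h1.union h2, ?_⟩
  have hdisj : Disjoint (Set.Ioc r c) (Set.Ioo c b) :=
    Set.disjoint_left.2 fun t h h' => absurd h.2 (not_le.2 h'.1)
  rw [← hun, setIntegral_union hdisj measurableSet_Ioo h1 h2,
    setIntegral_congr_fun (g := fun _ => (0 : ℂ)) measurableSet_Ioo hzero, integral_zero, add_zero,
    ← intervalIntegral.integral_of_le hrc,
    intervalIntegral.integral_eq_sub_of_hasDerivAt (f := K)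
      (fun t ht => hK t (hsub (by rwa [Set.uIcc_of_le hrc] at ht))) hii,
    hK0 c ⟨hc0, hc2⟩ hbc, zero_sub]

variable {b' : ℝ} {K K' : ℝ → ℂ} {τ : ℝ}

lemma IsRayWeight.continuousOn_rpow (h : IsRayWeight b ψ E) (p : ℝ) :
    ContinuousOn (fun t => |ψ t| ^ p) (Set.Ioo 0 b) := by
  refine ContinuousOn.rpow_const
    (fun t ht => ((h.deriv t ht).continuousAt.abs).continuousWithinAt) fun t ht => Or.inl ?_
  have := h.le t ht
  exact abs_ne_zero.2 (by linarith)

lemma IsRayWeight.continuousOn_weight (h : IsRayWeight b ψ E) (p : ℝ) :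
    ContinuousOn (fun t => |ψ t| ^ p * (E t / t)) (Set.Ioo 0 b) :=
  (h.continuousOn_rpow p).mul (h.cont.div continuousOn_id fun _ ht => ht.1.ne')

/-- The kernel `1_{r < t} |ψ(r)|^{-τ} E(r)/r · K'(t)` whose two iterated integrals are compared in
the integration by parts. -/
def rayKernel (ψ E : ℝ → ℝ) (τ : ℝ) (K' : ℝ → ℂ) (p : ℝ × ℝ) : ℂ :=
  {p : ℝ × ℝ | p.1 < p.2}.indicator
    (fun p => ((|ψ p.1| ^ (-τ) * (E p.1 / p.1) : ℝ) : ℂ) * K' p.2) p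

lemma IsRayWeight.aestronglyMeasurable_rayKernel (h : IsRayWeight b ψ E)
    (hK'c : ContinuousOn K' (Set.Ioo 0 b)) :
    AEStronglyMeasurable (rayKernel ψ E τ K')
      ((volume.restrict (Set.Ioo 0 b)).prod (volume.restrict (Set.Ioo 0 b))) := by
  unfold rayKernel
  refine AEStronglyMeasurable.indicator ?_ (measurableSet_lt measurable_fst measurable_snd)
  have h1 : AEStronglyMeasurable (fun t => ((|ψ t| ^ (-τ) * (E t / t) : ℝ) : ℂ))
      (volume.restrict (Set.Ioo 0 b)) :=
    (Complex.continuous_ofReal.comp_continuousOn (h.continuousOn_weight _)).aestronglyMeasurable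
      measurableSet_Ioo
  have h2 : AEStronglyMeasurable K' (volume.restrict (Set.Ioo 0 b)) :=
    hK'c.aestronglyMeasurable measurableSet_Ioo
  exact h1.comp_fst.mul h2.comp_snd

/-- Integrating the kernel in `t` gives `-K` times the weight. -/
lemma integral_rayKernel_snd (hb' : b' < b)
    (hK : ∀ t ∈ Set.Ioo 0 b, HasDerivAt K (K' t) t) (hK'c : ContinuousOn K' (Set.Ioo 0 b))
    (hK0 : ∀ t ∈ Set.Ioo 0 b, b' < t → K t = 0) {r : ℝ} (hr : r ∈ Set.Ioo 0 b) :
    ∫ t in Set.Ioo 0 b, rayKernel ψ E τ K' (r, t) =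
      -(K r * ((|ψ r| ^ (-τ) * (E r / r) : ℝ) : ℂ)) := by
  have h1 : ∀ t, rayKernel ψ E τ K' (r, t) = (Set.Ioi r).indicator
      (fun t => ((|ψ r| ^ (-τ) * (E r / r) : ℝ) : ℂ) * K' t) t := fun t => by
    by_cases hrt : r < t
    · rw [rayKernel, Set.indicator_of_mem (by exact hrt), Set.indicator_of_mem (by exact hrt)]
    · rw [rayKernel, Set.indicator_of_notMem (by exact hrt), Set.indicator_of_notMem (by exact hrt)]
  simp_rw [h1]
  rw [setIntegral_indicator measurableSet_Ioi,
    show Set.Ioo 0 b ∩ Set.Ioi r = Set.Ioo r b by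
      ext t; simp only [Set.mem_inter_iff, Set.mem_Ioo, Set.mem_Ioi]
      exact ⟨fun h => ⟨h.2, h.1.2⟩, fun h => ⟨⟨hr.1.trans h.1, h.2⟩, h.1⟩⟩,
    integral_const_mul, (integral_deriv_of_eventually_zero hb' hK hK'c hK0 hr).2]
  ring

/-- Slices of the kernel in `r`. -/
lemma IsRayWeight.rayKernel_fst (h : IsRayWeight b ψ E) (hτ : 1 < τ) {t : ℝ}
    (ht : t ∈ Set.Ioo 0 b) :
    IntegrableOn (fun r => rayKernel ψ E τ K' (r, t)) (Set.Ioo 0 b) ∧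
    ∫ r in Set.Ioo 0 b, rayKernel ψ E τ K' (r, t) =
      ((1 / (2 * (τ - 1)) : ℝ) : ℂ) * (K' t * ((|ψ t| ^ (1 - τ) : ℝ) : ℂ)) ∧
    ∫⁻ r in Set.Ioo 0 b, ‖rayKernel ψ E τ K' (r, t)‖ₑ =
      ENNReal.ofReal (1 / (2 * (τ - 1))) * (‖K' t‖ₑ * ENNReal.ofReal (|ψ t| ^ (1 - τ))) := by
  obtain ⟨hI, hV⟩ := h.integral_weight hτ ht
  have h1 : ∀ r, rayKernel ψ E τ K' (r, t) = (Set.Iio t).indicator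
      (fun r => ((|ψ r| ^ (-τ) * (E r / r) : ℝ) : ℂ) * K' t) r := fun r => by
    by_cases hrt : r < t
    · rw [rayKernel, Set.indicator_of_mem (by exact hrt), Set.indicator_of_mem (by exact hrt)]
    · rw [rayKernel, Set.indicator_of_notMem (by exact hrt), Set.indicator_of_notMem (by exact hrt)]
  have hset : Set.Ioo 0 b ∩ Set.Iio t = Set.Ioo 0 t := by
    ext r; simp only [Set.mem_inter_iff, Set.mem_Ioo, Set.mem_Iio]
    exact ⟨fun h => ⟨h.1.1, h.2⟩, fun h => ⟨⟨h.1, h.2.trans ht.2⟩, h.2⟩⟩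
  have hI' : IntegrableOn (fun r => |ψ r| ^ (-τ) * (E r / r)) (Set.Ioo 0 t) :=
    hI.mono_set Set.Ioo_subset_Ioc_self
  have hτ' : 0 < τ - 1 := by linarith
  refine ⟨?_, ?_, ?_⟩
  · simp_rw [h1]
    rw [integrableOn_indicator_iff measurableSet_Iio, Set.inter_comm, hset]
    exact hI'.ofReal.mul_const _
  · simp_rw [h1]
    rw [setIntegral_indicator measurableSet_Iio, hset, integral_mul_const, integral_complex_ofReal,
      ← integral_Ioc_eq_integral_Ioo, hV]
    push_cast
    ring
  · simp_rw [h1, enorm_indicator_eq_indicator_enorm]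
    rw [setLIntegral_indicator measurableSet_Iio, Set.inter_comm, hset]
    simp_rw [enorm_mul]
    rw [lintegral_mul_const' _ _ enorm_ne_top]
    have h2 : ∫⁻ r in Set.Ioo 0 t, ‖((|ψ r| ^ (-τ) * (E r / r) : ℝ) : ℂ)‖ₑ =
        ENNReal.ofReal (|ψ t| ^ (1 - τ) / (2 * (τ - 1))) := by
      rw [← hV, integral_Ioc_eq_integral_Ioo, ofReal_integral_eq_lintegral_ofReal hI']
      · refine setLIntegral_congr_fun measurableSet_Ioo fun r hr => ?_
        have : 0 ≤ |ψ r| ^ (-τ) * (E r / r) := mul_nonneg (Real.rpow_nonneg (abs_nonneg _) _)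
          (div_nonneg (h.pos r ⟨hr.1, hr.2.trans ht.2⟩).le hr.1.le)
        rw [← ofReal_norm, Complex.norm_real, Real.norm_of_nonneg this]
      · filter_upwards [ae_restrict_mem measurableSet_Ioo] with r hr
        exact mul_nonneg (Real.rpow_nonneg (abs_nonneg _) _)
          (div_nonneg (h.pos r ⟨hr.1, hr.2.trans ht.2⟩).le hr.1.le)
    rw [h2, div_eq_mul_one_div, ENNReal.ofReal_mul (Real.rpow_nonneg (abs_nonneg _) _)]
    ring

/-- Integration by parts along a ray, as an inequality between absolute integrals. -/
lemma IsRayWeight.lintegral_le (h : IsRayWeight b ψ E) (hτ : 1 < τ) (hb' : b' < b)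
    (hK : ∀ t ∈ Set.Ioo 0 b, HasDerivAt K (K' t) t) (hK'c : ContinuousOn K' (Set.Ioo 0 b))
    (hK0 : ∀ t ∈ Set.Ioo 0 b, b' < t → K t = 0) :
    ∫⁻ t in Set.Ioo 0 b, ‖K t * ((|ψ t| ^ (-τ) * (E t / t) : ℝ) : ℂ)‖ₑ ≤
      ENNReal.ofReal (1 / (2 * (τ - 1))) *
        ∫⁻ t in Set.Ioo 0 b, ‖K' t * ((|ψ t| ^ (1 - τ) : ℝ) : ℂ)‖ₑ := by
  have hm := (h.aestronglyMeasurable_rayKernel (τ := τ) hK'c).enorm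
  calc ∫⁻ t in Set.Ioo 0 b, ‖K t * ((|ψ t| ^ (-τ) * (E t / t) : ℝ) : ℂ)‖ₑ
      ≤ ∫⁻ r in Set.Ioo 0 b, ∫⁻ t in Set.Ioo 0 b, ‖rayKernel ψ E τ K' (r, t)‖ₑ := by
        refine setLIntegral_mono' measurableSet_Ioo fun r hr => ?_
        rw [← enorm_neg, ← integral_rayKernel_snd hb' hK hK'c hK0 hr]
        exact enorm_integral_le_lintegral_enorm _
    _ = ∫⁻ t in Set.Ioo 0 b, ∫⁻ r in Set.Ioo 0 b, ‖rayKernel ψ E τ K' (r, t)‖ₑ :=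
        lintegral_lintegral_swap hm
    _ = ∫⁻ t in Set.Ioo 0 b, ENNReal.ofReal (1 / (2 * (τ - 1))) *
          ‖K' t * ((|ψ t| ^ (1 - τ) : ℝ) : ℂ)‖ₑ := by
        refine setLIntegral_congr_fun measurableSet_Ioo fun t ht => ?_
        rw [(h.rayKernel_fst hτ ht).2.2, enorm_mul, ← ofReal_norm ((_ : ℝ) : ℂ),
          Complex.norm_real, Real.norm_of_nonneg (Real.rpow_nonneg (abs_nonneg _) _)]
    _ = _ := lintegral_const_mul' _ _ ENNReal.ofReal_ne_top

/-- Integration by parts along a ray. -/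
lemma IsRayWeight.integral_eq (h : IsRayWeight b ψ E) (hτ : 1 < τ) (hb' : b' < b)
    (hK : ∀ t ∈ Set.Ioo 0 b, HasDerivAt K (K' t) t) (hK'c : ContinuousOn K' (Set.Ioo 0 b))
    (hK0 : ∀ t ∈ Set.Ioo 0 b, b' < t → K t = 0)
    (hint : IntegrableOn (fun t => K' t * ((|ψ t| ^ (1 - τ) : ℝ) : ℂ)) (Set.Ioo 0 b)) :
    ∫ t in Set.Ioo 0 b, K t * ((|ψ t| ^ (-τ) * (E t / t) : ℝ) : ℂ) =
      -(((1 / (2 * (τ - 1)) : ℝ) : ℂ) *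
        ∫ t in Set.Ioo 0 b, K' t * ((|ψ t| ^ (1 - τ) : ℝ) : ℂ)) := by
  have hm := h.aestronglyMeasurable_rayKernel (τ := τ) hK'c
  have hprod : Integrable (rayKernel ψ E τ K')
      ((volume.restrict (Set.Ioo 0 b)).prod (volume.restrict (Set.Ioo 0 b))) := by
    refine ⟨hm, ?_⟩
    rw [hasFiniteIntegral_iff_enorm, lintegral_prod_symm _ hm.enorm]
    have : ∫⁻ t in Set.Ioo 0 b, ∫⁻ r in Set.Ioo 0 b, ‖rayKernel ψ E τ K' (r, t)‖ₑ =
        ∫⁻ t in Set.Ioo 0 b, ENNReal.ofReal (1 / (2 * (τ - 1))) *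
          ‖K' t * ((|ψ t| ^ (1 - τ) : ℝ) : ℂ)‖ₑ := by
      refine setLIntegral_congr_fun measurableSet_Ioo fun t ht => ?_
      rw [(h.rayKernel_fst hτ ht).2.2, enorm_mul, ← ofReal_norm ((_ : ℝ) : ℂ),
        Complex.norm_real, Real.norm_of_nonneg (Real.rpow_nonneg (abs_nonneg _) _)]
    rw [this, lintegral_const_mul' _ _ ENNReal.ofReal_ne_top]
    exact ENNReal.mul_lt_top ENNReal.ofReal_lt_top hint.2
  have hswap := integral_integral_swap (f := fun r t => rayKernel ψ E τ K' (r, t)) hprod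
  rw [setIntegral_congr_fun measurableSet_Ioo
      (fun r hr => integral_rayKernel_snd hb' hK hK'c hK0 hr),
    setIntegral_congr_fun measurableSet_Ioo
      (fun t ht => (h.rayKernel_fst (K' := K') hτ ht).2.1), integral_neg,
    integral_const_mul] at hswap
  rw [← hswap, neg_neg]

end Ray

/-! ### Radial integration by parts on a box -/

section FubiniUpdate

variable {ι : Type*} [Fintype ι] [DecidableEq ι] {R : ι → ℝ} {S : Finset ι} {j : ι}

lemma lintegral_faceMeasure_insert (hj : j ∉ S) {g : (ι → ℝ) → ENNReal}
    (hg : AEMeasurable g (faceMeasure R (insert j S))) :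
    ∫⁻ x, g x ∂(faceMeasure R (insert j S)) =
      ∫⁻ x, (∫⁻ t in Set.Ioo 0 (R j), g (Function.update x j t)) ∂(faceMeasure R S) := by
  have hmp := measurePreserving_update R hj
  have hg' : AEMeasurable (fun p : (ι → ℝ) × ℝ => g (Function.update p.1 j p.2))
      ((faceMeasure R S).prod (volume.restrict (Set.Ioo 0 (R j)))) :=
    AEMeasurable.comp_measurable (by rwa [hmp.map_eq]) hmp.measurable
  rw [← lintegral_prod _ hg']
  conv_lhs => rw [← hmp.map_eq]
  exact lintegral_map' (by rwa [hmp.map_eq]) hmp.aemeasurable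

lemma integral_faceMeasure_insert (hj : j ∉ S) {g : (ι → ℝ) → ℂ}
    (hg : Integrable g (faceMeasure R (insert j S))) :
    (∀ᵐ x ∂(faceMeasure R S),
      IntegrableOn (fun t => g (Function.update x j t)) (Set.Ioo 0 (R j))) ∧
    ∫ x, g x ∂(faceMeasure R (insert j S)) =
      ∫ x, (∫ t in Set.Ioo 0 (R j), g (Function.update x j t)) ∂(faceMeasure R S) := by
  have hmp := measurePreserving_update R hj
  have hg' : Integrable (fun p : (ι → ℝ) × ℝ => g (Function.update p.1 j p.2))
      ((faceMeasure R S).prod (volume.restrict (Set.Ioo 0 (R j)))) :=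
    hmp.integrable_comp_of_integrable hg
  refine ⟨hg'.prod_right_ae, ?_⟩
  rw [← integral_prod _ hg']
  conv_lhs => rw [← hmp.map_eq]
  exact integral_map hmp.aemeasurable (by rw [hmp.map_eq]; exact hg.1)

end FubiniUpdate

/-- A potential `ψ` on the open box `∏ (0, R_i)` with its normalised logarithmic derivatives
`e_j = (r_j / 2) ∂ψ/∂r_j`, which extend smoothly and positively to the symmetric box
`∏ (-R_i, R_i)` and equal `1` on `{r_j = 0}`. -/
structure RadialModel (ι : Type*) [Fintype ι] [DecidableEq ι] where
  /-- the side lengths of the box -/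
  R : ι → ℝ
  /-- the normalised logarithmic derivatives of the potential -/
  e : ι → (ι → ℝ) → ℝ
  /-- the potential -/
  psi : (ι → ℝ) → ℝ
  R_pos : ∀ i, 0 < R i
  e_smooth : ∀ j, ContDiffOn ℝ ∞ (e j) {r | ∀ i, |r i| < R i}
  e_pos : ∀ j r, (∀ i, |r i| < R i) → 0 < e j r
  e_zero : ∀ j r, (∀ i, |r i| < R i) → r j = 0 → e j r = 1
  psi_le : ∀ r, (∀ i, r i ∈ Set.Ioo 0 (R i)) → psi r ≤ -1
  psi_deriv : ∀ r, (∀ i, r i ∈ Set.Ioo 0 (R i)) → ∀ j,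
    HasDerivAt (fun t => psi (Function.update r j t)) (2 * e j r / r j) (r j)
  psi_lim : ∀ r, (∀ i, r i ∈ Set.Ioo 0 (R i)) → ∀ j,
    Tendsto (fun t => psi (Function.update r j t)) (𝓝[>] 0) atBot
  psi_cont : ContinuousOn psi {r | ∀ i, r i ∈ Set.Ioo 0 (R i)}

namespace RadialModel

variable {ι : Type*} [Fintype ι] [DecidableEq ι] (M : RadialModel ι)

/-- The symmetric box `∏ (-R_i, R_i)`. -/
def box : Set (ι → ℝ) := {r | ∀ i, |r i| < M.R i}

/-- The open box `∏ (0, R_i)`. -/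
def posBox : Set (ι → ℝ) := {r | ∀ i, r i ∈ Set.Ioo 0 (M.R i)}

/-- The operator `F ↦ ∂/∂r_j (F / e_j)`. -/
def step (F : (ι → ℝ) → ℂ) (j : ι) (r : ι → ℝ) : ℂ :=
  lineDeriv ℝ (fun x => F x / (M.e j x : ℂ)) r (Pi.single j 1)

lemma isOpen_box : IsOpen M.box := by
  rw [box, Set.ofPred_forall]
  exact isOpen_iInter_of_finite fun i => isOpen_lt (by fun_prop) continuous_const

lemma isOpen_posBox : IsOpen M.posBox := by
  rw [posBox, Set.ofPred_forall]
  exact isOpen_iInter_of_finite fun i => isOpen_Ioo.preimage (continuous_apply i)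

lemma posBox_subset_box : M.posBox ⊆ M.box := fun r hr i => by
  rw [abs_of_pos (hr i).1]; exact (hr i).2

lemma measurableSet_posBox : MeasurableSet M.posBox := M.isOpen_posBox.measurableSet

lemma ae_mem_posBox : ∀ᵐ r ∂(faceMeasure M.R Finset.univ), r ∈ M.posBox := by
  filter_upwards [ae_faceMeasure M.R Finset.univ] with r hr i
  exact (hr i).1 (Finset.mem_univ i)

lemma aestronglyMeasurable_of_continuousOn {F : (ι → ℝ) → ℂ} (hF : ContinuousOn F M.posBox) :
    AEStronglyMeasurable F (faceMeasure M.R Finset.univ) := by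
  have h := hF.aestronglyMeasurable (μ := faceMeasure M.R Finset.univ) M.measurableSet_posBox
  rwa [Measure.restrict_eq_self_of_ae_mem M.ae_mem_posBox] at h

/-- Smooth functions on the symmetric box which vanish where some `r_i` exceeds `R'_i < R_i`. -/
structure IsTest (R' : ι → ℝ) (f : (ι → ℝ) → ℂ) : Prop where
  lt : ∀ i, R' i < M.R i
  smooth : ContDiffOn ℝ ∞ f M.box
  zero : ∀ r ∈ M.box, ∀ i, R' i < r i → f r = 0

variable {M} {R' : ι → ℝ} {f : (ι → ℝ) → ℂ} {j : ι}

lemma IsTest.smooth_div (hf : M.IsTest R' f) (j : ι) :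
    ContDiffOn ℝ ∞ (fun x => f x / (M.e j x : ℂ)) M.box := by
  simp_rw [div_eq_mul_inv]
  have h1 : ContDiffOn ℝ ∞ (fun x => (M.e j x : ℂ)) M.box :=
    Complex.ofRealCLM.contDiff.comp_contDiffOn (M.e_smooth j)
  refine hf.smooth.mul (h1.inv fun x hx => ?_)
  exact Complex.ofReal_ne_zero.2 (M.e_pos j x hx).ne'

lemma step_eq_fderiv (hf : M.IsTest R' f) {r : ι → ℝ} (hr : r ∈ M.box) :
    M.step f j r = fderiv ℝ (fun x => f x / (M.e j x : ℂ)) r (Pi.single j 1) :=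
  (((hf.smooth_div j).contDiffAt (M.isOpen_box.mem_nhds hr)).differentiableAt
    (by simp)).lineDeriv_eq_fderiv

lemma IsTest.step (hf : M.IsTest R' f) (j : ι) : M.IsTest R' (M.step f j) where
  lt := hf.lt
  smooth := by
    have h1 := (hf.smooth_div j).fderiv_of_isOpen M.isOpen_box (m := ∞) (by simp)
    refine (h1.clm_apply (contDiffOn_const (c := (Pi.single j 1 : ι → ℝ)))).congr fun r hr => ?_
    exact step_eq_fderiv hf hr
  zero := by
    intro r hr i hi
    have h1 : (fun x => f x / (M.e j x : ℂ)) =ᶠ[𝓝 r] fun _ => 0 := by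
      have h2 : ∀ᶠ x in 𝓝 r, R' i < x i := (continuous_apply i).continuousAt.eventually_const_lt hi
      filter_upwards [h2, M.isOpen_box.mem_nhds hr] with x hx1 hx2
      rw [hf.zero x hx2 i hx1, zero_div]
    rw [RadialModel.step, h1.lineDeriv_eq]
    simp [lineDeriv]

lemma IsTest.foldl (hf : M.IsTest R' f) (L : List ι) : M.IsTest R' (L.foldl M.step f) := by
  induction L generalizing f with
  | nil => exact hf
  | cons j L ih => exact ih (hf.step j)

lemma IsTest.hasDerivAt (hf : M.IsTest R' f) {x : ι → ℝ} {t : ℝ}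
    (hx : Function.update x j t ∈ M.box) :
    HasDerivAt (fun s => f (Function.update x j s) / (M.e j (Function.update x j s) : ℂ))
      (M.step f j (Function.update x j t)) t := by
  have h1 := (((hf.smooth_div j).contDiffAt (M.isOpen_box.mem_nhds hx)).differentiableAt
    (by simp)).hasFDerivAt
  rw [step_eq_fderiv hf hx]
  exact h1.comp_hasDerivAt t (hasDerivAt_update x j t)

lemma update_mem_posBox {x : ι → ℝ} {t : ℝ} (hx : ∀ i, i ≠ j → x i ∈ Set.Ioo 0 (M.R i))
    (ht : t ∈ Set.Ioo 0 (M.R j)) : Function.update x j t ∈ M.posBox := by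
  intro i
  by_cases hi : i = j
  · subst hi; simpa using ht
  · simpa [Function.update_of_ne hi] using hx i hi

lemma continuous_update_line {ι : Type*} [DecidableEq ι] (x : ι → ℝ) (j : ι) :
    Continuous fun t : ℝ => Function.update x j t :=
  continuous_const.update j continuous_id

lemma isRayWeight {x : ι → ℝ} (hx : ∀ i, i ≠ j → x i ∈ Set.Ioo 0 (M.R i)) :
    IsRayWeight (M.R j) (fun t => M.psi (Function.update x j t))
      (fun t => M.e j (Function.update x j t)) where
  le t ht := M.psi_le _ (update_mem_posBox hx ht)
  deriv t ht := by
    simpa using M.psi_deriv _ (update_mem_posBox hx ht) j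
  pos t ht := M.e_pos j _ (M.posBox_subset_box (update_mem_posBox hx ht))
  cont := (M.e_smooth j).continuousOn.comp (continuous_update_line x j).continuousOn
    fun t ht => M.posBox_subset_box (update_mem_posBox hx ht)
  lim := by
    obtain ⟨t, ht⟩ : ∃ t, t ∈ Set.Ioo 0 (M.R j) := ⟨M.R j / 2, by
      have := M.R_pos j; constructor <;> linarith⟩
    simpa using M.psi_lim _ (update_mem_posBox hx ht) j

lemma continuousOn_psi_rpow (p : ℝ) : ContinuousOn (fun r => |M.psi r| ^ p) M.posBox :=
  M.psi_cont.abs.rpow_const fun r hr => Or.inl (by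
    have := M.psi_le r hr
    exact abs_ne_zero.2 (by linarith))

section Step

variable {Q : (ι → ℝ) → ℝ} {τ : ℝ}

lemma IsTest.step_source_continuousOn (hf : M.IsTest R' f) (j : ι) (hQ : ContinuousOn Q M.posBox) :
    ContinuousOn (fun r => f r * ((|M.psi r| ^ (-τ) * ((r j)⁻¹ * Q r) : ℝ) : ℂ)) M.posBox := by
  refine (hf.smooth.continuousOn.mono M.posBox_subset_box).mul
    (Complex.continuous_ofReal.comp_continuousOn ((continuousOn_psi_rpow _).mul (ContinuousOn.mul
      ?_ hQ)))
  exact (continuous_apply j).continuousOn.inv₀ fun r hr => (hr j).1.ne'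

lemma IsTest.step_target_continuousOn (hf : M.IsTest R' f) (p : ℝ) (hQ : ContinuousOn Q M.posBox) :
    ContinuousOn (fun r => f r * ((|M.psi r| ^ p * Q r : ℝ) : ℂ)) M.posBox :=
  (hf.smooth.continuousOn.mono M.posBox_subset_box).mul
    (Complex.continuous_ofReal.comp_continuousOn ((continuousOn_psi_rpow _).mul hQ))

lemma IsTest.ray_eq (x : ι → ℝ) (hx : ∀ i, i ≠ j → x i ∈ Set.Ioo 0 (M.R i))
    (hQj : ∀ x t, Q (Function.update x j t) = Q x) {t : ℝ} (ht : t ∈ Set.Ioo 0 (M.R j)) :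
    f (Function.update x j t) * ((|M.psi (Function.update x j t)| ^ (-τ) *
      ((Function.update x j t j)⁻¹ * Q (Function.update x j t)) : ℝ) : ℂ) =
    (f (Function.update x j t) / (M.e j (Function.update x j t) : ℂ) *
      ((|M.psi (Function.update x j t)| ^ (-τ) * (M.e j (Function.update x j t) / t) : ℝ) : ℂ)) *
        (Q x : ℂ) := by
  have h1 : (M.e j (Function.update x j t) : ℂ) ≠ 0 := Complex.ofReal_ne_zero.2
    (M.e_pos j _ (M.posBox_subset_box (update_mem_posBox hx ht))).ne'
  have h2 : (t : ℂ) ≠ 0 := Complex.ofReal_ne_zero.2 ht.1.ne'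
  rw [hQj, Function.update_self]
  push_cast
  field_simp

/-- Integration by parts in the variable `r_j`, with a weight `Q` independent of `r_j`: inequality
between absolute integrals. -/
lemma IsTest.lintegral_step_le (hf : M.IsTest R' f) (j : ι) (hQ : ContinuousOn Q M.posBox)
    (hQj : ∀ x t, Q (Function.update x j t) = Q x) (hτ : 1 < τ) :
    ∫⁻ r, ‖f r * ((|M.psi r| ^ (-τ) * ((r j)⁻¹ * Q r) : ℝ) : ℂ)‖ₑ
        ∂(faceMeasure M.R Finset.univ) ≤
      ENNReal.ofReal (1 / (2 * (τ - 1))) *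
        ∫⁻ r, ‖M.step f j r * ((|M.psi r| ^ (1 - τ) * Q r : ℝ) : ℂ)‖ₑ
          ∂(faceMeasure M.R Finset.univ) := by
  have h1 := (M.aestronglyMeasurable_of_continuousOn
    (hf.step_source_continuousOn (τ := τ) j hQ)).enorm
  have h2 := (M.aestronglyMeasurable_of_continuousOn
    ((hf.step j).step_target_continuousOn (1 - τ) hQ)).enorm
  rw [← Finset.insert_erase (Finset.mem_univ j)] at h1 h2 ⊢
  rw [lintegral_faceMeasure_insert (Finset.notMem_erase j _) h1,
    lintegral_faceMeasure_insert (Finset.notMem_erase j _) h2,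
    ← lintegral_const_mul' _ _ ENNReal.ofReal_ne_top]
  refine lintegral_mono_ae ?_
  filter_upwards [ae_faceMeasure M.R (Finset.univ.erase j)] with x hx
  have hx' : ∀ i, i ≠ j → x i ∈ Set.Ioo 0 (M.R i) := fun i hi => (hx i).1 (by simp [hi])
  rw [setLIntegral_congr_fun measurableSet_Ioo
    (fun t ht => congrArg _ (IsTest.ray_eq (f := f) (τ := τ) x hx' hQj ht))]
  simp_rw [enorm_mul _ (Q x : ℂ), hQj]
  rw [lintegral_mul_const' _ _ enorm_ne_top]
  have h3 := (isRayWeight hx').lintegral_le hτ (hf.lt j)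
    (fun t ht => hf.hasDerivAt (M.posBox_subset_box (update_mem_posBox hx' ht)))
    ((hf.step j).smooth.continuousOn.comp (continuous_update_line x j).continuousOn
      fun t ht => M.posBox_subset_box (update_mem_posBox hx' ht))
    (fun t ht htj => by
      rw [hf.zero _ (M.posBox_subset_box (update_mem_posBox hx' ht)) j (by simpa using htj),
        zero_div])
  refine (mul_le_mul_left h3 ‖(Q x : ℂ)‖ₑ).trans (le_of_eq ?_)
  rw [mul_assoc, ← lintegral_mul_const' _ _ enorm_ne_top]
  congr 1
  refine lintegral_congr fun t => ?_
  rw [← enorm_mul]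
  push_cast
  ring_nf

/-- Integration by parts in the variable `r_j`, with a weight `Q` independent of `r_j`. -/
lemma IsTest.integral_step_eq (hf : M.IsTest R' f) (j : ι) (hQ : ContinuousOn Q M.posBox)
    (hQj : ∀ x t, Q (Function.update x j t) = Q x) (hQp : ∀ x ∈ M.posBox, 0 < Q x) (hτ : 1 < τ)
    (hint : Integrable (fun r => M.step f j r * ((|M.psi r| ^ (1 - τ) * Q r : ℝ) : ℂ))
      (faceMeasure M.R Finset.univ)) :
    Integrable (fun r => f r * ((|M.psi r| ^ (-τ) * ((r j)⁻¹ * Q r) : ℝ) : ℂ))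
        (faceMeasure M.R Finset.univ) ∧
      ∫ r, f r * ((|M.psi r| ^ (-τ) * ((r j)⁻¹ * Q r) : ℝ) : ℂ) ∂(faceMeasure M.R Finset.univ) =
      -(((1 / (2 * (τ - 1)) : ℝ) : ℂ) *
        ∫ r, M.step f j r * ((|M.psi r| ^ (1 - τ) * Q r : ℝ) : ℂ)
          ∂(faceMeasure M.R Finset.univ)) := by
  have hI : Integrable (fun r => f r * ((|M.psi r| ^ (-τ) * ((r j)⁻¹ * Q r) : ℝ) : ℂ))
      (faceMeasure M.R Finset.univ) := by
    refine ⟨M.aestronglyMeasurable_of_continuousOn (hf.step_source_continuousOn j hQ), ?_⟩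
    rw [hasFiniteIntegral_iff_enorm]
    exact (hf.lintegral_step_le j hQ hQj hτ).trans_lt
      (ENNReal.mul_lt_top ENNReal.ofReal_lt_top hint.2)
  refine ⟨hI, ?_⟩
  rw [← Finset.insert_erase (Finset.mem_univ j)] at hI hint ⊢
  obtain ⟨-, h1⟩ := integral_faceMeasure_insert (Finset.notMem_erase j _) hI
  obtain ⟨h2, h3⟩ := integral_faceMeasure_insert (Finset.notMem_erase j _) hint
  rw [h1, h3, ← integral_const_mul, ← integral_neg]
  refine integral_congr_ae ?_
  filter_upwards [ae_faceMeasure M.R (Finset.univ.erase j), h2] with x hx hx2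
  have hx' : ∀ i, i ≠ j → x i ∈ Set.Ioo 0 (M.R i) := fun i hi => (hx i).1 (by simp [hi])
  obtain ⟨t₀, ht₀⟩ : ∃ t, t ∈ Set.Ioo 0 (M.R j) := ⟨M.R j / 2, by
    have := M.R_pos j; constructor <;> linarith⟩
  have hQx : (Q x : ℂ) ≠ 0 := by
    rw [← hQj x t₀]; exact Complex.ofReal_ne_zero.2 (hQp _ (update_mem_posBox hx' ht₀)).ne'
  have h4 : ∀ t, M.step f j (Function.update x j t) *
      ((|M.psi (Function.update x j t)| ^ (1 - τ) * Q (Function.update x j t) : ℝ) : ℂ) =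
      (M.step f j (Function.update x j t) *
        ((|M.psi (Function.update x j t)| ^ (1 - τ) : ℝ) : ℂ)) * (Q x : ℂ) := fun t => by
    rw [hQj]; push_cast; ring
  simp_rw [h4] at hx2 ⊢
  have h5 : IntegrableOn (fun t => M.step f j (Function.update x j t) *
      ((|M.psi (Function.update x j t)| ^ (1 - τ) : ℝ) : ℂ)) (Set.Ioo 0 (M.R j)) := by
    have := hx2.mul_const (Q x : ℂ)⁻¹
    simpa [IntegrableOn, mul_assoc, hQx] using this
  have h6 := (isRayWeight hx').integral_eq hτ (hf.lt j)
    (fun t ht => hf.hasDerivAt (M.posBox_subset_box (update_mem_posBox hx' ht)))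
    ((hf.step j).smooth.continuousOn.comp (continuous_update_line x j).continuousOn
      fun t ht => M.posBox_subset_box (update_mem_posBox hx' ht))
    (fun t ht htj => by
      rw [hf.zero _ (M.posBox_subset_box (update_mem_posBox hx' ht)) j (by simpa using htj),
        zero_div]) h5
  rw [setIntegral_congr_fun measurableSet_Ioo
    (fun t ht => IsTest.ray_eq (f := f) (τ := τ) x hx' hQj ht), integral_mul_const,
    integral_mul_const, h6]
  ring

end Step

/-- The product `∏_{j ∈ L} 1/r_j`. -/
def invProd {ι : Type*} (L : List ι) (r : ι → ℝ) : ℝ := (L.map fun j => (r j)⁻¹).prod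

lemma invProd_cons {ι : Type*} (j : ι) (L : List ι) (r : ι → ℝ) :
    invProd (j :: L) r = (r j)⁻¹ * invProd L r := by simp [invProd]

lemma continuousOn_invProd (L : List ι) : ContinuousOn (invProd L) M.posBox := by
  induction L with
  | nil =>
    have h : invProd ([] : List ι) = fun _ => 1 := funext fun r => by simp [invProd]
    rw [h]
    exact continuousOn_const
  | cons j L ih =>
    simp_rw [funext (invProd_cons j L)]
    exact ((continuous_apply j).continuousOn.inv₀ fun r hr => (hr j).1.ne').mul ih

lemma invProd_pos (L : List ι) {r : ι → ℝ} (hr : r ∈ M.posBox) : 0 < invProd L r := by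
  induction L with
  | nil => simp [invProd]
  | cons j L ih => rw [invProd_cons]; exact mul_pos (inv_pos.2 (hr j).1) ih

lemma invProd_update {ι : Type*} [DecidableEq ι] {j : ι} {L : List ι} (hj : j ∉ L) (x : ι → ℝ)
    (t : ℝ) :
    invProd L (Function.update x j t) = invProd L x := by
  unfold invProd
  congr 1
  refine List.map_congr_left fun i hi => ?_
  rw [Function.update_of_ne (ne_of_mem_of_not_mem hi hj)]

/-- The constant `∏_{i < k} 1 / (2 (τ - 1 - i))` produced by `k` integrations by parts. -/
def partsConst (τ : ℝ) : ℕ → ℝ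
  | 0 => 1
  | k + 1 => 1 / (2 * (τ - 1)) * partsConst (τ - 1) k

/-- Iterated radial integration by parts: inequality between absolute integrals. -/
lemma IsTest.lintegral_foldl_le {L : List ι} (hL : L.Nodup) {τ : ℝ} (hτ : (L.length : ℝ) < τ)
    (hf : M.IsTest R' f) :
    ∫⁻ r, ‖f r * ((|M.psi r| ^ (-τ) * invProd L r : ℝ) : ℂ)‖ₑ ∂(faceMeasure M.R Finset.univ) ≤
      ENNReal.ofReal (partsConst τ L.length) *
        ∫⁻ r, ‖L.foldl M.step f r * ((|M.psi r| ^ (-(τ - L.length)) : ℝ) : ℂ)‖ₑ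
          ∂(faceMeasure M.R Finset.univ) := by
  induction L generalizing f τ with
  | nil => simp [invProd, partsConst]
  | cons j L ih =>
    rw [List.nodup_cons] at hL
    simp only [List.length_cons, Nat.cast_add, Nat.cast_one] at hτ ⊢
    have h0 : (0 : ℝ) ≤ L.length := Nat.cast_nonneg _
    have hτ1 : 1 < τ := by linarith
    have h1 := hf.lintegral_step_le j (continuousOn_invProd L) (invProd_update hL.1) hτ1
    have h2 := ih hL.2 (τ := τ - 1) (by linarith) (hf.step j)
    simp_rw [invProd_cons]
    refine h1.trans ?_
    rw [partsConst, ENNReal.ofReal_mul (by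
      have : 0 < τ - 1 := by linarith
      positivity), mul_assoc]
    gcongr
    rw [show -(τ - 1) = 1 - τ by ring, show -(τ - 1 - (L.length : ℝ)) =
      -(τ - ((L.length : ℝ) + 1)) by ring] at h2
    exact h2

/-- Iterated radial integration by parts. -/
lemma IsTest.integral_foldl_eq {L : List ι} (hL : L.Nodup) {τ : ℝ} (hτ : (L.length : ℝ) < τ)
    (hf : M.IsTest R' f)
    (hint : Integrable (fun r => L.foldl M.step f r *
      ((|M.psi r| ^ (-(τ - L.length)) : ℝ) : ℂ)) (faceMeasure M.R Finset.univ)) :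
    Integrable (fun r => f r * ((|M.psi r| ^ (-τ) * invProd L r : ℝ) : ℂ))
        (faceMeasure M.R Finset.univ) ∧
      ∫ r, f r * ((|M.psi r| ^ (-τ) * invProd L r : ℝ) : ℂ) ∂(faceMeasure M.R Finset.univ) =
      (-1) ^ L.length * (partsConst τ L.length : ℂ) *
        ∫ r, L.foldl M.step f r * ((|M.psi r| ^ (-(τ - L.length)) : ℝ) : ℂ)
          ∂(faceMeasure M.R Finset.univ) := by
  induction L generalizing f τ with
  | nil => simpa [invProd, partsConst] using hint
  | cons j L ih =>
    rw [List.nodup_cons] at hL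
    simp only [List.length_cons, Nat.cast_add, Nat.cast_one, List.foldl_cons] at hτ hint ⊢
    have h0 : (0 : ℝ) ≤ L.length := Nat.cast_nonneg _
    have hτ1 : 1 < τ := by linarith
    have hr : -(τ - ((L.length : ℝ) + 1)) = -(τ - 1 - (L.length : ℝ)) := by ring
    rw [hr] at hint ⊢
    obtain ⟨h1, h2⟩ := ih hL.2 (τ := τ - 1) (by linarith) (hf.step j) hint
    rw [show -(τ - 1) = 1 - τ by ring] at h1 h2
    obtain ⟨h3, h4⟩ := hf.integral_step_eq j (continuousOn_invProd L) (invProd_update hL.1)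
      (fun x hx => invProd_pos L hx) hτ1 h1
    simp_rw [invProd_cons]
    refine ⟨h3, ?_⟩
    rw [h4, h2, partsConst]
    push_cast
    ring

lemma IsTest.integrable_faceMeasure (hf : M.IsTest R' f) (S : Finset ι) :
    Integrable f (faceMeasure M.R S) := by
  -- on `∏ [0, R_i)` the function vanishes off the compact box `∏ [0, max R'_i 0]`
  set C : Set (ι → ℝ) := Set.pi Set.univ fun i => Set.Icc 0 (max (R' i) 0) with hC
  have hCbox : C ⊆ M.box := fun r hr i => by
    have h1 := hr i (Set.mem_univ i)
    rw [abs_of_nonneg h1.1]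
    exact h1.2.trans_lt (max_lt (hf.lt i) (M.R_pos i))
  have hCc : IsCompact C := isCompact_univ_pi fun i => isCompact_Icc
  have hon : IntegrableOn f C (faceMeasure M.R S) :=
    ContinuousOn.integrableOn_compact hCc (hf.smooth.continuousOn.mono hCbox)
  refine (integrableOn_iff_integrable_of_support_subset (s := C) (f := C.indicator f)
    Set.support_indicator_subset).1 ?_ |>.congr ?_
  · exact hon.congr_fun (fun r hr => (Set.indicator_of_mem hr f).symm) hCc.measurableSet
  · filter_upwards [ae_faceMeasure M.R S] with r hr
    by_cases hrC : r ∈ C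
    · exact Set.indicator_of_mem hrC f
    · rw [Set.indicator_of_notMem hrC]
      have hr0 : ∀ i, 0 ≤ r i ∧ r i < M.R i := fun i => by
        by_cases hi : i ∈ S
        · exact ⟨((hr i).1 hi).1.le, ((hr i).1 hi).2⟩
        · rw [(hr i).2 hi]; exact ⟨le_rfl, M.R_pos i⟩
      have : ∃ i, R' i < r i := by
        by_contra! hcon
        exact hrC fun i _ => ⟨(hr0 i).1, (hcon i).trans (le_max_left _ _)⟩
      obtain ⟨i, hi⟩ := this
      exact (hf.zero r (fun i => by rw [abs_of_nonneg (hr0 i).1]; exact (hr0 i).2) i hi).symm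

/-- Integrating all the radial derivatives leaves the boundary value at the origin. -/
lemma IsTest.integral_foldl_faceMeasure {L : List ι} (hL : L.Nodup) (hf : M.IsTest R' f) :
    ∫ r, L.foldl M.step f r ∂(faceMeasure M.R L.toFinset) = (-1) ^ L.length * f 0 := by
  induction L using List.reverseRecOn with
  | nil => simp [faceMeasure_empty]
  | append_singleton L j ih =>
    have hL' : L.Nodup ∧ j ∉ L := by
      rw [List.nodup_append] at hL
      exact ⟨hL.1, fun h => hL.2.2 j h j (by simp) rfl⟩
    have hjS : j ∉ L.toFinset := by simpa using hL'.2
    have hset : (L ++ [j]).toFinset = insert j L.toFinset := by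
      ext i; simp
    set F := L.foldl M.step f with hF
    have hFt : M.IsTest R' F := hf.foldl L
    rw [hset, List.foldl_append, ← hF, List.foldl_cons, List.foldl_nil,
      (integral_faceMeasure_insert hjS ((hFt.step j).integrable_faceMeasure _)).2]
    have hinner : ∀ᵐ x ∂(faceMeasure M.R L.toFinset),
        ∫ t in Set.Ioo 0 (M.R j), M.step F j (Function.update x j t) = -F x := by
      filter_upwards [ae_faceMeasure M.R L.toFinset] with x hx
      have hxj : x j = 0 := (hx j).2 hjS
      have hxb : ∀ i, 0 ≤ x i ∧ x i < M.R i := fun i => by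
        by_cases hi : i ∈ L.toFinset
        · exact ⟨((hx i).1 hi).1.le, ((hx i).1 hi).2⟩
        · rw [(hx i).2 hi]; exact ⟨le_rfl, M.R_pos i⟩
      have hbox : ∀ t, |t| < M.R j → Function.update x j t ∈ M.box := fun t ht i => by
        by_cases hi : i = j
        · subst hi; simpa using ht
        · rw [Function.update_of_ne hi, abs_of_nonneg (hxb i).1]; exact (hxb i).2
      have hR := M.R_pos j
      obtain ⟨c, hc1, hc2⟩ := exists_between (max_lt (hf.lt j) hR)
      have hc0 : 0 < c := (le_max_right _ _).trans_lt hc1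
      have hcR : R' j < c := (le_max_left _ _).trans_lt hc1
      have hcont : ContinuousOn (fun t => M.step F j (Function.update x j t)) (Set.Icc 0 c) :=
        (hFt.step j).smooth.continuousOn.comp (continuous_update_line x j).continuousOn
          fun t ht => hbox t (by rw [abs_of_nonneg ht.1]; exact ht.2.trans_lt hc2)
      have hzero : ∀ t ∈ Set.Ioo c (M.R j), M.step F j (Function.update x j t) = 0 := fun t ht =>
        (hFt.step j).zero _ (hbox t (by rw [abs_of_pos (hc0.trans ht.1)]; exact ht.2)) j
          (by simpa using hcR.trans ht.1)
      have hi1 : IntervalIntegrable (fun t => M.step F j (Function.update x j t)) volume 0 c :=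
        (by rwa [Set.uIcc_of_le hc0.le] : ContinuousOn _ (Set.uIcc 0 c)).intervalIntegrable
      have hun : Set.Ioc 0 c ∪ Set.Ioo c (M.R j) = Set.Ioo 0 (M.R j) :=
        Set.Ioc_union_Ioo_eq_Ioo hc0.le hc2
      rw [← hun, setIntegral_union (Set.disjoint_left.2 fun t h h' => absurd h.2 (not_le.2 h'.1))
        measurableSet_Ioo ((intervalIntegrable_iff_integrableOn_Ioc_of_le hc0.le).1 hi1)
        ((integrableOn_congr_fun (g := fun _ => (0 : ℂ)) hzero measurableSet_Ioo).2
          integrableOn_zero),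
        setIntegral_congr_fun (g := fun _ => (0 : ℂ)) measurableSet_Ioo hzero, integral_zero,
        add_zero, ← intervalIntegral.integral_of_le hc0.le,
        intervalIntegral.integral_eq_sub_of_hasDerivAt
          (f := fun s => F (Function.update x j s) / (M.e j (Function.update x j s) : ℂ))
          (fun t ht => by
            rw [Set.uIcc_of_le hc0.le] at ht
            exact hFt.hasDerivAt (hbox t (by rw [abs_of_nonneg ht.1]; exact ht.2.trans_lt hc2)))
          hi1]
      have hx0 : Function.update x j 0 = x := by rw [← hxj, Function.update_eq_self]
      rw [hFt.zero _ (hbox c (by rwa [abs_of_pos hc0])) j (by simpa using hcR), hx0,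
        M.e_zero j x (fun i => by rw [abs_of_nonneg (hxb i).1]; exact (hxb i).2) hxj]
      simp
    rw [integral_congr_ae hinner, integral_neg, ih hL'.1, List.length_append, List.length_singleton]
    ring

end RadialModel

/-! ### Radial derivatives off the divisor -/

section RadialCalculus

variable {m l : ℕ}

lemma radialDeriv_eq_slice (j : Fin m) (F : Coords m l → ℂ) (z : Coords m l) :
    radialDeriv j F z = lineDeriv ℝ (fun u => F (u, z.2)) z.1
      (Pi.single j (z.1 j / (‖z.1 j‖ : ℂ))) := by
  have h : ∀ t : ℝ, z + t • ((Pi.single j (z.1 j / (‖z.1 j‖ : ℂ)), 0) : Coords m l) =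
      (z.1 + t • (Pi.single j (z.1 j / (‖z.1 j‖ : ℂ)) : Fin m → ℂ), z.2) := fun t => by
    ext <;> simp
  simp only [radialDeriv, lineDeriv, h]

lemma radialDeriv_eq_fderiv {j : Fin m} {F : Coords m l → ℂ} {z : Coords m l}
    (hF : DifferentiableAt ℝ (fun u => F (u, z.2)) z.1) :
    radialDeriv j F z = fderiv ℝ (fun u => F (u, z.2)) z.1
      (Pi.single j (z.1 j / (‖z.1 j‖ : ℂ))) := by
  rw [radialDeriv_eq_slice, hF.lineDeriv_eq_fderiv]

lemma radialDeriv_add {j : Fin m} {F G : Coords m l → ℂ} {z : Coords m l}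
    (hF : DifferentiableAt ℝ (fun u => F (u, z.2)) z.1)
    (hG : DifferentiableAt ℝ (fun u => G (u, z.2)) z.1) :
    radialDeriv j (fun y => F y + G y) z = radialDeriv j F z + radialDeriv j G z := by
  rw [radialDeriv_eq_fderiv hF, radialDeriv_eq_fderiv hG,
    radialDeriv_eq_fderiv (F := fun y => F y + G y) (hF.add hG), fderiv_fun_add hF hG]
  rfl

lemma radialDeriv_mul {j : Fin m} {F G : Coords m l → ℂ} {z : Coords m l}
    (hF : DifferentiableAt ℝ (fun u => F (u, z.2)) z.1)
    (hG : DifferentiableAt ℝ (fun u => G (u, z.2)) z.1) :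
    radialDeriv j (fun y => F y * G y) z = radialDeriv j F z * G z + F z * radialDeriv j G z := by
  rw [radialDeriv_eq_fderiv hF, radialDeriv_eq_fderiv hG,
    radialDeriv_eq_fderiv (F := fun y => F y * G y) (hF.mul hG), fderiv_fun_mul hF hG]
  simp only [Prod.mk.eta, add_apply, smul_apply,
    smul_eq_mul]
  ring

lemma radialDeriv_congr {j : Fin m} {F G : Coords m l → ℂ} {z : Coords m l}
    (h : (fun u => F (u, z.2)) =ᶠ[𝓝 z.1] fun u => G (u, z.2)) :
    radialDeriv j F z = radialDeriv j G z := by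
  rw [radialDeriv_eq_slice, radialDeriv_eq_slice, h.lineDeriv_eq]

lemma radialDeriv_const_mul {j : Fin m} {κ F : Coords m l → ℂ}
    (hκ : ∀ z d, κ (z + (Pi.single j d, 0)) = κ z) (z : Coords m l) :
    radialDeriv j (fun y => κ y * F y) z = κ z * radialDeriv j F z := by
  have h : ∀ t : ℝ, z + t • ((Pi.single j (z.1 j / (‖z.1 j‖ : ℂ)), 0) : Coords m l) =
      z + (Pi.single j (t • (z.1 j / (‖z.1 j‖ : ℂ))), 0) := fun t => by
    rw [Prod.smul_mk, ← Pi.single_smul', smul_zero]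
  simp only [radialDeriv, lineDeriv, h, hκ]
  exact deriv_const_mul_field _

lemma radialDerivs_append (L : List (Fin m)) (j : Fin m) (h : Coords m l → ℂ) :
    radialDerivs (L ++ [j]) h = radialDeriv j (radialDerivs L h) := by
  simp [radialDerivs]

lemma contDiffAt_phase {u : Fin m → ℂ} {i : Fin m} (hu : u i ≠ 0) :
    ContDiffAt ℝ ∞ (fun u : Fin m → ℂ => u i / (‖u i‖ : ℂ)) u := by
  simp_rw [div_eq_mul_inv]
  have h1 : ContDiffAt ℝ ∞ (fun u : Fin m → ℂ => u i) u := by fun_prop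
  have h2 : ContDiffAt ℝ ∞ (fun u : Fin m → ℂ => (‖u i‖ : ℂ)) u :=
    Complex.ofRealCLM.contDiff.contDiffAt.comp u (h1.norm ℝ hu)
  exact h1.mul (h2.inv (by simpa using hu))

/-- Phases are constant in the radial directions. -/
lemma radialDeriv_phase {j i : Fin m} {z : Coords m l} (hz : z.1 j ≠ 0) :
    radialDeriv j (fun z : Coords m l => z.1 i / (‖z.1 i‖ : ℂ)) z = 0 := by
  have hn : 0 < ‖z.1 j‖ := norm_pos_iff.2 hz
  have h : (fun t : ℝ => (fun z : Coords m l => z.1 i / (‖z.1 i‖ : ℂ))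
      (z + t • ((Pi.single j (z.1 j / (‖z.1 j‖ : ℂ)), 0) : Coords m l))) =ᶠ[𝓝 0]
      fun _ => z.1 i / (‖z.1 i‖ : ℂ) := by
    filter_upwards [lt_mem_nhds (neg_lt_zero.2 hn)] with t ht
    by_cases hij : i = j
    · subst hij
      have h1 : (z + t • ((Pi.single i (z.1 i / (‖z.1 i‖ : ℂ)), 0) : Coords m l)).1 i =
          ((1 + t / ‖z.1 i‖ : ℝ) : ℂ) * z.1 i := by
        simp; ring
      have h2 : 0 < 1 + t / ‖z.1 i‖ := by
        rw [← neg_lt_iff_pos_add', lt_div_iff₀ hn]; linarith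
      rw [h1, norm_mul, Complex.norm_real, Real.norm_of_nonneg h2.le, Complex.ofReal_mul,
        mul_div_mul_left _ _ (Complex.ofReal_ne_zero.2 h2.ne')]
    · simp [hij]
  rw [radialDeriv, lineDeriv, h.deriv_eq, deriv_const]

lemma radialDeriv_conj {j : Fin m} {F : Coords m l → ℂ} {z : Coords m l} :
    radialDeriv j (fun y => conj (F y)) z = conj (radialDeriv j F z) := by
  simp only [radialDeriv, lineDeriv]
  exact deriv.star

namespace AdmissiblePolydisc

variable (A : AdmissiblePolydisc m l)

/-- The complement of the divisor `D` in `V`. -/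
def offD : Set (Coords m l) := {z | z ∈ A.V ∧ ∀ j, z.1 j ≠ 0}

/-- The complement of the coordinate hyperplanes in `U`. -/
def sliceOffD : Set (Fin m → ℂ) := {u | u ∈ A.U ∧ ∀ j, u j ≠ 0}

lemma isOpen_offD : IsOpen A.offD := by
  refine A.isOpen_V.inter ?_
  change IsOpen {z : Coords m l | ∀ j, z.1 j ≠ 0}
  rw [Set.ofPred_forall]
  exact isOpen_iInter_of_finite fun i => isOpen_ne_fun (by fun_prop) continuous_const

lemma isOpen_sliceOffD : IsOpen A.sliceOffD := by
  refine A.isOpen_U.inter ?_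
  change IsOpen {u : Fin m → ℂ | ∀ j, u j ≠ 0}
  rw [Set.ofPred_forall]
  exact isOpen_iInter_of_finite fun i => isOpen_ne_fun (by fun_prop) continuous_const

lemma offD_subset_V : A.offD ⊆ A.V := fun _ hz => hz.1

variable {A} in
lemma mem_sliceOffD {z : Coords m l} (hz : z ∈ A.offD) : z.1 ∈ A.sliceOffD := ⟨hz.1.1, hz.2⟩

variable {A} in
lemma mem_offD_of_slice {z : Coords m l} (hz : z ∈ A.offD) {u : Fin m → ℂ}
    (hu : u ∈ A.sliceOffD) : (u, z.2) ∈ A.offD := ⟨⟨hu.1, hz.1.2⟩, hu.2⟩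

lemma ae_mem_offD : ∀ᵐ z ∂(volume.restrict A.V), z ∈ A.offD := by
  have h1 : ∀ᵐ z : Coords m l, ∀ j, z.1 j ≠ 0 := by
    refine eventually_all.2 fun j => ?_
    have h2 : ∀ᵐ u : Fin m → ℂ, u j ≠ 0 := by
      rw [volume_pi]; exact Measure.ae_eval_ne (μ := fun _ : Fin m => (volume : Measure ℂ)) j 0
    exact Measure.quasiMeasurePreserving_fst.ae h2
  filter_upwards [ae_restrict_mem A.isOpen_V.measurableSet, ae_restrict_of_ae h1] with z h2 h3
  exact ⟨h2, h3⟩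

lemma aestronglyMeasurable_of_continuousOn {F : Coords m l → ℂ} (hF : ContinuousOn F A.offD) :
    AEStronglyMeasurable F (volume.restrict A.V) := by
  have h := hF.aestronglyMeasurable (μ := volume.restrict A.V) A.isOpen_offD.measurableSet
  rwa [Measure.restrict_eq_self_of_ae_mem A.ae_mem_offD] at h

/-! ### Coefficients of polar type -/

/-- The algebra of functions on `V ∖ D` generated by smooth functions on `V` and by the phases
`e^{± iθ_j}`. -/
inductive IsPolarCoeff : (Coords m l → ℂ) → Prop
  | smooth {a : Coords m l → ℂ} : ContDiffOn ℝ ∞ a A.V → IsPolarCoeff a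
  | phase (j : Fin m) : IsPolarCoeff fun z => z.1 j / (‖z.1 j‖ : ℂ)
  | conjPhase (j : Fin m) : IsPolarCoeff fun z => conj (z.1 j / (‖z.1 j‖ : ℂ))
  | add {a b : Coords m l → ℂ} : IsPolarCoeff a → IsPolarCoeff b → IsPolarCoeff fun z => a z + b z
  | mul {a b : Coords m l → ℂ} : IsPolarCoeff a → IsPolarCoeff b → IsPolarCoeff fun z => a z * b z
  | congr {a b : Coords m l → ℂ} : IsPolarCoeff a → Set.EqOn a b A.offD → IsPolarCoeff b

variable {A}

lemma contDiffOn_phase (j : Fin m) :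
    ContDiffOn ℝ ∞ (fun z : Coords m l => z.1 j / (‖z.1 j‖ : ℂ)) A.offD := fun z hz =>
  ((contDiffAt_phase (hz.2 j)).comp z (f := fun z : Coords m l => z.1)
    contDiffAt_fst).contDiffWithinAt

lemma IsPolarCoeff.contDiffOn {a : Coords m l → ℂ} (ha : A.IsPolarCoeff a) :
    ContDiffOn ℝ ∞ a A.offD := by
  induction ha with
  | smooth h => exact h.mono A.offD_subset_V
  | phase j => exact contDiffOn_phase j
  | conjPhase j => exact Complex.conjCLE.contDiff.comp_contDiffOn (contDiffOn_phase j)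
  | add _ _ h1 h2 => exact h1.add h2
  | mul _ _ h1 h2 => exact h1.mul h2
  | congr _ h2 h1 => exact h1.congr fun z hz => (h2 hz).symm

lemma contDiffOn_slice {a : Coords m l → ℂ} (ha : ContDiffOn ℝ ∞ a A.offD) {z : Coords m l}
    (hz : z ∈ A.offD) : ContDiffOn ℝ ∞ (fun u => a (u, z.2)) A.sliceOffD :=
  ha.comp (contDiff_prodMk_left z.2).contDiffOn fun _ hu => mem_offD_of_slice hz hu

lemma differentiableAt_slice {F : Coords m l → ℂ} {z : Coords m l} (hz : z ∈ A.offD)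
    (hF : ContDiffOn ℝ ∞ (fun u => F (u, z.2)) A.sliceOffD) :
    DifferentiableAt ℝ (fun u => F (u, z.2)) z.1 :=
  (hF.contDiffAt (A.isOpen_sliceOffD.mem_nhds (mem_sliceOffD hz))).differentiableAt (by simp)

lemma contDiffOn_slice_radialDeriv {F : Coords m l → ℂ} {w : Fin l → ℂ}
    (hF : ContDiffOn ℝ ∞ (fun u => F (u, w)) A.sliceOffD) (j : Fin m) :
    ContDiffOn ℝ ∞ (fun u => radialDeriv j F (u, w)) A.sliceOffD := by
  have h1 := hF.fderiv_of_isOpen A.isOpen_sliceOffD (m := ∞) (by simp)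
  have h2 : ContDiffOn ℝ ∞ (fun u : Fin m → ℂ =>
      (Pi.single j (u j / (‖u j‖ : ℂ)) : Fin m → ℂ)) A.sliceOffD := by
    refine contDiffOn_pi.2 fun i => ?_
    by_cases hij : i = j
    · subst hij
      simp only [Pi.single_eq_same]
      exact fun u hu => (contDiffAt_phase (hu.2 i)).contDiffWithinAt
    · simp only [Pi.single_eq_of_ne hij]
      exact contDiffOn_const
  refine (h1.clm_apply h2).congr fun u hu => ?_
  exact radialDeriv_eq_fderiv (z := (u, w))
    ((hF.contDiffAt (A.isOpen_sliceOffD.mem_nhds hu)).differentiableAt (by simp))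

/-- The algebra is stable under radial derivatives. -/
lemma IsPolarCoeff.radialDeriv {a : Coords m l → ℂ} (ha : A.IsPolarCoeff a) (j : Fin m) :
    A.IsPolarCoeff (radialDeriv j a) := by
  have hd : ∀ {b : Coords m l → ℂ}, A.IsPolarCoeff b → ∀ {z}, z ∈ A.offD →
      DifferentiableAt ℝ (fun u => b (u, z.2)) z.1 := fun hb _ hz =>
    differentiableAt_slice hz (contDiffOn_slice hb.contDiffOn hz)
  have hc : ∀ c : ℂ, A.IsPolarCoeff fun _ => c := fun c => .smooth contDiffOn_const
  induction ha with
  | @smooth a h =>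
    have h1 : ∀ v : Coords m l, A.IsPolarCoeff fun z => fderiv ℝ a z v := fun v =>
      .smooth ((h.fderiv_of_isOpen A.isOpen_V (m := ∞) (by simp)).clm_apply contDiffOn_const)
    -- `∂/∂r = cos θ ∂/∂x + sin θ ∂/∂y`
    refine .congr (.add (.mul (.mul (hc (1 / 2)) (.add (.phase j) (.conjPhase j)))
      (h1 (Pi.single j 1, 0))) (.mul (.mul (hc (-Complex.I / 2))
        (.add (.phase j) (.mul (hc (-1)) (.conjPhase j)))) (h1 (Pi.single j Complex.I, 0)))) ?_
    intro z hz
    have hda : DifferentiableAt ℝ a z :=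
      (h.contDiffAt (A.isOpen_V.mem_nhds hz.1)).differentiableAt (by simp)
    set p : ℂ := z.1 j / (‖z.1 j‖ : ℂ) with hp
    have hre : (1 / 2 : ℂ) * (p + conj p) = (p.re : ℂ) := by
      rw [Complex.add_conj]; push_cast; ring
    have him : -Complex.I / 2 * (p + -1 * conj p) = (p.im : ℂ) := by
      have := Complex.sub_conj p
      rw [show p + -1 * conj p = p - conj p by ring, this]
      push_cast
      linear_combination (-(p.im : ℂ)) * Complex.I_sq
    have hv : ((Pi.single j p, 0) : Coords m l) =
        p.re • ((Pi.single j 1, 0) : Coords m l) + p.im • ((Pi.single j Complex.I, 0) : Coords m l) := by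
      refine Prod.ext (funext fun i => ?_) (by simp)
      by_cases hij : i = j
      · subst hij
        simp [Complex.re_add_im]
      · simp [hij]
    change (1 / 2 : ℂ) * (p + conj p) * _ + -Complex.I / 2 * (p + -1 * conj p) * _ = _
    rw [hre, him, _root_.radialDeriv, hda.lineDeriv_eq_fderiv, hv, map_add, map_smul, map_smul]
    simp
  | phase i =>
    exact .congr (hc 0) fun z hz => (radialDeriv_phase (hz.2 j)).symm
  | conjPhase i =>
    exact .congr (hc 0) fun z hz => by rw [radialDeriv_conj, radialDeriv_phase (hz.2 j), map_zero]
  | add ha hb h1 h2 =>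
    exact .congr (.add h1 h2) fun z hz => (radialDeriv_add (hd ha hz) (hd hb hz)).symm
  | mul ha hb h1 h2 =>
    exact .congr (.add (.mul h1 hb) (.mul ha h2)) fun z hz =>
      (radialDeriv_mul (hd ha hz) (hd hb hz)).symm
  | congr ha h2 h1 =>
    refine .congr h1 fun z hz => radialDeriv_congr ?_
    filter_upwards [A.isOpen_sliceOffD.mem_nhds (mem_sliceOffD hz)] with u hu
    exact h2 (mem_offD_of_slice hz hu)

lemma IsPolarCoeff.bounded {a : Coords m l → ℂ} (ha : A.IsPolarCoeff a) {K : Set (Coords m l)}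
    (hK : IsCompact K) (hKV : K ⊆ A.V) : ∃ C : ℝ, ∀ z ∈ K, z ∈ A.offD → ‖a z‖ ≤ C := by
  have hph : ∀ w : ℂ, ‖w / (‖w‖ : ℂ)‖ ≤ 1 := fun w => by
    rw [norm_div, Complex.norm_real, norm_norm]
    exact div_self_le_one _
  induction ha with
  | smooth h =>
    obtain ⟨C, hC⟩ := hK.exists_bound_of_continuousOn (h.continuousOn.mono hKV)
    exact ⟨C, fun z hz _ => hC z hz⟩
  | phase j => exact ⟨1, fun z _ _ => hph _⟩
  | conjPhase j => exact ⟨1, fun z _ _ => by rw [RCLike.norm_conj]; exact hph _⟩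
  | add _ _ h1 h2 =>
    obtain ⟨C1, h1⟩ := h1
    obtain ⟨C2, h2⟩ := h2
    exact ⟨C1 + C2, fun z hz hz' => (norm_add_le _ _).trans (add_le_add (h1 z hz hz') (h2 z hz hz'))⟩
  | mul _ _ h1 h2 =>
    obtain ⟨C1, h1⟩ := h1
    obtain ⟨C2, h2⟩ := h2
    exact ⟨C1 * C2, fun z hz hz' => (norm_mul _ _).le.trans
      (mul_le_mul (h1 z hz hz') (h2 z hz hz') (norm_nonneg _)
        ((norm_nonneg _).trans (h1 z hz hz')))⟩
  | congr _ h2 h1 =>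
    obtain ⟨C1, h1⟩ := h1
    exact ⟨C1, fun z hz hz' => by rw [← h2 hz']; exact h1 z hz hz'⟩

/-! ### Normalised radial derivatives of the potential -/

/-- The function `(r_j / 2) ∂ψ_D/∂r_j`. -/
def logDeriv (A : AdmissiblePolydisc m l) (j : Fin m) (z : Coords m l) : ℝ :=
  1 - radialEuler j A.smD z / 2

lemma radialStep_eq (F : Coords m l → ℂ) (j : Fin m) :
    A.radialStep F j = radialDeriv j fun z => F z / (A.logDeriv j z : ℂ) := rfl

lemma contDiffOn_smD : ContDiffOn ℝ ∞ A.smD A.V := A.smD_smooth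

lemma contDiffOn_logDeriv (j : Fin m) : ContDiffOn ℝ ∞ (A.logDeriv j) A.V := by
  have h1 := (contDiffOn_smD (A := A)).fderiv_of_isOpen A.isOpen_V (m := ∞) (by simp)
  have h2 : ContDiff ℝ ∞ fun z : Coords m l => ((Pi.single j (z.1 j), 0) : Coords m l) := by
    refine ContDiff.prodMk (contDiff_pi.2 fun i => ?_) contDiff_const
    by_cases hij : i = j
    · subst hij; simp only [Pi.single_eq_same]; fun_prop
    · simp only [Pi.single_eq_of_ne hij]; exact contDiff_const
  exact contDiffOn_const.sub ((h1.clm_apply h2.contDiffOn).div_const 2)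

lemma logDeriv_pos (j : Fin m) {z : Coords m l} (hz : z ∈ A.V) : 0 < A.logDeriv j z := by
  obtain ⟨c, hc, h⟩ := A.radial_pos j
  have := h z hz.1 hz.2
  unfold logDeriv
  linarith

lemma logDeriv_eq_one {j : Fin m} {z : Coords m l} (hz : z.1 j = 0) : A.logDeriv j z = 1 := by
  have : ((Pi.single j (0 : ℂ), 0) : Coords m l) = 0 := by ext <;> simp
  rw [logDeriv, radialEuler, hz, this]
  simp

lemma isPolarCoeff_inv_logDeriv (j : Fin m) :
    A.IsPolarCoeff fun z => (A.logDeriv j z : ℂ)⁻¹ := by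
  have h1 : ContDiffOn ℝ ∞ (fun z => (A.logDeriv j z : ℂ)) A.V :=
    Complex.ofRealCLM.contDiff.comp_contDiffOn (contDiffOn_logDeriv j)
  exact .smooth (h1.inv fun z hz => Complex.ofReal_ne_zero.2 (logDeriv_pos j hz).ne')

lemma radialStep_const_mul {j : Fin m} {κ F : Coords m l → ℂ}
    (hκ : ∀ z d, κ (z + (Pi.single j d, 0)) = κ z) :
    A.radialStep (fun y => κ y * F y) j = fun z => κ z * A.radialStep F j z := by
  funext z
  simp only [radialStep_eq, mul_div_assoc]
  exact radialDeriv_const_mul hκ z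

lemma foldl_radialStep_const_mul {L : List (Fin m)} {κ F : Coords m l → ℂ}
    (hκ : ∀ j ∈ L, ∀ z d, κ (z + (Pi.single j d, 0)) = κ z) :
    L.foldl A.radialStep (fun y => κ y * F y) = fun z => κ z * L.foldl A.radialStep F z := by
  induction L generalizing F with
  | nil => rfl
  | cons j L ih =>
    rw [List.foldl_cons, List.foldl_cons, radialStep_const_mul (hκ j (by simp)),
      ih fun i hi => hκ i (by simp [hi])]

lemma foldl_radialStep_congr {L : List (Fin m)} {F G : Coords m l → ℂ} (h : Set.EqOn F G A.offD) :
    Set.EqOn (L.foldl A.radialStep F) (L.foldl A.radialStep G) A.offD := by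
  induction L generalizing F G with
  | nil => exact h
  | cons j L ih =>
    refine ih fun z hz => ?_
    simp only [radialStep_eq]
    refine radialDeriv_congr ?_
    filter_upwards [A.isOpen_sliceOffD.mem_nhds (mem_sliceOffD hz)] with u hu
    rw [h (mem_offD_of_slice hz hu)]

/-! ### Radially regular functions -/

variable (A) in
/-- The regularity required of the functions `⟨g_P, g_{P'}⟩`: smooth in the polar sense along `U`
for almost every `w`, with all mixed radial derivatives locally integrable for the polar measure. -/
structure IsRadiallyRegular (h : Coords m l → ℂ) : Prop where
  smooth_U : ∀ᵐ w ∂(volume.restrict A.W), IsPolarSmoothOn A.U fun u => h (u, w)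
  locInt : ∀ L : List (Fin m), L.Nodup → LocallyIntegrableOn
    (fun z : Coords m l => radialDerivs L h z / ((∏ j, ‖z.1 j‖ : ℝ) : ℂ)) A.V volume

variable (A) in
/-- The points off `D` over those `w` for which `h(·, w)` is smooth in the polar sense. -/
def goodSet (h : Coords m l → ℂ) : Set (Coords m l) :=
  {z | z ∈ A.offD ∧ IsPolarSmoothOn A.U fun u => h (u, z.2)}

lemma mem_goodSet_of_slice {h : Coords m l → ℂ} {z : Coords m l} (hz : z ∈ A.goodSet h)
    {u : Fin m → ℂ} (hu : u ∈ A.sliceOffD) : (u, z.2) ∈ A.goodSet h :=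
  ⟨mem_offD_of_slice hz.1 hu, hz.2⟩

lemma volume_restrict_V : (volume : Measure (Coords m l)).restrict A.V =
    (volume.restrict A.U).prod (volume.restrict A.W) := by
  rw [Measure.prod_restrict]; rfl

lemma IsRadiallyRegular.ae_mem_goodSet {h : Coords m l → ℂ} (hh : A.IsRadiallyRegular h) :
    ∀ᵐ z ∂(volume.restrict A.V), z ∈ A.goodSet h := by
  have h1 : ∀ᵐ z ∂(volume.restrict A.V), IsPolarSmoothOn A.U fun u => h (u, z.2) := by
    rw [volume_restrict_V]
    exact Measure.quasiMeasurePreserving_snd.ae hh.smooth_U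
  filter_upwards [A.ae_mem_offD, h1] with z h2 h3
  exact ⟨h2, h3⟩

lemma contDiffOn_of_isPolarSmoothOn {h : (Fin m → ℂ) → ℂ} (hh : IsPolarSmoothOn A.U h) :
    ContDiffOn ℝ ∞ h A.sliceOffD := by
  obtain ⟨S, a, ha, hsum⟩ := hh
  have hpow : ∀ (j : Fin m) (k : ℕ),
      ContDiffOn ℝ ∞ (fun u : Fin m → ℂ => (u j / (‖u j‖ : ℂ)) ^ k) A.sliceOffD := fun j k =>
    ContDiffOn.pow (fun u hu => (contDiffAt_phase (hu.2 j)).contDiffWithinAt) k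
  have hzpow : ∀ (j : Fin m) (k : ℤ),
      ContDiffOn ℝ ∞ (fun u : Fin m → ℂ => (u j / (‖u j‖ : ℂ)) ^ k) A.sliceOffD := by
    intro j k
    cases k with
    | ofNat k => simpa using hpow j k
    | negSucc k =>
      simp_rw [zpow_negSucc]
      refine (hpow j (k + 1)).inv fun u hu => ?_
      exact pow_ne_zero _ (div_ne_zero (hu.2 j) (by simpa using hu.2 j))
  refine ContDiffOn.congr (f := fun u => ∑ ν ∈ S, a ν u * ∏ j, (u j / (‖u j‖ : ℂ)) ^ (ν j)) ?_
    fun u hu => hsum u hu.1 hu.2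
  exact ContDiffOn.sum fun ν hν => ((ha ν hν).mono fun u hu => hu.1).mul
    (contDiffOn_prod fun j _ => hzpow j (ν j))

/-- Sums of terms `c · ∂^s h / ∂r_{j_s} ⋯ ∂r_{j_1}` with distinct `j_1, …, j_s ∈ S` and polar
coefficients `c` vanishing off `K`. -/
inductive RadialComb (A : AdmissiblePolydisc m l) (h : Coords m l → ℂ) (K : Set (Coords m l)) :
    Finset (Fin m) → (Coords m l → ℂ) → Prop
  | term {S : Finset (Fin m)} {c : Coords m l → ℂ} {L : List (Fin m)} : A.IsPolarCoeff c →
      (∀ z ∉ K, c z = 0) → L.Nodup → (∀ j ∈ L, j ∈ S) →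
      RadialComb A h K S fun z => c z * radialDerivs L h z
  | add {S : Finset (Fin m)} {F G : Coords m l → ℂ} : RadialComb A h K S F →
      RadialComb A h K S G → RadialComb A h K S fun z => F z + G z
  | congr {S : Finset (Fin m)} {F G : Coords m l → ℂ} : RadialComb A h K S F →
      Set.EqOn F G (A.goodSet h) → RadialComb A h K S G

variable {h : Coords m l → ℂ} {K : Set (Coords m l)} {S : Finset (Fin m)} {F : Coords m l → ℂ}

lemma contDiffOn_slice_radialDerivs (L : List (Fin m)) {z : Coords m l} (hz : z ∈ A.goodSet h) :
    ContDiffOn ℝ ∞ (fun u => radialDerivs L h (u, z.2)) A.sliceOffD := by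
  induction L using List.reverseRecOn with
  | nil => exact contDiffOn_of_isPolarSmoothOn hz.2
  | append_singleton L j ih =>
    rw [radialDerivs_append]
    exact contDiffOn_slice_radialDeriv ih j

lemma RadialComb.contDiffOn_slice (hF : RadialComb A h K S F) {z : Coords m l}
    (hz : z ∈ A.goodSet h) : ContDiffOn ℝ ∞ (fun u => F (u, z.2)) A.sliceOffD := by
  induction hF with
  | term hc _ _ _ =>
    exact (AdmissiblePolydisc.contDiffOn_slice hc.contDiffOn hz.1).mul
      (contDiffOn_slice_radialDerivs _ hz)
  | add _ _ h1 h2 => exact h1.add h2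
  | congr _ h2 h1 =>
    exact h1.congr fun u hu => (h2 (mem_goodSet_of_slice hz hu)).symm

lemma radialDeriv_eq_zero_of_notMem (hK : IsClosed K) {c : Coords m l → ℂ}
    (hc : ∀ z ∉ K, c z = 0) (j : Fin m) {z : Coords m l} (hz : z ∉ K) : radialDeriv j c z = 0 := by
  have h0 : c =ᶠ[𝓝 z] fun _ => 0 := by
    filter_upwards [hK.isOpen_compl.mem_nhds hz] with y hy using hc y hy
  rw [radialDeriv, h0.lineDeriv_eq]
  simp [lineDeriv]

lemma RadialComb.radialStep (hK : IsClosed K) (hF : RadialComb A h K S F) {j : Fin m}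
    (hj : j ∉ S) : RadialComb A h K (insert j S) (A.radialStep F j) := by
  have hd : ∀ {G : Coords m l → ℂ}, RadialComb A h K S G → ∀ {z}, z ∈ A.goodSet h →
      DifferentiableAt ℝ (fun u => G (u, z.2) / (A.logDeriv j (u, z.2) : ℂ)) z.1 := by
    intro G hG z hz
    simp_rw [div_eq_mul_inv]
    exact (differentiableAt_slice hz.1 (hG.contDiffOn_slice hz)).mul
      (differentiableAt_slice (F := fun z => (A.logDeriv j z : ℂ)⁻¹) hz.1
        (AdmissiblePolydisc.contDiffOn_slice (isPolarCoeff_inv_logDeriv j).contDiffOn hz.1))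
  induction hF with
  | @term c L hc hcK hL hLS =>
    have hc' : A.IsPolarCoeff fun z => c z * (A.logDeriv j z : ℂ)⁻¹ :=
      hc.mul (isPolarCoeff_inv_logDeriv j)
    have hcK' : ∀ z ∉ K, c z * (A.logDeriv j z : ℂ)⁻¹ = 0 := fun z hz => by
      rw [hcK z hz, zero_mul]
    have hjL : j ∉ L := fun hjL => hj (hLS j hjL)
    refine .congr (.add (.term (hc'.radialDeriv j)
        (fun z hz => radialDeriv_eq_zero_of_notMem hK hcK' j hz) hL
        fun i hi => Finset.mem_insert_of_mem (hLS i hi))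
      (.term (L := L ++ [j]) hc' hcK' (List.nodup_append.2 ⟨hL, by simp, by
        intro a ha b hb hab
        simp only [List.mem_singleton] at hb
        exact hjL (hb ▸ hab ▸ ha)⟩) ?_)) ?_
    · intro i hi
      rcases List.mem_append.1 hi with hi | hi
      · exact Finset.mem_insert_of_mem (hLS i hi)
      · simp only [List.mem_singleton] at hi
        exact hi ▸ Finset.mem_insert_self _ _
    · intro z hz
      simp only [radialStep_eq, radialDerivs_append]
      rw [← radialDeriv_mul
        (differentiableAt_slice hz.1 (AdmissiblePolydisc.contDiffOn_slice hc'.contDiffOn hz.1))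
        (differentiableAt_slice hz.1 (contDiffOn_slice_radialDerivs L hz))]
      congr 1
      funext y
      ring
  | @add F G hF hG h1 h2 =>
    refine .congr (.add h1 h2) fun z hz => ?_
    simp only [radialStep_eq, add_div]
    exact (radialDeriv_add (F := fun y => F y / (A.logDeriv j y : ℂ))
      (G := fun y => G y / (A.logDeriv j y : ℂ)) (hd hF hz) (hd hG hz)).symm
  | congr _ h2 h1 =>
    refine .congr h1 fun z hz => ?_
    simp only [radialStep_eq]
    refine radialDeriv_congr ?_
    filter_upwards [A.isOpen_sliceOffD.mem_nhds (mem_sliceOffD hz.1)] with u hu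
    rw [h2 (mem_goodSet_of_slice hz hu)]

lemma RadialComb.foldl (hK : IsClosed K) {L : List (Fin m)} (hL : L.Nodup)
    (hLS : ∀ j ∈ L, j ∉ S) (hF : RadialComb A h K S F) :
    RadialComb A h K (S ∪ L.toFinset) (L.foldl A.radialStep F) := by
  induction L generalizing S F with
  | nil => simpa using hF
  | cons j L ih =>
    rw [List.nodup_cons] at hL
    have h1 := ih (S := insert j S) hL.2 (fun i hi => by
      simp only [Finset.mem_insert, not_or]
      exact ⟨fun hij => hL.1 (hij ▸ hi), hLS i (by simp [hi])⟩)
      (hF.radialStep hK (hLS j (by simp)))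
    rw [List.foldl_cons, List.toFinset_cons, Finset.union_insert, ← Finset.insert_union]
    exact h1

/-- Combinations of radial derivatives of a radially regular function are integrable for the polar
measure. -/
lemma RadialComb.integrableOn (hh : A.IsRadiallyRegular h) (hK : IsCompact K) (hKV : K ⊆ A.V)
    (hF : RadialComb A h K S F) :
    IntegrableOn (fun z => F z / ((∏ j, ‖z.1 j‖ : ℝ) : ℂ)) A.V := by
  induction hF with
  | @term c L hc hcK hL _ =>
    have h1 : IntegrableOn (fun z : Coords m l =>
        radialDerivs L h z / ((∏ j, ‖z.1 j‖ : ℝ) : ℂ)) K :=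
      (hh.locInt L hL).integrableOn_compact_subset hKV hK
    obtain ⟨C, hC⟩ := hc.bounded hK hKV
    have h2 : AEStronglyMeasurable c (volume.restrict K) :=
      (A.aestronglyMeasurable_of_continuousOn hc.contDiffOn.continuousOn).mono_measure
        (Measure.restrict_mono hKV le_rfl)
    have h3 : ∀ᵐ z ∂(volume.restrict K), ‖c z‖ ≤ C := by
      filter_upwards [ae_restrict_mem hK.measurableSet,
        ae_mono (Measure.restrict_mono hKV le_rfl) A.ae_mem_offD] with z hz hz'
      exact hC z hz hz'
    have h4 := Integrable.bdd_mul h1 h2 h3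
    have h5 : IntegrableOn (fun z => c z * radialDerivs L h z / ((∏ j, ‖z.1 j‖ : ℝ) : ℂ)) K := by
      simpa only [IntegrableOn, mul_div_assoc] using h4
    refine ((integrableOn_iff_integrable_of_support_subset fun z hz => ?_).1 h5).integrableOn
    by_contra hzK
    exact hz (by simp [hcK z hzK])
  | add _ _ h1 h2 =>
    simp_rw [add_div]
    exact h1.add h2
  | congr _ h2 h1 =>
    refine h1.congr ?_
    filter_upwards [hh.ae_mem_goodSet] with z hz
    rw [h2 hz]

lemma IsRadiallyRegular.aestronglyMeasurable (hh : A.IsRadiallyRegular h) :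
    AEStronglyMeasurable h (volume.restrict A.V) := by
  have h1 := (hh.locInt [] List.nodup_nil).aestronglyMeasurable
  have h2 : AEStronglyMeasurable (fun z : Coords m l => ((∏ j, ‖z.1 j‖ : ℝ) : ℂ))
      (volume.restrict A.V) := (by fun_prop : Continuous _).aestronglyMeasurable
  refine (h1.mul h2).congr ?_
  filter_upwards [A.ae_mem_offD] with z hz
  have h3 : ((∏ j, ‖z.1 j‖ : ℝ) : ℂ) ≠ 0 := Complex.ofReal_ne_zero.2
    (Finset.prod_ne_zero_iff.2 fun j _ => norm_ne_zero_iff.2 (hz.2 j))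
  exact div_mul_cancel₀ _ h3

end AdmissiblePolydisc

end RadialCalculus

/-! ### Slices in partial polar coordinates -/

section PolarSlices

variable {m l : ℕ}

namespace RadialModel

variable {ι : Type*} [Fintype ι] [DecidableEq ι] {M : RadialModel ι}

lemma foldl_step_congr {L : List ι} {F G : (ι → ℝ) → ℂ} (h : Set.EqOn F G M.posBox) :
    Set.EqOn (L.foldl M.step F) (L.foldl M.step G) M.posBox := by
  induction L generalizing F G with
  | nil => exact h
  | cons j L ih =>
    refine ih fun r hr => ?_
    have h1 : (fun x => F x / (M.e j x : ℂ)) =ᶠ[𝓝 r] fun x => G x / (M.e j x : ℂ) := by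
      filter_upwards [M.isOpen_posBox.mem_nhds hr] with x hx
      rw [h hx]
    exact h1.lineDeriv_eq

end RadialModel

section PolarSplit

variable {P : Finset (Fin m)} {r : {j // j ∈ P} → ℝ} {x : PolarBase l P} {i : {j // j ∈ P}}

lemma polarSplit_add (t : ℝ) :
    polarSplit P (r + t • Pi.single i 1) x = polarSplit P r x +
      t • ((Pi.single i.1 (Complex.exp ((x.1 i : ℂ) * Complex.I)), 0) : Coords m l) := by
  refine Prod.ext (funext fun j => ?_) (by simp [polarSplit])
  by_cases hj : j ∈ P
  · by_cases hij : j = i.1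
    · subst hij
      simp [polarSplit, add_mul]
    · have : (⟨j, hj⟩ : {j // j ∈ P}) ≠ i := fun h => hij (by rw [← h])
      simp [polarSplit, hj, hij, this]
  · have hij : j ≠ i.1 := fun h => hj (h ▸ i.2)
    simp [polarSplit, hj, hij]

lemma update_eq_add (t : ℝ) : Function.update r i t = r + (t - r i) • Pi.single i (1 : ℝ) := by
  funext k
  by_cases hk : k = i
  · subst hk; simp
  · simp [hk]

lemma contDiff_polarSplit (x : PolarBase l P) : ContDiff ℝ ∞ fun r => polarSplit P r x := by
  unfold polarSplit
  refine ContDiff.prodMk (contDiff_pi.2 fun j => ?_) contDiff_const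
  by_cases hj : j ∈ P
  · simp only [hj, dif_pos]
    exact (Complex.ofRealCLM.contDiff.comp (contDiff_apply ℝ ℝ (⟨j, hj⟩ : {j // j ∈ P}))).mul
      contDiff_const
  · simp only [hj, dif_neg, not_false_eq_true]
    exact contDiff_const

lemma phase_polarSplit_mem (hr : 0 < r i) :
    (polarSplit P r x).1 i / (‖(polarSplit P r x).1 i‖ : ℂ) =
      Complex.exp ((x.1 i : ℂ) * Complex.I) := by
  rw [norm_polarSplit_mem, polarSplit_fst_mem, abs_of_pos hr]
  exact mul_div_cancel_left₀ _ (Complex.ofReal_ne_zero.2 hr.ne')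

/-- In polar coordinates `∂/∂r_i` is an ordinary partial derivative. -/
lemma radialDeriv_polarSplit (F : Coords m l → ℂ) (hr : 0 < r i) :
    radialDeriv i.1 F (polarSplit P r x) =
      lineDeriv ℝ (fun y => F (polarSplit P y x)) r (Pi.single i 1) := by
  simp only [radialDeriv, lineDeriv, polarSplit_add, phase_polarSplit_mem hr]

end PolarSplit

namespace AdmissiblePolydisc

variable {A : AdmissiblePolydisc m l} {P : Finset (Fin m)}

lemma continuousOn_psiD : ContinuousOn A.psiD A.offD := by
  refine ContinuousOn.sub ?_ (contDiffOn_smD.continuousOn.mono A.offD_subset_V)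
  refine continuousOn_finsetSum _ fun j _ => ContinuousOn.log ?_ fun z hz => ?_
  · exact Continuous.continuousOn (by fun_prop)
  · exact pow_ne_zero _ (norm_ne_zero_iff.2 (hz.2 j))

lemma psiD_le_of_mem {z : Coords m l} (hz : z ∈ A.offD) : A.psiD z ≤ -1 :=
  A.psiD_le z hz.1.1 hz.1.2 hz.2

lemma one_le_abs_psiD {z : Coords m l} (hz : z ∈ A.offD) : 1 ≤ |A.psiD z| := by
  have := psiD_le_of_mem hz
  rw [abs_of_neg (by linarith)]; linarith

variable (A P) in
/-- The parameters of polar coordinates whose fibres lie in `V` and meet `D` only along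
`{u_j = 0}`, `j ∈ P`. -/
def regularBase : Set (PolarBase l P) := {x | x.2 ∈ A.lcCentre P ∧ ∀ j, x.2.1 j ≠ 0}

lemma polarSplit_mem_V {x : PolarBase l P} (hx : x ∈ A.regularBase P) {r : {j // j ∈ P} → ℝ}
    (hr : ∀ i, |r i| < A.radii P i) : polarSplit P r x ∈ A.V := by
  refine ⟨fun j => ?_, hx.1.2⟩
  by_cases hj : j ∈ P
  · exact (norm_polarSplit_mem r x ⟨j, hj⟩).trans_lt (hr ⟨j, hj⟩)
  · rw [polarSplit_fst_notMem r x ⟨j, hj⟩]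
    exact hx.1.1 ⟨j, hj⟩

lemma polarSplit_mem_offD {x : PolarBase l P} (hx : x ∈ A.regularBase P)
    {r : {j // j ∈ P} → ℝ} (hr : ∀ i, r i ∈ Set.Ioo 0 (A.radii P i)) :
    polarSplit P r x ∈ A.offD := by
  refine ⟨polarSplit_mem_V hx fun i => by rw [abs_of_pos (hr i).1]; exact (hr i).2, fun j => ?_⟩
  by_cases hj : j ∈ P
  · rw [← norm_ne_zero_iff, norm_polarSplit_mem r x ⟨j, hj⟩, abs_of_pos (hr _).1]
    exact (hr _).1.ne'
  · rw [polarSplit_fst_notMem r x ⟨j, hj⟩]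
    exact hx.2 ⟨j, hj⟩

lemma update_mem {R r : {j // j ∈ P} → ℝ} (hr : ∀ i, r i ∈ Set.Ioo 0 (R i)) {i : {j // j ∈ P}}
    {t : ℝ} (ht : |t| < R i) (k : {j // j ∈ P}) : |Function.update r i t k| < R k := by
  by_cases hk : k = i
  · subst hk; simpa using ht
  · rw [Function.update_of_ne hk, abs_of_pos (hr k).1]; exact (hr k).2

/-- Along a coordinate line of the polar coordinates the singular part of `ψ_D` is `log t²`. -/
lemma psiD_polarSplit_update (r : {j // j ∈ P} → ℝ) (x : PolarBase l P) (i : {j // j ∈ P})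
    (t : ℝ) : A.psiD (polarSplit P (Function.update r i t) x) =
      (∑ j ∈ Finset.univ.erase i.1, Real.log (‖(polarSplit P r x).1 j‖ ^ 2)) + 2 * Real.log t -
        A.smD (polarSplit P (Function.update r i t) x) := by
  rw [psiD, phiD, ← Finset.sum_erase_add _ _ (Finset.mem_univ i.1), norm_polarSplit_mem,
    Function.update_self, sq_abs, Real.log_pow]
  congr 2
  refine Finset.sum_congr rfl fun j hj => ?_
  rw [update_eq_add, polarSplit_add]
  simp [Pi.single_eq_of_ne (Finset.ne_of_mem_erase hj)]

variable (A P) in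
/-- The restriction of `ψ_D` to a fibre of the polar coordinates. -/
def fibreModel (x : PolarBase l P) (hx : x ∈ A.regularBase P) : RadialModel {j // j ∈ P} where
  R := A.radii P
  e i r := A.logDeriv i.1 (polarSplit P r x)
  psi r := A.psiD (polarSplit P r x)
  R_pos i := A.R_pos i
  e_smooth i := (contDiffOn_logDeriv i.1).comp (contDiff_polarSplit x).contDiffOn
    fun _ hr => polarSplit_mem_V hx hr
  e_pos i _ hr := logDeriv_pos i.1 (polarSplit_mem_V hx hr)
  e_zero i r _ hri := logDeriv_eq_one (by rw [polarSplit_fst_mem, hri]; simp)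
  psi_le r hr := psiD_le_of_mem (polarSplit_mem_offD hx hr)
  psi_cont := continuousOn_psiD.comp (contDiff_polarSplit x).continuous.continuousOn
    fun _ hr => polarSplit_mem_offD hx hr
  psi_deriv r hr i := by
    have hri := (hr i).1
    set z := polarSplit P r x with hz
    set d : Coords m l := (Pi.single i.1 (Complex.exp ((x.1 i : ℂ) * Complex.I)), 0) with hd
    have hzV : z ∈ A.V := (polarSplit_mem_offD hx hr).1
    have hdiff : DifferentiableAt ℝ A.smD z :=
      (contDiffOn_smD.contDiffAt (A.isOpen_V.mem_nhds hzV)).differentiableAt (by simp)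
    have h1 : HasDerivAt (fun t => A.smD (polarSplit P (Function.update r i t) x))
        (fderiv ℝ A.smD z d) (r i) := by
      simp_rw [update_eq_add, polarSplit_add, ← hz, ← hd]
      have h2 : HasDerivAt (fun t : ℝ => z + (t - r i) • d) d (r i) := by
        have := (((hasDerivAt_id (r i)).sub_const (r i)).smul_const d).const_add z
        simpa using this
      have h3 : HasFDerivAt A.smD (fderiv ℝ A.smD z) (z + (r i - r i) • d) := by
        simpa using hdiff.hasFDerivAt
      exact h3.comp_hasDerivAt _ h2
    have h2 : HasDerivAt (fun t => A.psiD (polarSplit P (Function.update r i t) x))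
        (2 * (r i)⁻¹ - fderiv ℝ A.smD z d) (r i) := by
      simp_rw [psiD_polarSplit_update]
      exact (((Real.hasDerivAt_log hri.ne').const_mul 2).const_add _).sub h1
    convert! h2 using 1
    have h3 : ((Pi.single i.1 (z.1 i.1), 0) : Coords m l) = r i • d := by
      rw [hz, polarSplit_fst_mem, hd, Prod.smul_mk, ← Pi.single_smul', smul_zero,
        Complex.real_smul]
    rw [logDeriv, radialEuler, h3, map_smul, smul_eq_mul]
    field_simp
  psi_lim r hr i := by
    simp_rw [psiD_polarSplit_update]
    have h1 : Tendsto (fun t => A.smD (polarSplit P (Function.update r i t) x)) (𝓝[>] 0)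
        (𝓝 (A.smD (polarSplit P (Function.update r i 0) x))) := by
      have h2 : ContinuousAt A.smD (polarSplit P (Function.update r i 0) x) :=
        contDiffOn_smD.continuousOn.continuousAt (A.isOpen_V.mem_nhds
          (polarSplit_mem_V hx (update_mem hr (by rw [abs_zero]; exact A.R_pos i))))
      have h3 : Continuous fun t => polarSplit P (Function.update r i t) x :=
        (contDiff_polarSplit x).continuous.comp (RadialModel.continuous_update_line r i)
      exact (h2.tendsto.comp h3.continuousAt.tendsto).mono_left nhdsWithin_le_nhds
    have h4 : Tendsto (fun t : ℝ => 2 * Real.log t) (𝓝[>] 0) atBot :=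
      Real.tendsto_log_nhdsGT_zero.const_mul_atBot (by norm_num)
    have h5 := (tendsto_atBot_add_const_left _
      (∑ j ∈ Finset.univ.erase i.1, Real.log (‖(polarSplit P r x).1 j‖ ^ 2)) h4)
    simpa only [sub_eq_add_neg] using h5.atBot_add h1.neg

/-- Radial integration by parts on `V` becomes integration by parts on the fibres. -/
lemma foldl_radialStep_polarSplit {x : PolarBase l P} (hx : x ∈ A.regularBase P)
    (L : List {j // j ∈ P}) (F : Coords m l → ℂ) :
    Set.EqOn (fun r => (L.map Subtype.val).foldl A.radialStep F (polarSplit P r x))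
      (L.foldl (A.fibreModel P x hx).step fun r => F (polarSplit P r x))
      (A.fibreModel P x hx).posBox := by
  induction L generalizing F with
  | nil => exact fun r _ => rfl
  | cons j L ih =>
    intro r hr
    rw [List.map_cons, List.foldl_cons, List.foldl_cons]
    refine (ih (A.radialStep F j.1) hr).trans (RadialModel.foldl_step_congr (fun r hr => ?_) hr)
    exact radialDeriv_polarSplit _ (hr j).1

/-- Polar smoothness lets the restriction to a fibre extend smoothly across `r_P = 0`. -/
lemma exists_smooth_extension {h : Coords m l → ℂ} {x : PolarBase l P}
    (hx : x ∈ A.regularBase P) (hh : IsPolarSmoothOn A.U fun u => h (u, x.2.2)) :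
    ∃ g : ({j // j ∈ P} → ℝ) → ℂ, ContDiffOn ℝ ∞ g (A.fibreModel P x hx).box ∧
      Set.EqOn (fun r => h (polarSplit P r x)) g (A.fibreModel P x hx).posBox := by
  obtain ⟨S, a, ha, hsum⟩ := hh
  set p : Fin m → ℂ := fun j => if hj : j ∈ P then Complex.exp ((x.1 ⟨j, hj⟩ : ℂ) * Complex.I)
    else x.2.1 ⟨j, hj⟩ / (‖x.2.1 ⟨j, hj⟩‖ : ℂ) with hp
  refine ⟨fun r => ∑ ν ∈ S, a ν (polarSplit P r x).1 * ∏ j, p j ^ ν j, ?_, fun r hr => ?_⟩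
  · refine ContDiffOn.sum fun ν hν => ContDiffOn.mul ?_ contDiffOn_const
    exact (ha ν hν).comp (contDiff_fst.comp (contDiff_polarSplit x)).contDiffOn
      fun r hr => (polarSplit_mem_V hx hr).1
  · have hz := polarSplit_mem_offD hx hr
    have h1 := hsum (polarSplit P r x).1 hz.1.1 hz.2
    refine h1.trans (Finset.sum_congr rfl fun ν _ => ?_)
    congr 1
    refine Finset.prod_congr rfl fun j _ => ?_
    congr 1
    by_cases hj : j ∈ P
    · simp only [hp, hj, dif_pos]
      exact phase_polarSplit_mem (i := ⟨j, hj⟩) (hr _).1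
    · simp only [hp, hj, dif_neg, not_false_eq_true]
      rw [polarSplit_fst_notMem r x ⟨j, hj⟩]

/-- The boundary value of `h` at `r_P = 0` as a function of the angles and of the point of the lc
centre; its angular average is `lcRestrict`. -/
def boundaryValue (P : Finset (Fin m)) (h : Coords m l → ℂ) (x : PolarBase l P) : ℂ :=
  limUnder (𝓝[>] (0 : ℝ)) fun t => h (polarPoint P t x.1 x.2.1, x.2.2)

lemma tendsto_boundaryValue {h : Coords m l → ℂ} {x : PolarBase l P} (hx : x ∈ A.regularBase P)
    {g : ({j // j ∈ P} → ℝ) → ℂ} (hg : ContDiffOn ℝ ∞ g (A.fibreModel P x hx).box)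
    (hgh : Set.EqOn (fun r => h (polarSplit P r x)) g (A.fibreModel P x hx).posBox) :
    Tendsto (fun t => h (polarPoint P t x.1 x.2.1, x.2.2)) (𝓝[>] (0 : ℝ)) (𝓝 (g 0)) := by
  have h0 : (0 : {j // j ∈ P} → ℝ) ∈ (A.fibreModel P x hx).box := fun i => by
    rw [Pi.zero_apply, abs_zero]; exact A.R_pos i
  have h1 : Tendsto (fun t : ℝ => (fun _ => t : {j // j ∈ P} → ℝ)) (𝓝[>] 0) (𝓝 0) :=
    (tendsto_pi_nhds.2 fun _ => tendsto_id).mono_left nhdsWithin_le_nhds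
  have h2 := (hg.continuousOn.continuousAt
    ((A.fibreModel P x hx).isOpen_box.mem_nhds h0)).tendsto.comp h1
  refine h2.congr' ?_
  have h3 : ∀ᶠ t in 𝓝[>] (0 : ℝ), ∀ i : {j // j ∈ P}, t < A.radii P i :=
    eventually_all.2 fun i => nhdsWithin_le_nhds (gt_mem_nhds (A.R_pos i))
  filter_upwards [self_mem_nhdsWithin, h3] with t ht ht'
  exact (hgh (fun i => ⟨ht, ht' i⟩)).symm

lemma boundaryValue_eq {h : Coords m l → ℂ} {x : PolarBase l P} (hx : x ∈ A.regularBase P)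
    {g : ({j // j ∈ P} → ℝ) → ℂ} (hg : ContDiffOn ℝ ∞ g (A.fibreModel P x hx).box)
    (hgh : Set.EqOn (fun r => h (polarSplit P r x)) g (A.fibreModel P x hx).posBox) :
    boundaryValue P h x = g 0 :=
  (tendsto_boundaryValue hx hg hgh).limUnder_eq

lemma ae_lcCentre {h : Coords m l → ℂ} (hh : A.IsRadiallyRegular h) :
    ∀ᵐ y ∂(volume.restrict (A.lcCentre P)), (y ∈ A.lcCentre P ∧ ∀ j, y.1 j ≠ 0) ∧
      IsPolarSmoothOn A.U fun u => h (u, y.2) := by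
  have h1 : ∀ᵐ y ∂(volume.restrict (A.lcCentre P)), y ∈ A.lcCentre P :=
    ae_restrict_mem (A.isOpen_lcCentre P).measurableSet
  have h2 : ∀ᵐ y ∂(volume.restrict (A.lcCentre P)), ∀ j, y.1 j ≠ 0 := by
    refine ae_restrict_of_ae (eventually_all.2 fun j => ?_)
    have h3 : ∀ᵐ v : {j // j ∉ P} → ℂ, v j ≠ 0 := by
      rw [volume_pi]
      exact Measure.ae_eval_ne (μ := fun _ : {j // j ∉ P} => (volume : Measure ℂ)) j 0
    exact Measure.quasiMeasurePreserving_fst.ae h3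
  have h3 : ∀ᵐ y ∂((volume : Measure (({j // j ∉ P} → ℂ) × (Fin l → ℂ))).restrict
      (A.lcCentre P)), IsPolarSmoothOn A.U fun u => h (u, y.2) := by
    rw [lcCentre, Measure.volume_eq_prod, ← Measure.prod_restrict]
    exact Measure.quasiMeasurePreserving_snd.ae hh.smooth_U
  exact (h1.and h2).and h3

lemma ae_regularBase {h : Coords m l → ℂ} (hh : A.IsRadiallyRegular h) :
    ∀ᵐ x ∂(A.baseMeasure P), x ∈ A.regularBase P ∧ IsPolarSmoothOn A.U fun u => h (u, x.2.2) :=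
  Measure.quasiMeasurePreserving_snd.ae (ae_lcCentre hh)

/-- A compactly supported function on `V` vanishes for `r_j` close to the radius `R_j`. -/
lemma exists_radii_of_hasCompactSupport {b : Coords m l → ℂ} (hb : HasCompactSupport b)
    (hbV : tsupport b ⊆ A.V) (P : Finset (Fin m)) :
    ∃ R' : {j // j ∈ P} → ℝ, (∀ i, R' i < A.radii P i) ∧
      ∀ z, b z ≠ 0 → ∀ i : {j // j ∈ P}, ‖z.1 i‖ ≤ R' i := by
  have h1 : ∀ i : {j // j ∈ P}, ∃ c, c < A.radii P i ∧ ∀ z, b z ≠ 0 → ‖z.1 i‖ ≤ c := by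
    intro i
    rcases (tsupport b).eq_empty_or_nonempty with he | hne
    · refine ⟨A.radii P i - 1, by linarith, fun z hz => ?_⟩
      have := subset_tsupport b hz
      rw [he] at this
      exact this.elim
    · obtain ⟨z₀, hz₀, hmax⟩ := hb.exists_isMaxOn hne
        (f := fun z : Coords m l => ‖z.1 i‖) (Continuous.continuousOn (by fun_prop))
      exact ⟨‖z₀.1 i‖, (hbV hz₀).1 i, fun z hz => hmax (subset_tsupport b hz)⟩
  choose R' h2 h3 using h1
  exact ⟨R', h2, fun z hz i => h3 i z hz⟩

/-- The restriction of `b h` to a fibre, extended across `r_P = 0`. -/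
lemma exists_isTest {b h : Coords m l → ℂ} (hbs : ContDiff ℝ ∞ b) (hb : HasCompactSupport b)
    (hbV : tsupport b ⊆ A.V) {x : PolarBase l P}
    (hx : x ∈ A.regularBase P) (hh : IsPolarSmoothOn A.U fun u => h (u, x.2.2)) :
    ∃ (R' : {j // j ∈ P} → ℝ) (f : ({j // j ∈ P} → ℝ) → ℂ), (A.fibreModel P x hx).IsTest R' f ∧
      Set.EqOn (fun r => b (polarSplit P r x) * h (polarSplit P r x)) f
        (A.fibreModel P x hx).posBox ∧
      f 0 = b (polarSplit P 0 x) * boundaryValue P h x := by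
  obtain ⟨g, hg, hgh⟩ := exists_smooth_extension hx hh
  obtain ⟨R', hR', hb0⟩ := exists_radii_of_hasCompactSupport hb hbV P
  refine ⟨R', fun r => b (polarSplit P r x) * g r, ⟨hR', ?_, ?_⟩, ?_, ?_⟩
  · exact (hbs.comp (contDiff_polarSplit x)).contDiffOn.mul hg
  · intro r hr i hi
    have : b (polarSplit P r x) = 0 := by
      by_contra hne
      have h1 := hb0 _ hne i
      rw [norm_polarSplit_mem] at h1
      exact absurd (hi.trans_le (le_abs_self _)) (not_lt.2 h1)
    rw [this, zero_mul]
  · intro r hr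
    simp only
    rw [hgh.symm hr]
  · simp only
    rw [boundaryValue_eq hx hg hgh]

end AdmissiblePolydisc

end PolarSlices

/-! ### Integration by parts on the polydisc -/

section PolydiscParts

variable {m l : ℕ}

namespace RadialModel

variable {ι : Type*} [Fintype ι] [DecidableEq ι] {M : RadialModel ι}

lemma invProd_eq_prod {L : List ι} (hL : L.Nodup) (hu : L.toFinset = Finset.univ) (r : ι → ℝ) :
    invProd L r = ∏ i, (r i)⁻¹ := by
  rw [invProd, ← List.prod_toFinset _ hL, hu]

end RadialModel

namespace AdmissiblePolydisc

variable {A : AdmissiblePolydisc m l} {P : Finset (Fin m)}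

/-- The increasing enumeration of `P`, as a list in the subtype. -/
lemma exists_subtype_sort (P : Finset (Fin m)) : ∃ L : List {j // j ∈ P},
    L.map Subtype.val = P.sort (· ≤ ·) ∧ L.Nodup ∧ L.toFinset = Finset.univ ∧
      L.length = P.card := by
  have h : ∀ j ∈ P.sort (· ≤ ·), j ∈ P := fun j hj => (Finset.mem_sort _).1 hj
  refine ⟨(P.sort (· ≤ ·)).attachWith _ h, by simp, ?_, ?_, by simp⟩
  · refine List.Nodup.of_map Subtype.val ?_
    simp
  · ext j
    simp

/-- The data of an integration by parts on `V`: the numerator is `κ b h` with `h` radially regular,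
`b` smooth with compact support, and `κ` a singular factor which does not depend on the radii
`r_j`, `j ∈ P`, and has at most a simple pole along the other components of `D`. -/
structure PartsData (A : AdmissiblePolydisc m l) (P : Finset (Fin m))
    (κ b h : Coords m l → ℂ) : Prop where
  regular : A.IsRadiallyRegular h
  smooth : ContDiff ℝ ∞ b
  compact : HasCompactSupport b
  subset : tsupport b ⊆ A.V
  continuousOn : ContinuousOn κ A.offD
  bound : ∀ z ∈ A.offD, ‖κ z‖ * ∏ j ∈ Pᶜ, ‖z.1 j‖ ≤ 1
  fibre : ∀ r r' x, κ (polarSplit P r x) = κ (polarSplit P r' x)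

/-- The density obtained from `κ b h` after integrating by parts in all the `r_j`, `j ∈ P`. -/
def partsDensity (A : AdmissiblePolydisc m l) (P : Finset (Fin m)) (κ b h : Coords m l → ℂ)
    (z : Coords m l) : ℂ :=
  κ z * (P.sort (· ≤ ·)).foldl A.radialStep (fun y => b y * h y) z /
    ((∏ j ∈ P, (2 * ‖z.1 j‖) : ℝ) : ℂ)

/-- The singular density `κ b h ∏_{j ∈ P} r_j^{-2} |ψ_D|^{-τ}`. -/
def singularDensity (A : AdmissiblePolydisc m l) (P : Finset (Fin m)) (κ b h : Coords m l → ℂ)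
    (τ : ℝ) (z : Coords m l) : ℂ :=
  κ z * (b z * h z) * ((|A.psiD z| ^ (-τ) / ∏ j ∈ P, ‖z.1 j‖ ^ 2 : ℝ) : ℂ)

variable {κ b h : Coords m l → ℂ}

lemma PartsData.integrableOn_partsDensity (D : PartsData A P κ b h) :
    IntegrableOn (A.partsDensity P κ b h) A.V := by
  have h1 : RadialComb A h (tsupport b) ∅ fun z => b z * h z :=
    .term (L := []) (.smooth D.smooth.contDiffOn) (fun z hz => image_eq_zero_of_notMem_tsupport hz)
      List.nodup_nil (by simp)
  have h2 := (h1.foldl (L := P.sort (· ≤ ·)) (isClosed_tsupport b) (Finset.sort_nodup _ _)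
    (by simp)).integrableOn D.regular D.compact D.subset
  have h3 : ContinuousOn (fun z => κ z * ((∏ j ∈ Pᶜ, ‖z.1 j‖ : ℝ) : ℂ)) A.offD :=
    D.continuousOn.mul (Continuous.continuousOn (by fun_prop))
  have h4 := Integrable.bdd_mul h2 (A.aestronglyMeasurable_of_continuousOn h3) (c := 1) (by
    filter_upwards [A.ae_mem_offD] with z hz
    rw [norm_mul, Complex.norm_real, Real.norm_of_nonneg
      (Finset.prod_nonneg fun _ _ => norm_nonneg _)]
    exact D.bound z hz)
  refine (h4.const_mul ((2 : ℂ)⁻¹ ^ P.card)).congr ?_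
  filter_upwards [A.ae_mem_offD] with z hz
  have h5 : ∀ S : Finset (Fin m), ((∏ j ∈ S, ‖z.1 j‖ : ℝ) : ℂ) ≠ 0 := fun S =>
    Complex.ofReal_ne_zero.2 (Finset.prod_ne_zero_iff.2 fun j _ => norm_ne_zero_iff.2 (hz.2 j))
  rw [partsDensity, Finset.prod_mul_distrib, ← Finset.prod_mul_prod_compl P, Finset.prod_const]
  have h6 := h5 P
  have h7 := h5 Pᶜ
  rw [Complex.ofReal_mul, Complex.ofReal_mul, Complex.ofReal_pow, inv_pow]
  push_cast at h6 h7 ⊢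
  field_simp

lemma PartsData.aestronglyMeasurable_singularDensity (D : PartsData A P κ b h) (τ : ℝ) :
    AEStronglyMeasurable (A.singularDensity P κ b h τ) (volume.restrict A.V) := by
  refine AEStronglyMeasurable.mul (((A.aestronglyMeasurable_of_continuousOn D.continuousOn)).mul
    (D.smooth.continuous.aestronglyMeasurable.mul D.regular.aestronglyMeasurable)) ?_
  refine A.aestronglyMeasurable_of_continuousOn (Complex.continuous_ofReal.comp_continuousOn ?_)
  refine ContinuousOn.div (continuousOn_psiD.abs.rpow_const fun z hz => Or.inl ?_)
    (Continuous.continuousOn (by fun_prop)) fun z hz => ?_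
  · have := one_le_abs_psiD hz
    linarith
  · exact Finset.prod_ne_zero_iff.2 fun j _ => pow_ne_zero _ (norm_ne_zero_iff.2 (hz.2 j))

lemma aestronglyMeasurable_psiD_rpow (p : ℝ) :
    AEStronglyMeasurable (fun z => ((|A.psiD z| ^ p : ℝ) : ℂ)) (volume.restrict A.V) := by
  refine A.aestronglyMeasurable_of_continuousOn (Complex.continuous_ofReal.comp_continuousOn ?_)
  refine continuousOn_psiD.abs.rpow_const fun z hz => Or.inl ?_
  have := one_le_abs_psiD hz
  linarith

lemma norm_psiD_rpow_le {p : ℝ} (hp : 0 ≤ p) :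
    ∀ᵐ z ∂(volume.restrict A.V), ‖((|A.psiD z| ^ (-p) : ℝ) : ℂ)‖ ≤ 1 := by
  filter_upwards [A.ae_mem_offD] with z hz
  rw [Complex.norm_real, Real.norm_of_nonneg (Real.rpow_nonneg (abs_nonneg _) _)]
  exact Real.rpow_le_one_of_one_le_of_nonpos (one_le_abs_psiD hz) (by linarith)

lemma PartsData.integrableOn_partsDensity_mul (D : PartsData A P κ b h) {p : ℝ} (hp : 0 ≤ p) :
    IntegrableOn (fun z => A.partsDensity P κ b h z * ((|A.psiD z| ^ (-p) : ℝ) : ℂ)) A.V := by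
  have h1 := Integrable.bdd_mul D.integrableOn_partsDensity
    (aestronglyMeasurable_psiD_rpow (-p)) (norm_psiD_rpow_le hp)
  exact h1.congr (ae_of_all _ fun z => mul_comm _ _)

lemma prod_norm_polarSplit {x : PolarBase l P} {r : {j // j ∈ P} → ℝ} (hr : ∀ i, 0 < r i)
    (φ : ℝ → ℝ) : ∏ j ∈ P, φ ‖(polarSplit P r x).1 j‖ = ∏ i, φ (r i) := by
  rw [← Finset.prod_coe_sort P]
  refine Finset.prod_congr rfl fun i _ => ?_
  rw [norm_polarSplit_mem, abs_of_pos (hr i)]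

/-- The value of `κ` on a fibre of the polar coordinates. -/
lemma PartsData.kappa_eq (D : PartsData A P κ b h) (r : {j // j ∈ P} → ℝ) (x : PolarBase l P) :
    κ (polarSplit P r x) = κ (polarSplit P 0 x) := D.fibre _ _ _

/-- The restriction of the data to a fibre of the polar coordinates. -/
lemma PartsData.exists_fibre (D : PartsData A P κ b h) {x : PolarBase l P}
    (hx : x ∈ A.regularBase P) (hh : IsPolarSmoothOn A.U fun u => h (u, x.2.2))
    {L : List {j // j ∈ P}} (hLs : L.map Subtype.val = P.sort (· ≤ ·)) (hLn : L.Nodup)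
    (hLu : L.toFinset = Finset.univ) :
    ∃ (R' : {j // j ∈ P} → ℝ) (f : ({j // j ∈ P} → ℝ) → ℂ), (A.fibreModel P x hx).IsTest R' f ∧
      f 0 = b (polarSplit P 0 x) * boundaryValue P h x ∧
      (∀ τ, ∀ r ∈ (A.fibreModel P x hx).posBox, (polarJacobian P r : ℂ) *
        A.singularDensity P κ b h τ (polarSplit P r x) = κ (polarSplit P 0 x) *
          (f r * ((|(A.fibreModel P x hx).psi r| ^ (-τ) * RadialModel.invProd L r : ℝ) : ℂ))) ∧
      (∀ r ∈ (A.fibreModel P x hx).posBox, (polarJacobian P r : ℂ) *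
        A.partsDensity P κ b h (polarSplit P r x) = κ (polarSplit P 0 x) * ((2 : ℂ)⁻¹ ^ P.card *
          L.foldl (A.fibreModel P x hx).step f r)) := by
  obtain ⟨R', f, hf, hfe, hf0⟩ := exists_isTest D.smooth D.compact D.subset hx hh
  refine ⟨R', f, hf, hf0, fun τ r hr => ?_, fun r hr => ?_⟩
  · have hpos : ∀ i, 0 < r i := fun i => (hr i).1
    have h1 := hfe hr
    simp only at h1
    rw [singularDensity, D.kappa_eq, h1, RadialModel.invProd_eq_prod hLn hLu,
      prod_norm_polarSplit hpos (fun t => t ^ 2), polarJacobian, Finset.prod_inv_distrib,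
      Finset.prod_pow]
    have h2 : ((∏ i, r i : ℝ) : ℂ) ≠ 0 :=
      Complex.ofReal_ne_zero.2 (Finset.prod_pos fun i _ => hpos i).ne'
    change _ = _ * (f r * ((|A.psiD (polarSplit P r x)| ^ (-τ) * (∏ i, r i)⁻¹ : ℝ) : ℂ))
    rw [Complex.ofReal_div, Complex.ofReal_mul, Complex.ofReal_inv, Complex.ofReal_pow]
    field_simp
  · have hpos : ∀ i, 0 < r i := fun i => (hr i).1
    have h1 := foldl_radialStep_polarSplit hx L (fun y => b y * h y) hr
    simp only [hLs] at h1
    rw [partsDensity, D.kappa_eq, h1, RadialModel.foldl_step_congr hfe hr,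
      prod_norm_polarSplit hpos (fun t => 2 * t), polarJacobian, Finset.prod_mul_distrib,
      Finset.prod_const, Finset.card_univ, Fintype.card_coe]
    have h2 : ((∏ i, r i : ℝ) : ℂ) ≠ 0 :=
      Complex.ofReal_ne_zero.2 (Finset.prod_pos fun i _ => hpos i).ne'
    rw [Complex.ofReal_mul, Complex.ofReal_pow, inv_pow]
    push_cast at h2 ⊢
    field_simp

/-- The constant of the iterated integration by parts, in closed form. -/
lemma partsConst_eq (s : ℕ) {σ ε : ℝ} : RadialModel.partsConst (σ + ε) s =
    2⁻¹ ^ s * (∏ j ∈ Finset.Icc 1 s, (σ - j + ε))⁻¹ := by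
  have key : ∀ s : ℕ, ∀ τ : ℝ, RadialModel.partsConst τ s =
      2⁻¹ ^ s * (∏ j ∈ Finset.range s, (τ - 1 - j))⁻¹ := by
    intro s
    induction s with
    | zero => intro τ; simp [RadialModel.partsConst]
    | succ s ih =>
      intro τ
      rw [RadialModel.partsConst, ih, Finset.prod_range_succ']
      have : ∀ j : ℕ, τ - 1 - ((j + 1 : ℕ) : ℝ) = τ - 1 - 1 - j := fun j => by push_cast; ring
      simp_rw [this]
      rw [mul_inv, pow_succ]
      simp
      ring
  have hprod : ∀ s : ℕ, ∏ j ∈ Finset.range s, (σ + ε - 1 - j) =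
      ∏ j ∈ Finset.Icc 1 s, (σ - j + ε) := by
    intro s
    induction s with
    | zero => simp
    | succ s ih =>
      rw [Finset.prod_range_succ, ih, Finset.prod_Icc_succ_top (by omega)]
      push_cast
      ring
  rw [key, hprod]

/-- Integration by parts on `V`: the singular density is integrable, with integral given by the
density of the radial derivatives. -/
lemma PartsData.integral_singularDensity (D : PartsData A P κ b h) {τ : ℝ}
    (hτ : (P.card : ℝ) < τ) :
    IntegrableOn (A.singularDensity P κ b h τ) A.V ∧
      ∫ z in A.V, A.singularDensity P κ b h τ z =
        (-1) ^ P.card * (2 ^ P.card * (RadialModel.partsConst τ P.card : ℂ)) *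
          ∫ z in A.V, A.partsDensity P κ b h z *
            ((|A.psiD z| ^ (-(τ - P.card)) : ℝ) : ℂ) := by
  obtain ⟨L, hLs, hLn, hLu, hLc⟩ := exists_subtype_sort P
  have hτL : (L.length : ℝ) < τ := by rwa [hLc]
  have hX := D.aestronglyMeasurable_singularDensity τ
  have hY := D.integrableOn_partsDensity_mul (p := τ - P.card) (by linarith)
  have hY' := (A.integrable_polarSplit_iff (P := P) hY.1).1 hY
  have hX1 := A.aestronglyMeasurable_polarSplit (P := P) hX
  have hX2 : AEStronglyMeasurable (fun y : ({j // j ∈ P} → ℝ) × PolarBase l P =>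
      (polarJacobian P y.1 : ℂ) * A.singularDensity P κ b h τ (polarSplit P y.1 y.2))
      (A.polarMeasure P) := by
    refine AEStronglyMeasurable.mul ?_ hX1
    exact Continuous.aestronglyMeasurable (by unfold polarJacobian; fun_prop)
  have hae := ae_regularBase (P := P) D.regular
  have hI : IntegrableOn (A.singularDensity P κ b h τ) A.V := by
    rw [A.integrable_polarSplit_iff (P := P) hX]
    refine ⟨hX2, ?_⟩
    rw [hasFiniteIntegral_iff_enorm, polarMeasure, lintegral_prod_symm _ hX2.enorm]
    have hY2 := hY'.2
    rw [hasFiniteIntegral_iff_enorm, polarMeasure, lintegral_prod_symm _ hY'.1.enorm] at hY2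
    refine lt_of_le_of_lt ?_ (ENNReal.mul_lt_top
      (a := ENNReal.ofReal (RadialModel.partsConst τ P.card) * ‖(2 : ℂ) ^ P.card‖ₑ)
      (ENNReal.mul_lt_top ENNReal.ofReal_lt_top enorm_lt_top) hY2)
    rw [← lintegral_const_mul' _ _ (ENNReal.mul_ne_top ENNReal.ofReal_ne_top enorm_ne_top)]
    refine lintegral_mono_ae ?_
    filter_upwards [hae] with x hx
    obtain ⟨R', f, hf, -, hfs, hfp⟩ := D.exists_fibre hx.1 hx.2 hLs hLn hLu
    have h1 : ∫⁻ r, ‖(polarJacobian P r : ℂ) * A.singularDensity P κ b h τ (polarSplit P r x)‖ₑ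
        ∂(faceMeasure (A.radii P) Finset.univ) = ‖κ (polarSplit P 0 x)‖ₑ *
        ∫⁻ r, ‖f r * ((|(A.fibreModel P x hx.1).psi r| ^ (-τ) *
          RadialModel.invProd L r : ℝ) : ℂ)‖ₑ ∂(faceMeasure (A.radii P) Finset.univ) := by
      rw [← lintegral_const_mul' _ _ enorm_ne_top]
      refine lintegral_congr_ae ?_
      filter_upwards [(A.fibreModel P x hx.1).ae_mem_posBox] with r hr
      rw [hfs τ r hr, enorm_mul]
    have h2 : ‖(2 : ℂ) ^ P.card‖ₑ * ∫⁻ r, ‖(polarJacobian P r : ℂ) *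
          (A.partsDensity P κ b h (polarSplit P r x) *
            ((|A.psiD (polarSplit P r x)| ^ (-(τ - P.card)) : ℝ) : ℂ))‖ₑ
        ∂(faceMeasure (A.radii P) Finset.univ) = ‖κ (polarSplit P 0 x)‖ₑ *
        ∫⁻ r, ‖L.foldl (A.fibreModel P x hx.1).step f r *
          ((|(A.fibreModel P x hx.1).psi r| ^ (-(τ - L.length)) : ℝ) : ℂ)‖ₑ
          ∂(faceMeasure (A.radii P) Finset.univ) := by
      rw [← lintegral_const_mul' _ _ enorm_ne_top, ← lintegral_const_mul' _ _ enorm_ne_top]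
      refine lintegral_congr_ae ?_
      filter_upwards [(A.fibreModel P x hx.1).ae_mem_posBox] with r hr
      rw [← mul_assoc (polarJacobian P r : ℂ), hfp r hr, ← enorm_mul, ← enorm_mul, hLc]
      congr 1
      change _ = _ * (_ * ((|A.psiD (polarSplit P r x)| ^ (-(τ - P.card)) : ℝ) : ℂ))
      rw [inv_pow]
      field_simp
    rw [h1, mul_assoc, h2, mul_left_comm, ← hLc]
    gcongr
    exact hf.lintegral_foldl_le hLn hτL
  refine ⟨hI, ?_⟩
  have hI' := (A.integrable_polarSplit_iff (P := P) hX).1 hI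
  rw [A.integral_polarSplit (P := P) hX, A.integral_polarSplit (P := P) hY.1, polarMeasure,
    integral_prod_symm _ hI', integral_prod_symm _ hY', ← integral_const_mul]
  refine integral_congr_ae ?_
  filter_upwards [hae, hY'.prod_left_ae] with x hx hYx
  obtain ⟨R', f, hf, -, hfs, hfp⟩ := D.exists_fibre hx.1 hx.2 hLs hLn hLu
  have h1 : ∀ᵐ r ∂(faceMeasure (A.radii P) Finset.univ), (polarJacobian P r : ℂ) *
      A.singularDensity P κ b h τ (polarSplit P r x) = κ (polarSplit P 0 x) *
        (f r * ((|(A.fibreModel P x hx.1).psi r| ^ (-τ) * RadialModel.invProd L r : ℝ) : ℂ)) := by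
    filter_upwards [(A.fibreModel P x hx.1).ae_mem_posBox] with r hr using hfs τ r hr
  have h2 : ∀ᵐ r ∂(faceMeasure (A.radii P) Finset.univ), (polarJacobian P r : ℂ) *
      (A.partsDensity P κ b h (polarSplit P r x) *
        ((|A.psiD (polarSplit P r x)| ^ (-(τ - P.card)) : ℝ) : ℂ)) =
      (κ (polarSplit P 0 x) * (2 : ℂ)⁻¹ ^ P.card) * (L.foldl (A.fibreModel P x hx.1).step f r *
        ((|(A.fibreModel P x hx.1).psi r| ^ (-(τ - L.length)) : ℝ) : ℂ)) := by
    filter_upwards [(A.fibreModel P x hx.1).ae_mem_posBox] with r hr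
    rw [← mul_assoc (polarJacobian P r : ℂ), hfp r hr, hLc]
    change _ = _ * (_ * ((|A.psiD (polarSplit P r x)| ^ (-(τ - P.card)) : ℝ) : ℂ))
    ring
  rw [integral_congr_ae h1, integral_congr_ae h2, integral_const_mul, integral_const_mul]
  by_cases hκ : κ (polarSplit P 0 x) = 0
  · simp [hκ]
  have hc : κ (polarSplit P 0 x) * (2 : ℂ)⁻¹ ^ P.card ≠ 0 :=
    mul_ne_zero hκ (pow_ne_zero _ (by norm_num))
  have h3 : Integrable (fun r => L.foldl (A.fibreModel P x hx.1).step f r *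
      ((|(A.fibreModel P x hx.1).psi r| ^ (-(τ - L.length)) : ℝ) : ℂ))
      (faceMeasure (A.fibreModel P x hx.1).R Finset.univ) := by
    have := (hYx.congr h2).const_mul (κ (polarSplit P 0 x) * (2 : ℂ)⁻¹ ^ P.card)⁻¹
    refine this.congr (ae_of_all _ fun r => ?_)
    exact inv_mul_cancel_left₀ hc _
  have h4 := (hf.integral_foldl_eq hLn hτL h3).2
  change ∫ r, _ ∂(faceMeasure (A.radii P) Finset.univ) =
    _ * ∫ r, _ ∂(faceMeasure (A.radii P) Finset.univ) at h4
  rw [h4, hLc, inv_pow]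
  field_simp

/-- The total integral of the density of the radial derivatives is given by the boundary values
along the lc centre. -/
lemma PartsData.integral_partsDensity (D : PartsData A P κ b h) :
    Integrable (fun x => κ (polarSplit P 0 x) * (b (polarSplit P 0 x) * boundaryValue P h x))
        (A.baseMeasure P) ∧
      ∫ z in A.V, A.partsDensity P κ b h z = (-1) ^ P.card * (2 : ℂ)⁻¹ ^ P.card *
        ∫ x, κ (polarSplit P 0 x) * (b (polarSplit P 0 x) * boundaryValue P h x)
          ∂(A.baseMeasure P) := by
  obtain ⟨L, hLs, hLn, hLu, hLc⟩ := exists_subtype_sort P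
  have hY := D.integrableOn_partsDensity
  have hY' := (A.integrable_polarSplit_iff (P := P) hY.1).1 hY
  have h1 : ∀ᵐ x ∂(A.baseMeasure P), ∫ r, (polarJacobian P r : ℂ) *
      A.partsDensity P κ b h (polarSplit P r x) ∂(faceMeasure (A.radii P) Finset.univ) =
      (-1) ^ P.card * (2 : ℂ)⁻¹ ^ P.card *
        (κ (polarSplit P 0 x) * (b (polarSplit P 0 x) * boundaryValue P h x)) := by
    filter_upwards [ae_regularBase (P := P) D.regular] with x hx
    obtain ⟨R', f, hf, hf0, -, hfp⟩ := D.exists_fibre hx.1 hx.2 hLs hLn hLu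
    have h2 : ∀ᵐ r ∂(faceMeasure (A.radii P) Finset.univ), (polarJacobian P r : ℂ) *
        A.partsDensity P κ b h (polarSplit P r x) = (κ (polarSplit P 0 x) * (2 : ℂ)⁻¹ ^ P.card) *
          L.foldl (A.fibreModel P x hx.1).step f r := by
      filter_upwards [(A.fibreModel P x hx.1).ae_mem_posBox] with r hr
      rw [hfp r hr]
      ring
    have h3 := hf.integral_foldl_faceMeasure hLn
    rw [hLu, hLc, hf0] at h3
    change ∫ r, _ ∂(faceMeasure (A.radii P) Finset.univ) = _ at h3
    rw [integral_congr_ae h2, integral_const_mul, h3]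
    ring
  have hint := hY'.integral_prod_right
  have h0 : ((-1) ^ P.card * (2 : ℂ)⁻¹ ^ P.card) ≠ 0 :=
    mul_ne_zero (pow_ne_zero _ (by norm_num)) (pow_ne_zero _ (by norm_num))
  refine ⟨?_, ?_⟩
  · have h4 := (hint.congr h1).const_mul ((-1) ^ P.card * (2 : ℂ)⁻¹ ^ P.card)⁻¹
    refine h4.congr (ae_of_all _ fun x => ?_)
    exact inv_mul_cancel_left₀ h0 _
  · rw [A.integral_polarSplit (P := P) hY.1, polarMeasure, integral_prod_symm _ hY',
      ← integral_const_mul]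
    exact integral_congr_ae h1

end AdmissiblePolydisc

end PolydiscParts

/-! ### Positivity of the inner product on `(0,q)`-forms -/

section Positivity

/-- The Cauchy–Binet formula, as a sum over all maps `Fin q → Fin n`. -/
lemma factorial_mul_det_mul {q n : ℕ} (M : Matrix (Fin q) (Fin n) ℂ)
    (N : Matrix (Fin n) (Fin q) ℂ) :
    (q.factorial : ℂ) * (M * N).det =
      ∑ p : Fin q → Fin n, (M.submatrix id p).det * (N.submatrix p id).det := by
  have h1 : (M * N).det = ∑ p : Fin q → Fin n, (∏ i, M i (p i)) * (N.submatrix p id).det := by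
    have h2 : (M * N) = fun i => ∑ k, M i k • N k := by
      ext i j
      simp [Matrix.mul_apply]
    change Matrix.detRowAlternating (M * N) = _
    rw [h2]
    refine (MultilinearMap.map_sum Matrix.detRowAlternating.toMultilinearMap
      (fun i k => M i k • N k)).trans (Finset.sum_congr rfl fun p _ => ?_)
    exact MultilinearMap.map_smul_univ _ (fun i => M i (p i)) (fun i => N (p i))
  -- every permutation contributes the same amount to the right-hand side
  have h2 : ∀ σ : Equiv.Perm (Fin q), ∑ p : Fin q → Fin n,
      ((Equiv.Perm.sign σ : ℤ) : ℂ) * (∏ i, M (σ i) (p i)) * (N.submatrix p id).det =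
        (M * N).det := by
    intro σ
    rw [h1]
    refine Fintype.sum_equiv (Equiv.arrowCongr σ (Equiv.refl (Fin n))) _ _ fun p => ?_
    have h3 : (N.submatrix p id).det = ((Equiv.Perm.sign σ : ℤ) : ℂ) *
        (N.submatrix (p ∘ σ.symm) id).det := by
      have := Matrix.det_permute σ (N.submatrix (p ∘ σ.symm) id)
      rw [← this]
      congr 1
      ext i j
      simp
    have h4 : ∏ i, M (σ i) (p i) = ∏ i, M i ((p ∘ σ.symm) i) := by
      rw [← Equiv.prod_comp σ (fun i => M i ((p ∘ σ.symm) i))]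
      simp
    have h5 : ((Equiv.Perm.sign σ : ℤ) : ℂ) * ((Equiv.Perm.sign σ : ℤ) : ℂ) = 1 := by
      rw [← Int.cast_mul, ← Units.val_mul, Int.units_mul_self]
      simp
    rw [h4, h3]
    change _ = (∏ i, M i ((p ∘ σ.symm) i)) * (N.submatrix (p ∘ σ.symm) id).det
    linear_combination (∏ i, M i ((p ∘ σ.symm) i)) * (N.submatrix (p ∘ σ.symm) id).det * h5
  simp_rw [Matrix.det_apply' (M.submatrix id _), Finset.sum_mul]
  rw [Finset.sum_comm]
  simp only [Matrix.submatrix_apply, id]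
  rw [Finset.sum_congr rfl fun σ _ => h2 σ, Finset.sum_const, Finset.card_univ,
    Fintype.card_perm, Fintype.card_fin, nsmul_eq_mul]

open scoped MatrixOrder Matrix.Norms.L2Operator in
lemma Matrix.PosSemidef.exists_eq_conjTranspose_mul_self {n : ℕ}
    {M : Matrix (Fin n) (Fin n) ℂ} (hM : M.PosSemidef) :
    ∃ B : Matrix (Fin n) (Fin n) ℂ, M = B.conjTranspose * B :=
  CStarAlgebra.nonneg_iff_eq_star_mul_self.1 hM.nonneg

lemma AntiForm.inner_self_nonneg {n q : ℕ} {H : Matrix (Fin n) (Fin n) ℂ} (hH : H.PosDef)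
    (a : AntiForm n q) : 0 ≤ (AntiForm.inner H a a).re := by
  obtain ⟨B, hB⟩ : ∃ B : Matrix (Fin n) (Fin n) ℂ, H⁻¹ = B.conjTranspose * B :=
    hH.inv.posSemidef.exists_eq_conjTranspose_mul_self
  set d : (Fin q → Fin n) → (Fin q ↪o Fin n) → ℂ := fun p J => (B.submatrix p J).det with hd
  have h1 : ∀ J K : Fin q ↪o Fin n, (q.factorial : ℂ) * (H⁻¹.submatrix J K).det =
      ∑ p, conj (d p J) * d p K := by
    intro J K
    have h2 : H⁻¹.submatrix J K = B.conjTranspose.submatrix J id * B.submatrix id K := by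
      rw [hB, ← Matrix.submatrix_mul_equiv _ _ _ (Equiv.refl (Fin n))]
      rfl
    rw [h2, factorial_mul_det_mul]
    refine Finset.sum_congr rfl fun p _ => ?_
    congr 1
    rw [hd]
    simp only
    rw [starRingEnd_apply, ← Matrix.det_conjTranspose]
    rfl
  have h2 : (q.factorial : ℂ) * AntiForm.inner H a a =
      ((∑ p, Complex.normSq (∑ J, a J * conj (d p J)) : ℝ) : ℂ) := by
    rw [AntiForm.inner, Finset.mul_sum]
    simp_rw [Finset.mul_sum]
    have h3 : ∀ J K : Fin q ↪o Fin n, (q.factorial : ℂ) *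
        (a J * conj (a K) * (H⁻¹.submatrix J K).det) =
        ∑ p, (a J * conj (d p J)) * conj (a K * conj (d p K)) := fun J K => by
      rw [mul_left_comm, h1, Finset.mul_sum]
      refine Finset.sum_congr rfl fun p _ => ?_
      simp only [map_mul, Complex.conj_conj]
      ring
    simp_rw [h3]
    push_cast
    simp_rw [Complex.normSq_eq_conj_mul_self, map_sum, Finset.sum_mul_sum]
    rw [Finset.sum_comm]
    refine (Finset.sum_congr rfl fun J _ => Finset.sum_comm).trans ?_
    rw [Finset.sum_comm]
    refine Finset.sum_congr rfl fun p _ => Finset.sum_congr rfl fun J _ =>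
      Finset.sum_congr rfl fun K _ => ?_
    ring
  have h3 : (q.factorial : ℝ) * (AntiForm.inner H a a).re =
      ∑ p, Complex.normSq (∑ J, a J * conj (d p J)) := by
    have := congrArg Complex.re h2
    rwa [Complex.ofReal_re, ← Complex.ofReal_natCast, Complex.re_ofReal_mul] at this
  have h4 : (0 : ℝ) < q.factorial := by exact_mod_cast q.factorial_pos
  refine nonneg_of_mul_nonneg_right ?_ h4
  rw [h3]
  exact Finset.sum_nonneg fun _ _ => Complex.normSq_nonneg _

lemma AntiForm.inner_sum {n q : ℕ} {ι : Type*} (H : Matrix (Fin n) (Fin n) ℂ) (T : Finset ι)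
    (c : ι → ℂ) (g : ι → AntiForm n q) (a : AntiForm n q) (ha : ∀ J, a J = ∑ P ∈ T, c P * g P J) :
    AntiForm.inner H a a = ∑ P ∈ T, ∑ P' ∈ T, c P * conj (c P') * AntiForm.inner H (g P) (g P') := by
  simp only [AntiForm.inner, ha, map_sum, Finset.mul_sum, Finset.sum_mul, map_mul]
  rw [Finset.sum_comm (s := T) (t := T)]
  rw [Finset.sum_congr rfl fun J _ => Finset.sum_comm, Finset.sum_comm]
  refine Finset.sum_congr rfl fun P _ => ?_
  rw [Finset.sum_congr rfl fun J _ => Finset.sum_comm, Finset.sum_comm]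
  refine Finset.sum_congr rfl fun P' _ => Finset.sum_congr rfl fun J _ =>
    Finset.sum_congr rfl fun K _ => ?_
  ring

end Positivity

/-! ### Cut-off decompositions -/

section Assembly

variable {m l q s : ℕ}

namespace AdmissiblePolydisc

variable {A : AdmissiblePolydisc m l} {P P' : Finset (Fin m)} {ρ : Coords m l → ℝ}
  {f : Coords m l → AntiForm (m + l) q} {g : Finset (Fin m) → Coords m l → AntiForm (m + l) q}
  {z : Coords m l}

/-- Smooth functions with compact support in `V`. -/
structure IsCutoff (A : AdmissiblePolydisc m l) (ρ : Coords m l → ℝ) : Prop where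
  smooth : ContDiff ℝ ∞ ρ
  compact : HasCompactSupport ρ
  subset : tsupport ρ ⊆ A.V

/-- The singular factor of the pairing of `g_P` with `g_{P'}`; it involves only coordinates
`u_j`, `j ∉ P`. -/
def pairFactor (P P' : Finset (Fin m)) (z : Coords m l) : ℂ := (∏ j ∈ P' \ P, conj (z.1 j))⁻¹

/-- The smooth factor of the pairing of `g_P` with `g_{P'}`. -/
def pairCutoff (ρ : Coords m l → ℝ) (P P' : Finset (Fin m)) (z : Coords m l) : ℂ :=
  (ρ z : ℂ) * ∏ j ∈ P \ P', conj (z.1 j)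

lemma IsRegularDecomposition.isRadiallyRegular (hg : A.IsRegularDecomposition s f g)
    (hP : P ∈ Finset.powersetCard s (Finset.univ : Finset (Fin m)))
    (hP' : P' ∈ Finset.powersetCard s (Finset.univ : Finset (Fin m))) :
    A.IsRadiallyRegular (A.innerF (g P) (g P')) :=
  ⟨hg.smooth_U P hP P' hP', hg.locInt P hP P' hP'⟩

lemma pairFactor_add_single {j : Fin m} (hj : j ∈ P) (P' : Finset (Fin m)) (z : Coords m l)
    (d : ℂ) : pairFactor P P' (z + (Pi.single j d, 0)) = pairFactor P P' z := by
  rw [pairFactor, pairFactor]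
  congr 1
  refine Finset.prod_congr rfl fun i hi => ?_
  have : i ≠ j := fun h => (Finset.mem_sdiff.1 hi).2 (h ▸ hj)
  simp [this]

lemma IsCutoff.partsData (hρ : A.IsCutoff ρ) {h : Coords m l → ℂ} (hh : A.IsRadiallyRegular h)
    (P P' : Finset (Fin m)) : PartsData A P (pairFactor P P') (pairCutoff ρ P P') h where
  regular := hh
  smooth := by
    refine (Complex.ofRealCLM.contDiff.comp hρ.smooth).mul (contDiff_prod fun j _ => ?_)
    exact Complex.conjCLE.contDiff.comp ((contDiff_apply ℝ ℂ j).comp contDiff_fst)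
  compact := (hρ.compact.comp_left Complex.ofReal_zero).mul_right
  subset := by
    refine (closure_mono fun z hz => ?_).trans hρ.subset
    have h1 := left_ne_zero_of_mul hz
    exact fun h2 => h1 (by rw [h2]; rfl)
  continuousOn := by
    refine ContinuousOn.inv₀ (Continuous.continuousOn ?_) fun z hz => ?_
    · exact continuous_finsetProd _ fun j _ => Complex.continuous_conj.comp (by fun_prop)
    · exact Finset.prod_ne_zero_iff.2 fun j _ => (map_ne_zero _).2 (hz.2 j)
  bound := fun z hz => by
    have h1 : P' \ P ⊆ Pᶜ := fun j hj => Finset.mem_compl.2 (Finset.mem_sdiff.1 hj).2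
    have h2 : ∏ j ∈ P' \ P, ‖z.1 j‖ ≠ 0 :=
      Finset.prod_ne_zero_iff.2 fun j _ => norm_ne_zero_iff.2 (hz.2 j)
    rw [pairFactor, norm_inv, norm_prod, ← Finset.prod_sdiff h1]
    simp only [RCLike.norm_conj]
    rw [mul_comm, mul_assoc, mul_inv_cancel₀ h2, mul_one]
    exact Finset.prod_le_one (fun j _ => norm_nonneg _)
      fun j _ => ((hz.1.1 j).trans (A.R_lt_one j)).le
  fibre := fun r r' x => by
    rw [pairFactor, pairFactor]
    congr 1
    refine Finset.prod_congr rfl fun i hi => ?_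
    have hi' := (Finset.mem_sdiff.1 hi).2
    rw [polarSplit_fst_notMem r x ⟨i, hi'⟩, polarSplit_fst_notMem r' x ⟨i, hi'⟩]

lemma prod_conj_ne_zero (hz : z ∈ A.offD) (S : Finset (Fin m)) : ∏ j ∈ S, conj (z.1 j) ≠ 0 :=
  Finset.prod_ne_zero_iff.2 fun j _ => (map_ne_zero _).2 (hz.2 j)

lemma pairFactor_mul_prod (hz : z ∈ A.offD) (P P' : Finset (Fin m)) :
    pairFactor P P' z * ∏ j ∈ P \ P', conj (z.1 j) =
      (∏ j ∈ P, conj (z.1 j)) / ∏ j ∈ P', conj (z.1 j) := by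
  rw [pairFactor, ← Finset.prod_inter_mul_prod_sdiff P P', ← Finset.prod_inter_mul_prod_sdiff P' P,
    Finset.inter_comm P' P]
  have h1 := prod_conj_ne_zero hz (P ∩ P')
  have h2 := prod_conj_ne_zero hz (P' \ P)
  field_simp

/-- The powers of `u_j`, `ū_j` and `r_j` in the pairing of `dz_P ∧ g_P` with `dz_{P'} ∧ g_{P'}`. -/
lemma prod_compl_mul_conj (hz : z ∈ A.offD) (P P' : Finset (Fin m)) :
    (∏ j ∈ Pᶜ, z.1 j) * conj (∏ j ∈ P'ᶜ, z.1 j) * (((∏ j, ‖z.1 j‖ ^ 2)⁻¹ : ℝ) : ℂ) =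
      pairFactor P P' z * (∏ j ∈ P \ P', conj (z.1 j)) *
        (((∏ j ∈ P, ‖z.1 j‖ ^ 2)⁻¹ : ℝ) : ℂ) := by
  have h1 : ∀ S : Finset (Fin m), ((∏ j ∈ S, ‖z.1 j‖ ^ 2 : ℝ) : ℂ) =
      (∏ j ∈ S, z.1 j) * ∏ j ∈ S, conj (z.1 j) := fun S => by
    rw [← Finset.prod_mul_distrib, Complex.ofReal_prod]
    exact Finset.prod_congr rfl fun j _ => by rw [Complex.mul_conj, Complex.normSq_eq_norm_sq]
  have h2 := Finset.prod_mul_prod_compl P fun j => conj (z.1 j)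
  have h3 := Finset.prod_mul_prod_compl P' fun j => conj (z.1 j)
  have h4 : ∀ S : Finset (Fin m), ∏ j ∈ S, z.1 j ≠ 0 := fun S =>
    Finset.prod_ne_zero_iff.2 fun j _ => hz.2 j
  rw [pairFactor_mul_prod hz, Complex.ofReal_inv, Complex.ofReal_inv, h1, h1, map_prod,
    ← Finset.prod_mul_prod_compl P fun j => z.1 j]
  have a1 := h4 P
  have a2 := h4 Pᶜ
  have a3 := prod_conj_ne_zero hz P
  have a4 := prod_conj_ne_zero hz P'
  have a5 := prod_conj_ne_zero hz Finset.univ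
  rw [div_mul_eq_mul_div, mul_inv, mul_inv, mul_inv, eq_div_iff a4]
  field_simp
  rw [← h3]
  ring

/-- The complex density of which `residueG` is the real part. -/
def densitySum (A : AdmissiblePolydisc m l) (ρ : Coords m l → ℝ) (s : ℕ)
    (g : Finset (Fin m) → Coords m l → AntiForm (m + l) q) (z : Coords m l) : ℂ :=
  ∑ P ∈ Finset.powersetCard s (Finset.univ : Finset (Fin m)),
    ∑ P' ∈ Finset.powersetCard s (Finset.univ : Finset (Fin m)),
      A.partsDensity P (pairFactor P P') (pairCutoff ρ P P') (A.innerF (g P) (g P')) z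

/-- The complex density of which `residueIntegrand` is the real part. -/
def singularSum (A : AdmissiblePolydisc m l) (ρ : Coords m l → ℝ) (s : ℕ)
    (g : Finset (Fin m) → Coords m l → AntiForm (m + l) q) (τ : ℝ) (z : Coords m l) : ℂ :=
  ∑ P ∈ Finset.powersetCard s (Finset.univ : Finset (Fin m)),
    ∑ P' ∈ Finset.powersetCard s (Finset.univ : Finset (Fin m)),
      A.singularDensity P (pairFactor P P') (pairCutoff ρ P P') (A.innerF (g P) (g P')) τ z

lemma residueG_eq_re (hz : z ∈ A.offD) : A.residueG ρ s g z = (A.densitySum ρ s g z).re := by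
  rw [residueG, densitySum]
  congr 1
  refine Finset.sum_congr rfl fun P _ => Finset.sum_congr rfl fun P' _ => ?_
  rw [partsDensity]
  congr 1
  have h1 : Set.EqOn (fun y => (ρ y : ℂ) * A.innerF (g P) (g P') y *
      ((∏ j ∈ P, conj (y.1 j)) / ∏ j ∈ P', conj (y.1 j)))
      (fun y => pairFactor P P' y * (pairCutoff ρ P P' y * A.innerF (g P) (g P') y)) A.offD := by
    intro y hy
    simp only
    rw [← pairFactor_mul_prod hy, pairCutoff]
    ring
  rw [foldl_radialStep_congr h1 hz, foldl_radialStep_const_mul fun j hj =>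
    pairFactor_add_single ((Finset.mem_sort _).1 hj) P']

lemma exp_neg_phi (hz : z ∈ A.offD) :
    Real.exp (-A.phi z) = Real.exp (-A.phiF z) * (∏ j, ‖z.1 j‖ ^ 2)⁻¹ := by
  have h1 : ∏ j, ‖z.1 j‖ ^ 2 = Real.exp (phiD z) := by
    rw [phiD, Real.exp_sum]
    exact Finset.prod_congr rfl fun j _ =>
      (Real.exp_log (pow_pos (norm_pos_iff.2 (hz.2 j)) 2)).symm
  rw [phi, neg_add, Real.exp_add, h1, Real.exp_neg (phiD z)]

lemma IsRegularDecomposition.residueIntegrand_eq_re (hg : A.IsRegularDecomposition s f g)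
    (τ : ℝ) : ∀ᵐ z ∂(volume.restrict A.V),
      A.residueIntegrand ρ f τ z = (A.singularSum ρ s g τ z).re := by
  filter_upwards [A.ae_mem_offD, hg.eq_sum] with z hz hf
  have h1 : A.residueIntegrand ρ f τ z = (AntiForm.inner (A.H z) (f z) (f z) *
      ((ρ z * Real.exp (-A.phi z) * |A.psiD z| ^ (-τ) : ℝ) : ℂ)).re := by
    rw [Complex.re_mul_ofReal, residueIntegrand, normSqPhi, Real.rpow_neg (abs_nonneg _)]
    ring
  rw [h1, AntiForm.inner_sum (A.H z) _ _ _ _ hf, singularSum]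
  congr 1
  rw [Finset.sum_mul]
  refine Finset.sum_congr rfl fun P _ => ?_
  rw [Finset.sum_mul]
  refine Finset.sum_congr rfl fun P' _ => ?_
  have h2 := prod_compl_mul_conj hz P P'
  rw [exp_neg_phi hz, singularDensity, pairCutoff, innerF, div_eq_mul_inv]
  push_cast at h2 ⊢
  linear_combination (AntiForm.inner (A.H z) (g P z) (g P' z) * ρ z *
    Complex.exp (-(A.phiF z : ℂ)) * ((|A.psiD z| ^ (-τ) : ℝ) : ℂ)) * h2

end AdmissiblePolydisc

end Assembly

/-! ### The identity after integrating by parts, and the residues -/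

section Identity

variable {m l q s : ℕ}

namespace AdmissiblePolydisc

variable {A : AdmissiblePolydisc m l} {P P' : Finset (Fin m)} {ρ : Coords m l → ℝ}
  {f : Coords m l → AntiForm (m + l) q} {g : Finset (Fin m) → Coords m l → AntiForm (m + l) q}
  {z : Coords m l}

lemma IsRegularDecomposition.partsData (hg : A.IsRegularDecomposition s f g) (hρ : A.IsCutoff ρ)
    (hP : P ∈ Finset.powersetCard s (Finset.univ : Finset (Fin m)))
    (hP' : P' ∈ Finset.powersetCard s (Finset.univ : Finset (Fin m))) :
    PartsData A P (pairFactor P P') (pairCutoff ρ P P') (A.innerF (g P) (g P')) :=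
  hρ.partsData (hg.isRadiallyRegular hP hP') P P'

lemma IsRegularDecomposition.integrableOn_densitySum (hg : A.IsRegularDecomposition s f g)
    (hρ : A.IsCutoff ρ) : IntegrableOn (A.densitySum ρ s g) A.V :=
  integrable_finsetSum _ fun _ hP => integrable_finsetSum _ fun _ hP' =>
    (hg.partsData hρ hP hP').integrableOn_partsDensity

lemma IsRegularDecomposition.integrableOn_densitySum_mul (hg : A.IsRegularDecomposition s f g)
    (hρ : A.IsCutoff ρ) {p : ℝ} (hp : 0 ≤ p) :
    IntegrableOn (fun z => A.densitySum ρ s g z * ((|A.psiD z| ^ (-p) : ℝ) : ℂ)) A.V := by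
  simp_rw [densitySum, Finset.sum_mul]
  exact integrable_finsetSum _ fun _ hP => integrable_finsetSum _ fun _ hP' =>
    (hg.partsData hρ hP hP').integrableOn_partsDensity_mul hp

lemma residueG_ae : ∀ᵐ z ∂(volume.restrict A.V),
    A.residueG ρ s g z = (A.densitySum ρ s g z).re := by
  filter_upwards [A.ae_mem_offD] with z hz using residueG_eq_re hz

lemma residueG_div_ae (p : ℝ) : ∀ᵐ z ∂(volume.restrict A.V),
    A.residueG ρ s g z / |A.psiD z| ^ p =
      (A.densitySum ρ s g z * ((|A.psiD z| ^ (-p) : ℝ) : ℂ)).re := by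
  filter_upwards [residueG_ae] with z hz
  rw [hz, Complex.re_mul_ofReal, Real.rpow_neg (abs_nonneg _), div_eq_mul_inv]

lemma IsRegularDecomposition.integrableOn_residueG (hg : A.IsRegularDecomposition s f g)
    (hρ : A.IsCutoff ρ) : IntegrableOn (A.residueG ρ s g) A.V :=
  (Complex.reCLM.integrable_comp (hg.integrableOn_densitySum hρ)).congr
    (residueG_ae.mono fun _ h => h.symm)

lemma IsRegularDecomposition.integrableOn_residueG_div (hg : A.IsRegularDecomposition s f g)
    (hρ : A.IsCutoff ρ) {p : ℝ} (hp : 0 ≤ p) :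
    IntegrableOn (fun z => A.residueG ρ s g z / |A.psiD z| ^ p) A.V :=
  (Complex.reCLM.integrable_comp (hg.integrableOn_densitySum_mul hρ hp)).congr
    ((residueG_div_ae p).mono fun _ h => h.symm)

lemma IsRegularDecomposition.integral_singularSum (hg : A.IsRegularDecomposition s f g)
    (hρ : A.IsCutoff ρ) {σ ε : ℝ} (hσ : (s : ℝ) < σ + ε) :
    IntegrableOn (A.singularSum ρ s g (σ + ε)) A.V ∧
      ∫ z in A.V, A.singularSum ρ s g (σ + ε) z =
        (((-1) ^ s / ∏ j ∈ Finset.Icc 1 s, (σ - j + ε) : ℝ) : ℂ) *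
          ∫ z in A.V, A.densitySum ρ s g z * ((|A.psiD z| ^ (-(σ - s + ε)) : ℝ) : ℂ) := by
  have h1 : ∀ P ∈ Finset.powersetCard s (Finset.univ : Finset (Fin m)),
      ∀ P' ∈ Finset.powersetCard s (Finset.univ : Finset (Fin m)), _ := fun P hP P' hP' =>
    (hg.partsData hρ hP hP').integral_singularDensity (τ := σ + ε)
      (by rw [(Finset.mem_powersetCard.1 hP).2]; exact hσ)
  refine ⟨integrable_finsetSum _ fun P hP => integrable_finsetSum _ fun P' hP' =>
    (h1 P hP P' hP').1, ?_⟩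
  simp_rw [singularSum, densitySum, Finset.sum_mul]
  have hp : 0 ≤ σ - s + ε := by linarith
  have h2 := fun P hP P' hP' =>
    (hg.partsData (P := P) (P' := P') hρ hP hP').integrableOn_partsDensity_mul hp
  rw [integral_finsetSum _ fun P hP => integrable_finsetSum _ fun P' hP' => (h1 P hP P' hP').1,
    integral_finsetSum _ fun P hP => integrable_finsetSum _ fun P' hP' => h2 P hP P' hP',
    Finset.mul_sum]
  refine Finset.sum_congr rfl fun P hP => ?_
  rw [integral_finsetSum _ fun P' hP' => (h1 P hP P' hP').1,
    integral_finsetSum _ fun P' hP' => h2 P hP P' hP', Finset.mul_sum]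
  refine Finset.sum_congr rfl fun P' hP' => ?_
  rw [(h1 P hP P' hP').2, (Finset.mem_powersetCard.1 hP).2, partsConst_eq,
    show σ + ε - s = σ - s + ε by ring]
  congr 1
  push_cast
  rw [← mul_assoc ((2 : ℂ) ^ s), inv_pow, mul_inv_cancel₀ (pow_ne_zero _ two_ne_zero), one_mul,
    div_eq_mul_inv]

lemma IsRegularDecomposition.integral_residueIntegrand (hg : A.IsRegularDecomposition s f g)
    (hρ : A.IsCutoff ρ) {σ ε : ℝ} (hσ : (s : ℝ) < σ + ε) :
    IntegrableOn (A.residueIntegrand ρ f (σ + ε)) A.V ∧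
      ∫ z in A.V, A.residueIntegrand ρ f (σ + ε) z =
        (-1) ^ s / (∏ j ∈ Finset.Icc 1 s, (σ - j + ε)) *
          ∫ z in A.V, A.residueG ρ s g z / |A.psiD z| ^ (σ - s + ε) := by
  obtain ⟨h1, h2⟩ := hg.integral_singularSum hρ hσ
  have h3 := hg.residueIntegrand_eq_re (ρ := ρ) (σ + ε)
  refine ⟨(Complex.reCLM.integrable_comp h1).congr (h3.mono fun _ h => h.symm), ?_⟩
  have h4 : ∫ z in A.V, (A.singularSum ρ s g (σ + ε) z).re =
      (∫ z in A.V, A.singularSum ρ s g (σ + ε) z).re := Complex.reCLM.integral_comp_comm h1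
  have h5 : ∫ z in A.V, (A.densitySum ρ s g z * ((|A.psiD z| ^ (-(σ - s + ε)) : ℝ) : ℂ)).re =
      (∫ z in A.V, A.densitySum ρ s g z * ((|A.psiD z| ^ (-(σ - s + ε)) : ℝ) : ℂ)).re :=
    Complex.reCLM.integral_comp_comm (hg.integrableOn_densitySum_mul hρ (by linarith))
  rw [integral_congr_ae h3, h4, h2, Complex.re_ofReal_mul, ← h5,
    integral_congr_ae (residueG_div_ae (σ - s + ε))]

lemma polarSplit_zero (x : PolarBase l P) :
    polarSplit P 0 x = (polarPoint P 0 0 x.2.1, x.2.2) := by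
  refine Prod.ext ?_ rfl
  ext j
  by_cases hj : j ∈ P <;> simp [polarSplit, polarPoint, hj]

lemma lcRestrict_eq (P : Finset (Fin m)) (h : Coords m l → ℂ)
    (y : ({j // j ∉ P} → ℂ) × (Fin l → ℂ)) :
    lcRestrict P h y = ((2 * Real.pi : ℝ) : ℂ)⁻¹ ^ P.card *
      ∫ θ in Set.pi Set.univ (fun _ : {j // j ∈ P} => Set.Ioc (0 : ℝ) (2 * Real.pi)),
        boundaryValue P h (θ, y) := rfl

/-- On the diagonal the boundary term is the residue norm on the lc centre. -/
lemma IsRegularDecomposition.integral_lcIntegrand (hg : A.IsRegularDecomposition s f g)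
    (hρ : A.IsCutoff ρ) (hP : P ∈ Finset.powersetCard s (Finset.univ : Finset (Fin m))) :
    IntegrableOn (A.lcIntegrand ρ P (g P)) (A.lcCentre P) ∧
      (∫ z in A.V, A.partsDensity P (pairFactor P P) (pairCutoff ρ P P)
        (A.innerF (g P) (g P)) z).re =
        (-1) ^ s * Real.pi ^ s * ∫ y in A.lcCentre P, A.lcIntegrand ρ P (g P) y := by
  obtain ⟨h1, h2⟩ := (hg.partsData hρ hP hP).integral_partsDensity
  have hc := (Finset.mem_powersetCard.1 hP).2
  have h3 : (fun x : PolarBase l P => pairFactor P P (polarSplit P 0 x) *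
      (pairCutoff ρ P P (polarSplit P 0 x) * boundaryValue P (A.innerF (g P) (g P)) x)) =
      fun x => (ρ (polarPoint P 0 0 x.2.1, x.2.2) : ℂ) *
        boundaryValue P (A.innerF (g P) (g P)) x := by
    ext x
    simp [pairFactor, pairCutoff, polarSplit_zero]
  rw [h3] at h1 h2
  have hpi : ((2 * Real.pi : ℝ) : ℂ) ≠ 0 := Complex.ofReal_ne_zero.2 (by positivity)
  have h4 : ∀ y : ({j // j ∉ P} → ℂ) × (Fin l → ℂ),
      ∫ θ in Set.pi Set.univ (fun _ : {j // j ∈ P} => Set.Ioc (0 : ℝ) (2 * Real.pi)),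
        (ρ (polarPoint P 0 0 y.1, y.2) : ℂ) * boundaryValue P (A.innerF (g P) (g P)) (θ, y) =
      ((2 * Real.pi : ℝ) : ℂ) ^ s *
        ((ρ (polarPoint P 0 0 y.1, y.2) : ℂ) * lcRestrict P (A.innerF (g P) (g P)) y) := by
    intro y
    rw [integral_const_mul, lcRestrict_eq, hc, inv_pow]
    have := pow_ne_zero s hpi
    field_simp
  have h5 : ∀ y, A.lcIntegrand ρ P (g P) y =
      ((ρ (polarPoint P 0 0 y.1, y.2) : ℂ) * lcRestrict P (A.innerF (g P) (g P)) y).re :=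
    fun y => by rw [Complex.re_ofReal_mul]; rfl
  have h6 : IntegrableOn (fun y => (ρ (polarPoint P 0 0 y.1, y.2) : ℂ) *
      lcRestrict P (A.innerF (g P) (g P)) y) (A.lcCentre P) := by
    have h7 := (Integrable.integral_prod_right h1).const_mul (((2 * Real.pi : ℝ) : ℂ) ^ s)⁻¹
    refine h7.congr (ae_of_all _ fun y => ?_)
    simp only [h4]
    rw [inv_mul_cancel_left₀ (pow_ne_zero s hpi)]
  refine ⟨(Complex.reCLM.integrable_comp h6).congr (ae_of_all _ fun y => (h5 y).symm), ?_⟩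
  have h8 : ∫ y in A.lcCentre P, ((ρ (polarPoint P 0 0 y.1, y.2) : ℂ) *
      lcRestrict P (A.innerF (g P) (g P)) y).re =
      (∫ y in A.lcCentre P, (ρ (polarPoint P 0 0 y.1, y.2) : ℂ) *
        lcRestrict P (A.innerF (g P) (g P)) y).re := Complex.reCLM.integral_comp_comm h6
  simp_rw [h5]
  rw [h2, hc, h8, baseMeasure, integral_prod_symm _ h1]
  simp only [h4]
  rw [integral_const_mul, ← mul_assoc]
  have h9 : (-1 : ℂ) ^ s * 2⁻¹ ^ s * ((2 * Real.pi : ℝ) : ℂ) ^ s =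
      (((-1) ^ s * Real.pi ^ s : ℝ) : ℂ) := by
    push_cast
    rw [mul_pow, inv_pow]
    field_simp
  rw [h9, Complex.re_ofReal_mul]

/-- Off the diagonal a factor `ū_j`, `j ∈ P ∖ P'`, kills the boundary term. -/
lemma IsRegularDecomposition.integral_partsDensity_eq_zero (hg : A.IsRegularDecomposition s f g)
    (hρ : A.IsCutoff ρ) (hP : P ∈ Finset.powersetCard s (Finset.univ : Finset (Fin m)))
    (hP' : P' ∈ Finset.powersetCard s (Finset.univ : Finset (Fin m))) (hne : P ≠ P') :
    ∫ z in A.V, A.partsDensity P (pairFactor P P') (pairCutoff ρ P P')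
      (A.innerF (g P) (g P')) z = 0 := by
  rw [(hg.partsData hρ hP hP').integral_partsDensity.2]
  obtain ⟨j, hj⟩ : (P \ P').Nonempty := by
    rw [Finset.nonempty_iff_ne_empty, Ne, Finset.sdiff_eq_empty_iff_subset]
    exact fun h => hne (Finset.eq_of_subset_of_card_le h (by
      rw [(Finset.mem_powersetCard.1 hP).2, (Finset.mem_powersetCard.1 hP').2]))
  have h1 : ∀ x : PolarBase l P, pairCutoff ρ P P' (polarSplit P 0 x) = 0 := fun x => by
    rw [pairCutoff, Finset.prod_eq_zero hj, mul_zero]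
    rw [polarSplit_fst_mem 0 x ⟨j, (Finset.mem_sdiff.1 hj).1⟩]
    simp
  simp [h1]

lemma IsRegularDecomposition.integral_residueG (hg : A.IsRegularDecomposition s f g)
    (hρ : A.IsCutoff ρ) : ∫ z in A.V, A.residueG ρ s g z =
      (-1) ^ s * (Real.pi ^ s * ∑ P ∈ Finset.powersetCard s (Finset.univ : Finset (Fin m)),
        ∫ y in A.lcCentre P, A.lcIntegrand ρ P (g P) y) := by
  have h1 : ∫ z in A.V, (A.densitySum ρ s g z).re = (∫ z in A.V, A.densitySum ρ s g z).re :=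
    Complex.reCLM.integral_comp_comm (hg.integrableOn_densitySum hρ)
  have h2 := fun P hP P' hP' =>
    (hg.partsData (P := P) (P' := P') hρ hP hP').integrableOn_partsDensity
  rw [integral_congr_ae residueG_ae, h1]
  simp_rw [densitySum]
  rw [integral_finsetSum _ fun P hP => integrable_finsetSum _ fun P' hP' => h2 P hP P' hP',
    Complex.re_sum, ← mul_assoc, Finset.mul_sum]
  refine Finset.sum_congr rfl fun P hP => ?_
  rw [integral_finsetSum _ fun P' hP' => h2 P hP P' hP', Finset.sum_eq_single_of_mem P hP
    fun P' hP' hne => hg.integral_partsDensity_eq_zero hρ hP hP' hne.symm]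
  exact (hg.integral_lcIntegrand hρ hP).2

/-- Boundary values of `|g_P|²` are nonnegative, since the pointwise inner product is. -/
lemma IsRegularDecomposition.lcNormSq_nonneg (hg : A.IsRegularDecomposition s f g)
    (hP : P ∈ Finset.powersetCard s (Finset.univ : Finset (Fin m))) :
    ∀ᵐ y ∂(volume.restrict (A.lcCentre P)), 0 ≤ A.lcNormSq P (g P) y := by
  filter_upwards [ae_lcCentre (hg.isRadiallyRegular hP hP)] with y hy
  have h1 : ∀ θ : {j // j ∈ P} → ℝ, 0 ≤ (boundaryValue P (A.innerF (g P) (g P)) (θ, y)).re := by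
    intro θ
    have hx : ((θ, y) : PolarBase l P) ∈ A.regularBase P := hy.1
    obtain ⟨b, hb, hbe⟩ := exists_smooth_extension hx hy.2
    rw [boundaryValue_eq hx hb hbe]
    have h2 := (Complex.continuous_re.tendsto _).comp (tendsto_boundaryValue hx hb hbe)
    have h3 : ∀ᶠ t in 𝓝[>] (0 : ℝ), ∀ i : {j // j ∈ P}, t < A.radii P i :=
      eventually_all.2 fun i => nhdsWithin_le_nhds (eventually_lt_nhds (A.R_pos i))
    refine ge_of_tendsto h2 ?_
    filter_upwards [h3, self_mem_nhdsWithin] with t ht ht0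
    have h4 : polarSplit P (fun _ => t) ((θ, y) : PolarBase l P) ∈ A.V :=
      polarSplit_mem_V hx fun i => by rw [abs_of_pos ht0]; exact ht i
    simp only [Function.comp_apply]
    change 0 ≤ (A.innerF (g P) (g P) (polarSplit P (fun _ => t) ((θ, y) : PolarBase l P))).re
    rw [innerF, Complex.re_mul_ofReal]
    exact mul_nonneg (AntiForm.inner_self_nonneg (A.H_posDef _ h4.1 h4.2) _) (Real.exp_pos _).le
  rw [lcNormSq, lcRestrict_eq, ← Complex.ofReal_inv, ← Complex.ofReal_pow, Complex.re_ofReal_mul]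
  refine mul_nonneg (by positivity) ?_
  -- without integrability in the angles the average is `0` by convention
  by_cases hi : IntegrableOn (fun θ => boundaryValue P (A.innerF (g P) (g P)) (θ, y))
      (Set.pi Set.univ (fun _ : {j // j ∈ P} => Set.Ioc (0 : ℝ) (2 * Real.pi)))
  · have h5 := Complex.reCLM.integral_comp_comm hi
    rw [Complex.reCLM_apply] at h5
    rw [← h5]
    exact integral_nonneg h1
  · rw [integral_undef hi, Complex.zero_re]

end AdmissiblePolydisc

end Identity

/-! ### Limits of the residue functions -/

section Limits

variable {m l q s : ℕ}

namespace AdmissiblePolydisc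

variable {A : AdmissiblePolydisc m l} {P P' : Finset (Fin m)} {ρ : Coords m l → ℝ}
  {f : Coords m l → AntiForm (m + l) q} {g : Finset (Fin m) → Coords m l → AntiForm (m + l) q}
  {z : Coords m l}

lemma normSqPhi_nonneg (hz : z ∈ A.V) : 0 ≤ A.normSqPhi f z :=
  mul_nonneg (AntiForm.inner_self_nonneg (A.H_posDef _ hz.1 hz.2) _) (Real.exp_pos _).le

lemma abs_residueIntegrand_le (hz : z ∈ A.offD) {τ τ' : ℝ} (h : τ ≤ τ') :
    |A.residueIntegrand ρ f τ' z| ≤ |A.residueIntegrand ρ f τ z| := by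
  have h1 := one_le_abs_psiD hz
  have h2 : ∀ p : ℝ, 0 < |A.psiD z| ^ p := fun p => Real.rpow_pos_of_pos (by linarith) p
  rw [residueIntegrand, residueIntegrand, abs_div, abs_div, abs_of_pos (h2 τ), abs_of_pos (h2 τ')]
  exact div_le_div_of_nonneg_left (abs_nonneg _) (h2 τ) (Real.rpow_le_rpow_of_exponent_le h1 h)

lemma residueIntegrand_nonneg (hz : z ∈ A.V) (hρ : 0 ≤ ρ z) (τ : ℝ) :
    0 ≤ A.residueIntegrand ρ f τ z :=
  div_nonneg (mul_nonneg hρ (normSqPhi_nonneg hz)) (Real.rpow_nonneg (abs_nonneg _) _)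

lemma IsRegularDecomposition.tendsto_integral_residueG_div (hg : A.IsRegularDecomposition s f g)
    (hρ : A.IsCutoff ρ) :
    Tendsto (fun ε : ℝ => ∫ z in A.V, A.residueG ρ s g z / |A.psiD z| ^ ε) (𝓝[>] 0)
      (𝓝 (∫ z in A.V, A.residueG ρ s g z)) := by
  refine tendsto_integral_filter_of_dominated_convergence (fun z => ‖A.residueG ρ s g z‖) ?_ ?_
    (hg.integrableOn_residueG hρ).norm ?_
  · filter_upwards [self_mem_nhdsWithin] with ε hε
    exact (hg.integrableOn_residueG_div hρ (le_of_lt hε)).1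
  · filter_upwards [self_mem_nhdsWithin] with ε hε
    filter_upwards [A.ae_mem_offD] with z hz
    have h1 : 1 ≤ |A.psiD z| ^ ε := Real.one_le_rpow (one_le_abs_psiD hz) (le_of_lt hε)
    rw [norm_div, Real.norm_of_nonneg (by linarith : 0 ≤ |A.psiD z| ^ ε)]
    exact div_le_self (norm_nonneg _) h1
  · filter_upwards [A.ae_mem_offD] with z hz
    have h1 : 0 < |A.psiD z| := by
      have := one_le_abs_psiD hz
      linarith
    have h2 : Tendsto (fun ε : ℝ => |A.psiD z| ^ ε) (𝓝[>] 0) (𝓝 1) := by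
      have := (Real.continuous_const_rpow h1.ne').tendsto 0
      rw [Real.rpow_zero] at this
      exact this.mono_left nhdsWithin_le_nhds
    have h3 := (tendsto_const_nhds (x := A.residueG ρ s g z)).div h2 one_ne_zero
    rw [div_one] at h3
    exact h3

lemma prod_Icc_sub_eq_factorial (k : ℕ) :
    ∏ j ∈ Finset.Icc 1 k, (((k + 1 : ℕ) : ℝ) - j) = k.factorial := by
  rw [← Finset.prod_range_add_one_eq_factorial, Nat.cast_prod]
  refine Finset.prod_nbij' (fun j => k - j) (fun j => k - j) ?_ ?_ ?_ ?_ ?_ <;>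
    intro j hj <;> simp only [Finset.mem_Icc, Finset.mem_range] at hj ⊢
  · omega
  · omega
  · omega
  · omega
  · rw [← Nat.cast_sub (by omega)]
    congr 1
    omega

lemma IsRegularDecomposition.tendsto_residue (hg : A.IsRegularDecomposition s f g)
    (hρ : A.IsCutoff ρ) (hs : 1 ≤ s) :
    Tendsto (fun ε : ℝ => ε * ∫ z in A.V, A.residueIntegrand ρ f ((s : ℝ) + ε) z) (𝓝[>] 0)
      (𝓝 (∑ P ∈ Finset.powersetCard s (Finset.univ : Finset (Fin m)),
        Real.pi ^ s / ((s - 1).factorial : ℝ) *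
          ∫ y in A.lcCentre P, A.lcIntegrand ρ P (g P) y)) := by
  obtain ⟨k, rfl⟩ : ∃ k, s = k + 1 := ⟨s - 1, by omega⟩
  have h1 : Tendsto (fun ε : ℝ => ∏ j ∈ Finset.Icc 1 k, (((k + 1 : ℕ) : ℝ) - j + ε)) (𝓝[>] 0)
      (𝓝 (k.factorial : ℝ)) := by
    have h2 : Continuous fun ε : ℝ => ∏ j ∈ Finset.Icc 1 k, (((k + 1 : ℕ) : ℝ) - j + ε) := by
      fun_prop
    have h3 := h2.tendsto 0
    simp only [add_zero] at h3
    rw [prod_Icc_sub_eq_factorial] at h3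
    exact h3.mono_left nhdsWithin_le_nhds
  have h2 := ((tendsto_const_nhds (x := (-1 : ℝ) ^ (k + 1))).div h1
    (by exact_mod_cast k.factorial_ne_zero)).mul (hg.tendsto_integral_residueG_div hρ)
  have h3 : (-1 : ℝ) ^ (k + 1) / (k.factorial : ℝ) * ∫ z in A.V, A.residueG ρ (k + 1) g z =
      ∑ P ∈ Finset.powersetCard (k + 1) (Finset.univ : Finset (Fin m)),
        Real.pi ^ (k + 1) / ((k + 1 - 1).factorial : ℝ) *
          ∫ y in A.lcCentre P, A.lcIntegrand ρ P (g P) y := by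
    rw [hg.integral_residueG hρ, ← Finset.mul_sum, Nat.add_sub_cancel]
    have h4 : (-1 : ℝ) ^ (k + 1) * (-1) ^ (k + 1) = 1 := by
      rw [← mul_pow]; simp
    linear_combination (Real.pi ^ (k + 1) / (k.factorial : ℝ) *
      ∑ P ∈ Finset.powersetCard (k + 1) (Finset.univ : Finset (Fin m)),
        ∫ y in A.lcCentre P, A.lcIntegrand ρ P (g P) y) * h4
  rw [h3] at h2
  refine h2.congr' ?_
  filter_upwards [self_mem_nhdsWithin] with ε hε
  have hε0 : ε ≠ 0 := (Set.mem_Ioi.1 hε).ne'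
  rw [(hg.integral_residueIntegrand hρ (σ := ((k + 1 : ℕ) : ℝ)) (ε := ε)
    (by linarith [Set.mem_Ioi.1 hε])).2, Finset.prod_Icc_succ_top (by omega), sub_self, zero_add,
    Pi.div_apply, ← mul_assoc]
  congr 1
  rw [← mul_div_assoc, mul_comm ε, mul_div_mul_right _ _ hε0]

lemma IsRegularDecomposition.lcIntegrand_nonneg (hg : A.IsRegularDecomposition s f g)
    (hP : P ∈ Finset.powersetCard s (Finset.univ : Finset (Fin m))) (hρ : ∀ z, 0 ≤ ρ z) :
    0 ≤ᵐ[volume.restrict (A.lcCentre P)] A.lcIntegrand ρ P (g P) := by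
  filter_upwards [hg.lcNormSq_nonneg hP] with y hy
  exact mul_nonneg (hρ _) hy

/-- Below the critical level the integral diverges: a finite value would bound the integrals at
the critical level uniformly, and the residue there would vanish. -/
lemma IsRegularDecomposition.lintegral_residueIntegrand_eq_top
    (hg : A.IsRegularDecomposition s f g) (hρ : A.IsCutoff ρ) (hρ0 : ∀ z, 0 ≤ ρ z)
    (hne : ∃ P ∈ Finset.powersetCard s (Finset.univ : Finset (Fin m)),
      ¬ ∀ᵐ x ∂(volume.restrict (A.lcCentre P)), A.lcIntegrand ρ P (g P) x = 0)
    (hs : 1 ≤ s) {τ : ℝ} (hτ : τ ≤ s) :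
    ∫⁻ z in A.V, ENNReal.ofReal (A.residueIntegrand ρ f τ z) = ⊤ := by
  by_contra hfin
  set C := (∫⁻ z in A.V, ENNReal.ofReal (A.residueIntegrand ρ f τ z)).toReal
  have h1 : ∀ δ : ℝ, 0 < δ → ∫ z in A.V, A.residueIntegrand ρ f ((s : ℝ) + δ) z ≤ C := by
    intro δ hδ
    have h2 := (hg.integral_residueIntegrand hρ (σ := (s : ℝ)) (ε := δ) (by linarith)).1
    rw [integral_eq_lintegral_of_nonneg_ae ?_ h2.1]
    · refine ENNReal.toReal_mono hfin (lintegral_mono_ae ?_)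
      filter_upwards [A.ae_mem_offD] with z hz
      refine ENNReal.ofReal_le_ofReal ?_
      have h3 := abs_residueIntegrand_le (ρ := ρ) (f := f) hz (show τ ≤ s + δ by linarith)
      rwa [abs_of_nonneg (residueIntegrand_nonneg hz.1 (hρ0 z) _),
        abs_of_nonneg (residueIntegrand_nonneg hz.1 (hρ0 z) _)] at h3
    · filter_upwards [A.ae_mem_offD] with z hz
      exact residueIntegrand_nonneg hz.1 (hρ0 z) _
  have h2 : Tendsto (fun δ : ℝ => δ * C) (𝓝[>] 0) (𝓝 0) := by
    have h3 : Tendsto (fun δ : ℝ => δ * C) (𝓝 0) (𝓝 (0 * C)) := tendsto_id.mul_const C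
    rw [zero_mul] at h3
    exact h3.mono_left nhdsWithin_le_nhds
  have h3 := le_of_tendsto_of_tendsto (hg.tendsto_residue hρ hs) h2 (by
    filter_upwards [self_mem_nhdsWithin] with δ hδ
    exact mul_le_mul_of_nonneg_left (h1 δ hδ) (le_of_lt hδ))
  refine absurd h3 (not_le.2 ?_)
  have h4 : ∀ P ∈ Finset.powersetCard s (Finset.univ : Finset (Fin m)),
      0 ≤ ∫ y in A.lcCentre P, A.lcIntegrand ρ P (g P) y := fun P hP =>
    integral_nonneg_of_ae (hg.lcIntegrand_nonneg hP hρ0)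
  obtain ⟨P, hP, hPne⟩ := hne
  have h5 : 0 < Real.pi ^ s / ((s - 1).factorial : ℝ) := by positivity
  refine Finset.sum_pos' (fun P hP => mul_nonneg h5.le (h4 P hP)) ⟨P, hP, mul_pos h5 ?_⟩
  refine (h4 P hP).lt_of_ne' fun h6 => hPne ?_
  exact (integral_eq_zero_iff_of_nonneg_ae (hg.lcIntegrand_nonneg hP hρ0)
    (hg.integral_lcIntegrand hρ hP).1).1 h6

lemma IsRegularDecomposition.tendsto_residue_zero (hg : A.IsRegularDecomposition s f g)
    (hρ : A.IsCutoff ρ) {σ : ℝ} (hσ : (s : ℝ) < σ) :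
    Tendsto (fun ε : ℝ => ε * ∫ z in A.V, A.residueIntegrand ρ f (σ + ε) z) (𝓝[>] 0) (𝓝 0) := by
  have h1 := (hg.integral_residueIntegrand hρ (σ := s) (ε := σ - s) (by linarith)).1
  rw [add_sub_cancel] at h1
  set C := ∫ z in A.V, ‖A.residueIntegrand ρ f σ z‖
  have h2 : Tendsto (fun ε : ℝ => ε * C) (𝓝[>] 0) (𝓝 0) := by
    have h3 : Tendsto (fun ε : ℝ => ε * C) (𝓝 0) (𝓝 (0 * C)) := tendsto_id.mul_const C
    rw [zero_mul] at h3
    exact h3.mono_left nhdsWithin_le_nhds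
  refine squeeze_zero_norm' ?_ h2
  filter_upwards [self_mem_nhdsWithin] with ε hε
  have hε' : 0 < ε := hε
  rw [norm_mul, Real.norm_of_nonneg hε'.le]
  refine mul_le_mul_of_nonneg_left ?_ hε'.le
  refine norm_integral_le_of_norm_le h1.norm ?_
  filter_upwards [A.ae_mem_offD] with z hz
  exact abs_residueIntegrand_le hz (by linarith)

lemma IsRegularDecomposition.tendsto_residue_level_zero (hg : A.IsRegularDecomposition 0 f g)
    (hρ : A.IsCutoff ρ) :
    Tendsto (fun ε : ℝ => ε * ∫ z in A.V, A.residueIntegrand ρ f (0 + ε) z) (𝓝[>] 0) (𝓝 0) := by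
  have h1 : Tendsto (fun ε : ℝ => ε) (𝓝[>] 0) (𝓝 0) := tendsto_id.mono_left nhdsWithin_le_nhds
  have h2 := h1.mul (hg.tendsto_integral_residueG_div hρ)
  rw [zero_mul] at h2
  refine h2.congr' ?_
  filter_upwards [self_mem_nhdsWithin] with ε hε
  have hε' : 0 < ε := hε
  rw [(hg.integral_residueIntegrand hρ (σ := 0) (ε := ε) (by simpa using hε')).2]
  simp

end AdmissiblePolydisc

end Limits

end

theorem theorem2p5 {m l q : ℕ} (A : AdmissiblePolydisc m l)
    (ρ : Coords m l → ℝ) (hρ : ContDiff ℝ ∞ ρ) (hρc : HasCompactSupport ρ)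
    (hρV : tsupport ρ ⊆ A.V)
    (f : Coords m l → AntiForm (m + l) q) (σf : ℕ) (hσf : A.IsMlcCodim f σf)
    (g : Finset (Fin m) → Coords m l → AntiForm (m + l) q)
    (hg : A.IsRegularDecomposition σf f g) :
    -- `G` is independent of `σ` and `ε` and has `L¹` coefficients
    IntegrableOn (A.residueG ρ σf g) A.V ∧
    -- the identity for `σ ≥ σ_f`
    (∀ σ ε : ℝ, (σf : ℝ) ≤ σ → 0 < ε →
      IntegrableOn (A.residueIntegrand ρ f (σ + ε)) A.V ∧
      IntegrableOn (fun z => A.residueG ρ σf g z / |A.psiD z| ^ (σ - σf + ε)) A.V ∧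
      ε * ∫ z in A.V, A.residueIntegrand ρ f (σ + ε) z =
        (-1) ^ σf * ε / (∏ j ∈ Finset.Icc 1 σf, (σ - j + ε)) *
          ∫ z in A.V, A.residueG ρ σf g z / |A.psiD z| ^ (σ - σf + ε)) ∧
    -- divergence for `0 ≤ σ < σ_f`
    ((∀ z, 0 ≤ ρ z) →
      (∃ P ∈ Finset.powersetCard σf (Finset.univ : Finset (Fin m)),
        ¬ ∀ᵐ x ∂(volume.restrict (A.lcCentre P)), A.lcIntegrand ρ P (g P) x = 0) →
      ∀ σ ε : ℝ, 0 ≤ σ → σ < σf → 0 < ε → ε ≤ σf - σ →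
        ENNReal.ofReal ε *
          ∫⁻ z in A.V, ENNReal.ofReal (A.residueIntegrand ρ f (σ + ε) z) = ⊤) ∧
    -- the limit when `σ > σ_f` or `σ = σ_f = 0`
    (∀ σ : ℝ, ((σf : ℝ) < σ ∨ (σ = σf ∧ σf = 0)) →
      Tendsto (fun ε : ℝ => ε * ∫ z in A.V, A.residueIntegrand ρ f (σ + ε) z)
        (𝓝[>] 0) (𝓝 0)) ∧
    -- the limit as a residue norm, for integers `σ ∈ [σ_f, m]`, `σ ≥ 1`
    (∀ s : ℕ, 1 ≤ s → σf ≤ s → s ≤ m →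
      ∀ g' : Finset (Fin m) → Coords m l → AntiForm (m + l) q,
        A.IsRegularDecomposition s f g' →
        (∀ P ∈ Finset.powersetCard s (Finset.univ : Finset (Fin m)),
          IntegrableOn (A.lcIntegrand ρ P (g' P)) (A.lcCentre P)) ∧
        Tendsto (fun ε : ℝ => ε * ∫ z in A.V, A.residueIntegrand ρ f ((s : ℝ) + ε) z)
          (𝓝[>] 0)
          (𝓝 (∑ P ∈ Finset.powersetCard s (Finset.univ : Finset (Fin m)),
            Real.pi ^ s / ((s - 1).factorial : ℝ) *
              ∫ x in A.lcCentre P, A.lcIntegrand ρ P (g' P) x))) := by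
  have hc : A.IsCutoff ρ := ⟨hρ, hρc, hρV⟩
  refine ⟨hg.integrableOn_residueG hc, fun σ ε hσ hε => ?_, fun hρ0 hne σ ε hσ hσ' hε hε' => ?_,
    fun σ hσ => ?_, fun s hs _ _ g' hg' => ⟨fun P hP => (hg'.integral_lcIntegrand hc hP).1,
      hg'.tendsto_residue hc hs⟩⟩
  · obtain ⟨h1, h2⟩ := hg.integral_residueIntegrand hc (σ := σ) (ε := ε) (by linarith)
    refine ⟨h1, hg.integrableOn_residueG_div hc (by linarith), ?_⟩
    rw [h2]
    ring
  · have h1 : 1 ≤ σf := by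
      have : (0 : ℝ) < σf := by linarith
      exact_mod_cast this
    rw [hg.lintegral_residueIntegrand_eq_top hc hρ0 hne h1 (by linarith),
      ENNReal.mul_top (ENNReal.ofReal_pos.2 hε).ne']
  · rcases hσ with hσ | ⟨rfl, rfl⟩
    · exact hg.tendsto_residue_zero hc hσ
    · simpa using hg.tendsto_residue_level_zero hc
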